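/- For a finite set $V$ and positive integers $m,k$, let $\mathcal K(V,m,k)$ be the uniform distribution on graphs with vertex set $V$, exactly $m$ edges and minimum degree at least $k$. Write $N_U(v)$ for the set of neighbours of $v$ in a vertex set $U$, and $\deg_U(v)=|N_U(v)|$. A pair of vertices $(u,v)$ in a graph is *$r$-joined* if $u\ne v$ and there is a path of length at most $r$ between $u$ and $v$, or if $u=v$ and there is a cycle of length at most $r$ containing $u$. **Lemma 8.1.** Fix an integer $k\ge 3$ and reals $\varepsilon>0$, $0<\alpha<1$ and $c,C>0$. There is $\Delta_0=\Delta_0(k,\varepsilon,\alpha,c,C)$ such that the following holds for every fixed $\Delta\ge\max(k,\Delta_0)$. Consider $n\in\mathbb N$, sets $S\subseteq V$ and an integer $m$ such that $cn\le |V|\le Cn$ and $\varepsilon n\le m-k|V|/2\le n/\varepsilon$ and $|S|=\lfloor \alpha|V|\rfloor$, and consider a random graph $G\sim\mathcal K(V,m,k)$. - Let $T=\{v\in S:\deg_G(v)\ge\Delta\}$. - Let $B_{\mathrm{bias}}\subseteq V\setminus T$ be the set of vertices of $V\setminus T$ which either satisfy $\deg_{V\setminus T}(v)<k$ or are within distance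 $2$ of such a vertex in $G[V\setminus T]$. - Let $T_{\mathrm{bad}}$ be the set of vertices appearing in a pair $(u,v)\in T^2$ which is $6$-joined in $G[T\cup B_{\mathrm{bias}}]$. - Let $E=V\setminus(B_{\mathrm{bias}}\cup S)$. - Let $T_{\mathrm{low}}=\{v\in T:\deg_E(v)<\sqrt\Delta\}$. - Let $T'=T\setminus(T_{\mathrm{bad}}\cup T_{\mathrm{low}})$. Then the following hold. 1. For every outcome of $G$ and every $U\subseteq V$ with $U\supseteq V\setminus T'$, the graph $G[U]$ has minimum degree at least $2$ and has no pair of distinct degree-$2$ vertices within distance $4$ of each other. 2. For every outcome of $G$, every $v\in T'$ has $\deg_E(v)\ge\sqrt\Delta$. 3. With high probability $|T'|\ge 7|T|/8$; that is, for every $\eta>0$ there is $N$ such that $\Pr(|T'|\ge 7|T|/8)\ge 1-\eta$ for all $n\ge N$ and all $V,S,m$ as above. 4. Condition on any outcome of the sets $T'$ and $E$, of the status of every edge not between $T'$ and $E$, and of the degrees $(\deg_E(v))_{v\in T'}$. Then, conditionally, for each $v\in T'$ the neighbourhood $N_E(v)$ is a uniformly random subset of $E$ of size $\deg_E(v)$,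 and these neighbourhoods are jointly independent over $v\in T'$. -/

import Mathlib

open MeasureTheory ProbabilityTheory

universe u

namespace Extraction

section

variable {V : Type u} [Fintype V]

/-- The graphs on the vertex set `V` with exactly `m` edges and minimum degree at least `k`. -/
def coreGraphs (V : Type u) [Fintype V] (m k : ℕ) : Set (SimpleGraph V) :=
  {G | G.edgeSet.ncard = m ∧ ∀ v, k ≤ (G.neighborSet v).ncard}

/-- The law `𝒦(V, m, k)`: the uniform distribution on the graphs with vertex set `V`, exactly `m`
edges and minimum degree at least `k`. -/
noncomputable def coreLaw (V : Type u) [Fintype V] (m k : ℕ) : Measure (SimpleGraph V) :=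
  uniformOn (coreGraphs V m k)

open Classical in
/-- The neighbourhood `N_U(v)` of `v` in the vertex set `U`. -/
noncomputable def nbhd (G : SimpleGraph V) (U : Finset V) (v : V) : Finset V :=
  {w ∈ U | G.Adj v w}

/-- The degree `deg_U(v)`, the number of neighbours of `v` in `U`. For `v ∈ U` this is the degree
of `v` in `G[U]`, and `deg_V(v)` is the degree of `v` in `G`. -/
noncomputable def degIn (G : SimpleGraph V) (U : Finset V) (v : V) : ℕ := (nbhd G U v).card

/-- `u` and `v` are within distance `r` in `G[U]`: there is a walk of length at most `r` between
them all of whose vertices lie in `U`. -/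
def WithinDist (G : SimpleGraph V) (U : Finset V) (r : ℕ) (u v : V) : Prop :=
  ∃ p : G.Walk u v, p.length ≤ r ∧ ∀ x ∈ p.support, x ∈ U

/-- `(u, v)` is `r`-joined in `G[U]`: either `u ≠ v` and there is a path of length at most `r`
in `G[U]` between them, or `u = v` and there is a cycle of length at most `r` in `G[U]` through
`u`. -/
def Joined (G : SimpleGraph V) (U : Finset V) (r : ℕ) (u v : V) : Prop :=
  (u ≠ v ∧ ∃ p : G.Walk u v, p.IsPath ∧ p.length ≤ r ∧ ∀ x ∈ p.support, x ∈ U) ∨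
  (u = v ∧ ∃ p : G.Walk u u, p.IsCycle ∧ p.length ≤ r ∧ ∀ x ∈ p.support, x ∈ U)

open Classical in
/-- `T`: the vertices of `S` which have degree at least `Δ` in `G`. -/
noncomputable def highSet (S : Finset V) (Δ : ℝ) (G : SimpleGraph V) : Finset V :=
  {v ∈ S | Δ ≤ (degIn G Finset.univ v : ℝ)}

open Classical in
/-- `B_bias`: the vertices of `V \ T` which are within distance 2 in `G[V \ T]` (possibly at
distance 0) of a vertex `w ∈ V \ T` with `deg_{V \ T}(w) < k`. -/
noncomputable def biasSet (S : Finset V) (Δ : ℝ) (k : ℕ) (G : SimpleGraph V) : Finset V :=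
  {v ∈ (highSet S Δ G)ᶜ | ∃ w ∈ (highSet S Δ G)ᶜ,
    degIn G (highSet S Δ G)ᶜ w < k ∧ WithinDist G (highSet S Δ G)ᶜ 2 v w}

open Classical in
/-- `T_bad`: the vertices appearing in a pair of `T²` which is 6-joined in `G[T ∪ B_bias]`. -/
noncomputable def badSet (S : Finset V) (Δ : ℝ) (k : ℕ) (G : SimpleGraph V) : Finset V :=
  {u ∈ highSet S Δ G | ∃ v ∈ highSet S Δ G,
    Joined G (highSet S Δ G ∪ biasSet S Δ k G) 6 u v}

open Classical in
/-- `E = V \ (B_bias ∪ S)`. -/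
noncomputable def freeSet (S : Finset V) (Δ : ℝ) (k : ℕ) (G : SimpleGraph V) : Finset V :=
  (biasSet S Δ k G ∪ S)ᶜ

open Classical in
/-- `T_low`: the vertices of `T` with fewer than `√Δ` neighbours in `E`. -/
noncomputable def lowSet (S : Finset V) (Δ : ℝ) (k : ℕ) (G : SimpleGraph V) : Finset V :=
  {v ∈ highSet S Δ G | (degIn G (freeSet S Δ k G) v : ℝ) < √Δ}

open Classical in
/-- `T' = T \ (T_bad ∪ T_low)`. -/
noncomputable def refinedSet (S : Finset V) (Δ : ℝ) (k : ℕ) (G : SimpleGraph V) : Finset V :=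
  highSet S Δ G \ (badSet S Δ k G ∪ lowSet S Δ k G)

/-- The event that the revealed information is the same as for the outcome `H`: the sets `T'` and
`E`, the status of every edge not between `T'` and `E`, and the degrees `deg_E(v)` of the
vertices `v ∈ T'`. -/
def revealed (S : Finset V) (Δ : ℝ) (k : ℕ) (H : SimpleGraph V) : Set (SimpleGraph V) :=
  {G | refinedSet S Δ k G = refinedSet S Δ k H ∧
    freeSet S Δ k G = freeSet S Δ k H ∧
    (∀ u v, ¬ (u ∈ refinedSet S Δ k H ∧ v ∈ freeSet S Δ k H) →
      ¬ (v ∈ refinedSet S Δ k H ∧ u ∈ freeSet S Δ k H) → (G.Adj u v ↔ H.Adj u v)) ∧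
    ∀ v ∈ refinedSet S Δ k H,
      degIn G (freeSet S Δ k H) v = degIn H (freeSet S Δ k H) v}

/-- The standing assumptions on `V`, `S` and `m` relative to `n`, where `c` and `C` are the implied
constants in `|V| = Θ(n)`. -/
def Admissible (k : ℕ) (ε α c C : ℝ) (n : ℕ) (S : Finset V) (m : ℕ) : Prop :=
  c * n ≤ (Fintype.card V : ℝ) ∧ (Fintype.card V : ℝ) ≤ C * n ∧
  ε * n ≤ (m : ℝ) - k * (Fintype.card V : ℝ) / 2 ∧
  (m : ℝ) - k * (Fintype.card V : ℝ) / 2 ≤ n / ε ∧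
  S.card = ⌊α * (Fintype.card V : ℝ)⌋₊

end

end Extraction

open Extraction

/-!
The structural claims are deterministic. A vertex whose degree drops below `k` when part of `T'`
is deleted lies in `B_bias` and has exactly one neighbour in the deleted part, because two
neighbours in `T'` would be 6-joined. Two vertices of degree `2` close to each other would
therefore connect their deleted neighbours by a short path or cycle inside `T ∪ B_bias`
(`minDegree_and_separation`). The sets of the construction do not change when the edges between
`T'` and `E` are redistributed with prescribed degrees into `E` on `T'`, since every vertex of `E`
has at least `k` neighbours outside `T` (`sets_eq_of_agreeOff`). Hence the conditional law is
uniform on a product of families of sets (`nbhd_indep_uniform`).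

That `T'` is most of `T` is proved by switchings in the model with exactly `m` edges: a move deletes
some edges and inserts others, and counting the moves in both directions
(`card_mul_le_card_mul_of_moves`) bounds the probability that given patterns are present
simultaneously. A `j`-th moment argument (`card_many_present_mul_le`) turns such bounds into bounds
for the probability that many patterns are present. As `j` is arbitrary, a constant factor between
the expected and the allowed number of patterns suffices, and no pattern has more than a small power
of the maximum degree of conflicts with others.

* Stars with `r` leaves whose centre can afford to lose them have probability `O(n ^ (-r))`
  (`card_stars_le`). With `r = 17` this bounds the maximum degree by `n ^ (1 / 16)`, and with `r = 3`
  it bounds the third moment of the degrees by `O(n)`; so the squares of the degrees of at least `Δ`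
  sum to `O(n / Δ)` (`sum_sq_large_le`).
* A positive proportion of `S` has degree at least `Δ`, since raising the degree of a vertex by one
  costs only a constant factor (`card_lowEvent_cons_le`).
* For a given degree sequence an edge `xy` appears with probability at most about
  `d x * d y / (2 * m)` (`card_edgesEvent_cons_mul_le`), even given other edges. Summed over the
  possible trails of length at most `6` between two vertices of `T`, or from a vertex of `T` back to
  itself, this is `O(|T| / Δ)`. The vertices of `T_bad` lie on such trails.
* For a vertex of `T` off these trails all its neighbours outside `S` of degree above `k` are in `E`
  (`goodNbrs_subset_nbhd_freeSet`). It has fewer than `√Δ` of them with probability `O(1 / √Δ)`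
  only: a neighbour can be exchanged for a new one outside `S` in a way that raises the degree of the
  latter, and this can be done at each of its `Δ` edges but undone at fewer than `√Δ + 1`
  (`card_fewGoodEvent_cons_mul_le`).
-/

set_option linter.unusedSectionVars false

namespace Extraction

/-! ### Degrees and distances in the refined graph -/

section Deterministic

open scoped Classical

variable {V : Type u} [Fintype V]

lemma mem_nbhd {G : SimpleGraph V} {U : Finset V} {v w : V} :
    w ∈ nbhd G U v ↔ w ∈ U ∧ G.Adj v w := by
  simp [nbhd]

lemma nbhd_mono {G : SimpleGraph V} {U W : Finset V} {v : V}
    (h : ∀ w ∈ U, G.Adj v w → w ∈ W) : nbhd G U v ⊆ nbhd G W v := by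
  intro w hw
  rw [mem_nbhd] at hw ⊢
  exact ⟨h w hw.1 hw.2, hw.2⟩

lemma ncard_neighborSet (G : SimpleGraph V) (v : V) :
    (G.neighborSet v).ncard = degIn G Finset.univ v := by
  rw [degIn, ← Set.ncard_coe_finset]
  congr 1
  ext w
  simp [mem_nbhd]

lemma mem_highSet {S : Finset V} {Δ : ℝ} {G : SimpleGraph V} {v : V} :
    v ∈ highSet S Δ G ↔ v ∈ S ∧ Δ ≤ (degIn G Finset.univ v : ℝ) := by
  simp [highSet]

lemma mem_biasSet {S : Finset V} {Δ : ℝ} {k : ℕ} {G : SimpleGraph V} {v : V} :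
    v ∈ biasSet S Δ k G ↔ v ∉ highSet S Δ G ∧ ∃ w, w ∉ highSet S Δ G ∧
      degIn G (highSet S Δ G)ᶜ w < k ∧ WithinDist G (highSet S Δ G)ᶜ 2 v w := by
  simp [biasSet]

lemma mem_badSet {S : Finset V} {Δ : ℝ} {k : ℕ} {G : SimpleGraph V} {u : V} :
    u ∈ badSet S Δ k G ↔ u ∈ highSet S Δ G ∧ ∃ v ∈ highSet S Δ G,
      Joined G (highSet S Δ G ∪ biasSet S Δ k G) 6 u v := by
  simp [badSet]

lemma mem_freeSet {S : Finset V} {Δ : ℝ} {k : ℕ} {G : SimpleGraph V} {v : V} :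
    v ∈ freeSet S Δ k G ↔ v ∉ biasSet S Δ k G ∧ v ∉ S := by
  simp [freeSet]

lemma mem_lowSet {S : Finset V} {Δ : ℝ} {k : ℕ} {G : SimpleGraph V} {v : V} :
    v ∈ lowSet S Δ k G ↔ v ∈ highSet S Δ G ∧ (degIn G (freeSet S Δ k G) v : ℝ) < √Δ := by
  simp [lowSet]

lemma mem_refinedSet {S : Finset V} {Δ : ℝ} {k : ℕ} {G : SimpleGraph V} {v : V} :
    v ∈ refinedSet S Δ k G ↔
      v ∈ highSet S Δ G ∧ v ∉ badSet S Δ k G ∧ v ∉ lowSet S Δ k G := by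
  simp [refinedSet]

lemma joined_of_walk {G : SimpleGraph V} {U : Finset V} {r : ℕ} {u v : V} (huv : u ≠ v)
    (p : G.Walk u v) (hl : p.length ≤ r) (hU : ∀ x ∈ p.support, x ∈ U) : Joined G U r u v := by
  exact Or.inl ⟨huv, p.bypass, p.bypass_isPath, p.length_bypass_le_length.trans hl,
    fun x hx => hU x (p.support_bypass_subset_support hx)⟩

/-- A path together with a vertex outside it that is adjacent to both of its (distinct) ends
closes up to a cycle. -/
lemma joined_of_path {G : SimpleGraph V} {U : Finset V} {r : ℕ} {a u v : V} (huv : u ≠ v)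
    (hu : G.Adj a u) (hv : G.Adj a v) (p : G.Walk u v) (hp : p.IsPath) (hl : p.length + 2 ≤ r)
    (ha : a ∉ p.support) (haU : a ∈ U) (hU : ∀ x ∈ p.support, x ∈ U) : Joined G U r a a := by
  refine Or.inr ⟨rfl, SimpleGraph.Walk.cons hu (p.concat hv.symm), ?_, ?_, ?_⟩
  · rw [SimpleGraph.Walk.cons_isCycle_iff]
    refine ⟨hp.concat ha _, ?_⟩
    rw [SimpleGraph.Walk.edges_concat]
    intro h
    simp only [List.concat_eq_append, List.mem_append, List.mem_singleton] at h
    rcases h with h | h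
    · exact ha (p.fst_mem_support_of_mem_edges h)
    · rw [Sym2.eq_swap, Sym2.congr_left] at h
      exact huv h
  · simp; omega
  · intro x hx
    simp [SimpleGraph.Walk.support_concat] at hx
    aesop

section Degrees

variable {S : Finset V} {Δ : ℝ} {k : ℕ} {G : SimpleGraph V} {U : Finset V}

lemma not_joined_of_mem_refinedSet {v w : V} (hv : v ∈ refinedSet S Δ k G)
    (hw : w ∈ highSet S Δ G) : ¬ Joined G (highSet S Δ G ∪ biasSet S Δ k G) 6 v w := by
  intro h
  exact (mem_refinedSet.1 hv).2.1 (mem_badSet.2 ⟨(mem_refinedSet.1 hv).1, w, hw, h⟩)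

lemma not_adj_of_mem_refinedSet {v w : V} (hv : v ∈ refinedSet S Δ k G)
    (hw : w ∈ highSet S Δ G) : ¬ G.Adj v w := by
  intro h
  refine not_joined_of_mem_refinedSet hv hw (joined_of_walk h.ne h.toWalk (by simp) ?_)
  have := (mem_refinedSet.1 hv).1
  simp; tauto

lemma mem_biasSet_self {v : V} (hv : v ∉ highSet S Δ G)
    (hd : degIn G (highSet S Δ G)ᶜ v < k) : v ∈ biasSet S Δ k G :=
  mem_biasSet.2 ⟨hv, v, hv, hd, SimpleGraph.Walk.nil, by simp, by simpa using hv⟩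

/-- A vertex of `B_bias` has at most one neighbour in `T'`. -/
lemma eq_of_adj_refinedSet {v a b : V} (hv : v ∈ biasSet S Δ k G)
    (ha : a ∈ refinedSet S Δ k G) (hb : b ∈ refinedSet S Δ k G) (hav : G.Adj v a)
    (hbv : G.Adj v b) : a = b := by
  by_contra hab
  have hb' := (mem_refinedSet.1 hb).1
  refine not_joined_of_mem_refinedSet ha hb' (joined_of_walk hab
    (SimpleGraph.Walk.cons hav.symm hbv.toWalk) (by simp) ?_)
  have := (mem_refinedSet.1 ha).1
  simp; tauto

lemma degree_of_mem_highSet (hG : ∀ v, k ≤ degIn G Finset.univ v)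
    (hU : ∀ v, v ∉ refinedSet S Δ k G → v ∈ U) {v : V} (hv : v ∈ highSet S Δ G) :
    k ≤ degIn G U v := by
  refine (hG v).trans (Finset.card_le_card (nbhd_mono fun w _ hw => hU w fun hw' => ?_))
  exact not_adj_of_mem_refinedSet hw' hv hw.symm

lemma degIn_compl_highSet_le (hU : ∀ v, v ∉ refinedSet S Δ k G → v ∈ U) (v : V) :
    degIn G (highSet S Δ G)ᶜ v ≤ degIn G U v := by
  refine Finset.card_le_card (nbhd_mono fun w hw _ => hU w fun hw' => ?_)
  exact (Finset.mem_compl.1 hw) (mem_refinedSet.1 hw').1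

/-- In a graph of minimum degree `k`, a vertex of degree less than `k` in `G[U]` lies in `B_bias`,
has exactly one neighbour outside `U`, and that neighbour lies in `T'`. -/
lemma exists_adj_of_degIn_lt (hG : ∀ v, k ≤ degIn G Finset.univ v)
    (hU : ∀ v, v ∉ refinedSet S Δ k G → v ∈ U) {v : V} (hd : degIn G U v < k) :
    v ∈ biasSet S Δ k G ∧ degIn G (highSet S Δ G)ᶜ v < k ∧ k ≤ degIn G U v + 1 ∧
      ∃ a ∈ refinedSet S Δ k G, a ∉ U ∧ G.Adj a v := by
  have hT : v ∉ highSet S Δ G := fun h => absurd (degree_of_mem_highSet hG hU h) (by omega)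
  have hc := (degIn_compl_highSet_le (S := S) (Δ := Δ) hU v).trans_lt hd
  have hB := mem_biasSet_self hT hc
  obtain ⟨a, ha, haU⟩ : ∃ a ∈ nbhd G Finset.univ v, a ∉ nbhd G U v := by
    by_contra! h
    exact absurd ((hG v).trans (Finset.card_le_card h)) (not_le.2 hd)
  rw [mem_nbhd] at ha haU
  have haU' : a ∉ U := fun h => haU ⟨h, ha.2⟩
  have haT : a ∈ refinedSet S Δ k G := by
    by_contra h
    exact haU' (hU a h)
  refine ⟨hB, hc, ?_, a, haT, haU', ha.2.symm⟩
  have : nbhd G Finset.univ v ⊆ insert a (nbhd G U v) := by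
    intro b hb
    rw [mem_nbhd] at hb
    rw [Finset.mem_insert, mem_nbhd]
    by_cases hbU : b ∈ U
    · exact Or.inr ⟨hbU, hb.2⟩
    · left
      have hbT : b ∈ refinedSet S Δ k G := by
        by_contra h
        exact hbU (hU b h)
      exact eq_of_adj_refinedSet hB hbT haT hb.2 ha.2
  exact (hG v).trans ((Finset.card_le_card this).trans (Finset.card_insert_le _ _))

/-- A walk of length at most `2` in `G[U]` starting from a vertex of deficient degree stays in
`B_bias`: a vertex of `T` on it would be joined to the neighbour in `T'` of its start. -/
lemma mem_biasSet_of_walk {u a x : V} (huB : u ∈ biasSet S Δ k G)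
    (hd : degIn G (highSet S Δ G)ᶜ u < k) (ha : a ∈ refinedSet S Δ k G) (haU : a ∉ U)
    (hau : G.Adj a u) (p : G.Walk u x) (hl : p.length ≤ 2) (hp : ∀ y ∈ p.support, y ∈ U) :
    x ∈ biasSet S Δ k G := by
  have haT := (mem_refinedSet.1 ha).1
  have huT := (mem_biasSet.1 huB).1
  have key1 : ∀ y, G.Adj u y → y ∈ U → y ∈ biasSet S Δ k G := by
    intro y huy hy
    have hyT : y ∉ highSet S Δ G := by
      intro hyT
      refine not_joined_of_mem_refinedSet ha hyT (joined_of_walk (fun h => haU (h ▸ hy))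
        (SimpleGraph.Walk.cons hau huy.toWalk) (by simp) ?_)
      simp; tauto
    refine mem_biasSet.2 ⟨hyT, u, huT, hd, huy.symm.toWalk, by simp, ?_⟩
    simp; tauto
  match p, hl, hp with
  | .nil, _, _ => exact huB
  | .cons h1 .nil, _, hp => exact key1 _ h1 (hp _ (by simp))
  | .cons (v := y) h1 (.cons h2 .nil), _, hp =>
    have hy := key1 _ h1 (hp _ (by simp))
    have hx : x ∈ U := hp _ (by simp)
    have hyT := (mem_biasSet.1 hy).1
    have hxT : x ∉ highSet S Δ G := by
      intro hxT
      refine not_joined_of_mem_refinedSet ha hxT (joined_of_walk (fun h => haU (h ▸ hx))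
        (SimpleGraph.Walk.cons hau (.cons h1 (.cons h2 .nil))) (by simp) ?_)
      simp [haT, huB, hy, hxT]
    refine mem_biasSet.2 ⟨hxT, u, huT, hd, .cons h2.symm (.cons h1.symm .nil), by simp, ?_⟩
    simp [huT, hyT, hxT]
  | .cons h1 (.cons h2 (.cons h3 q)), hl, _ => simp at hl

/-- Two vertices of degree `2` within distance `4` in `G[U]` would be deficient. The first half of
a path between them stays in `B_bias` by its first end, the second half by its last, so the whole
path does; their neighbours in `T'` outside `U` would then be joined by a path, or closed to a
cycle if they coincide, of length at most `6` in `G[T ∪ B_bias]`. -/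
theorem minDegree_and_separation (hk : 3 ≤ k) (hG : ∀ v, k ≤ degIn G Finset.univ v)
    (hU : ∀ v, v ∉ refinedSet S Δ k G → v ∈ U) :
    (∀ v ∈ U, 2 ≤ degIn G U v) ∧
      ∀ u ∈ U, ∀ v ∈ U, u ≠ v → degIn G U u = 2 → degIn G U v = 2 →
        ¬ WithinDist G U 4 u v := by
  constructor
  · intro v _
    by_contra! h
    have := (exists_adj_of_degIn_lt hG hU (v := v) (by omega)).2.2.1
    omega
  · rintro u - v - huv hu hv ⟨q, hql, hqU⟩
    obtain ⟨huB, hud, -, a, ha, haU, hau⟩ := exists_adj_of_degIn_lt hG hU (v := u) (by omega)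
    obtain ⟨hvB, hvd, -, b, hb, hbU, hbv⟩ := exists_adj_of_degIn_lt hG hU (v := v) (by omega)
    set p := q.bypass with hp
    have hpl : p.length ≤ 4 := q.length_bypass_le_length.trans hql
    have hpU : ∀ x ∈ p.support, x ∈ U := fun x hx => hqU x (q.support_bypass_subset_support hx)
    have hpB : ∀ x ∈ p.support, x ∈ biasSet S Δ k G := by
      intro x hx
      have hlen : (p.takeUntil x hx).length + (p.dropUntil x hx).length = p.length := by
        rw [← SimpleGraph.Walk.length_append, SimpleGraph.Walk.take_spec]
      by_cases h : (p.takeUntil x hx).length ≤ 2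
      · exact mem_biasSet_of_walk huB hud ha haU hau _ h
          fun y hy => hpU y (p.support_takeUntil_subset_support hx hy)
      · refine mem_biasSet_of_walk hvB hvd hb hbU hbv (p.dropUntil x hx).reverse
          (by rw [SimpleGraph.Walk.length_reverse]; omega) fun y hy => hpU y ?_
        rw [SimpleGraph.Walk.support_reverse, List.mem_reverse] at hy
        exact p.support_dropUntil_subset_support hx hy
    have haT := (mem_refinedSet.1 ha).1
    have hbT := (mem_refinedSet.1 hb).1
    by_cases hab : a = b
    · subst hab
      refine not_joined_of_mem_refinedSet ha haT (joined_of_path huv hau hbv p q.bypass_isPath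
        (by omega) (fun h => haU (hpU a h)) (Finset.mem_union_left _ haT) fun x hx =>
          Finset.mem_union_right _ (hpB x hx))
    · refine not_joined_of_mem_refinedSet ha hbT (joined_of_walk hab
        (SimpleGraph.Walk.cons hau (p.concat hbv.symm)) (by simp; omega) fun x hx => ?_)
      simp [SimpleGraph.Walk.support_concat] at hx
      rw [Finset.mem_union]
      rcases hx with rfl | hx | rfl
      · exact Or.inl haT
      · exact Or.inr (hpB x hx)
      · exact Or.inl hbT

theorem sqrt_le_degIn_freeSet {v : V} (hv : v ∈ refinedSet S Δ k G) :
    √Δ ≤ (degIn G (freeSet S Δ k G) v : ℝ) := by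
  by_contra! h
  exact (mem_refinedSet.1 hv).2.2 (mem_lowSet.2 ⟨(mem_refinedSet.1 hv).1, h⟩)

end Degrees

end Deterministic

/-! ### Resampling the edges between `T'` and `E` -/

section Resampling

open scoped Classical

variable {V : Type u} [Fintype V]

lemma degIn_univ_eq_degree (G : SimpleGraph V) (v : V) : degIn G Finset.univ v = G.degree v := by
  rw [degIn, ← SimpleGraph.card_neighborFinset_eq_degree]
  congr 1
  ext w
  simp [mem_nbhd]

lemma sum_degIn (G : SimpleGraph V) : ∑ v, degIn G Finset.univ v = 2 * G.edgeSet.ncard := by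
  simp_rw [degIn_univ_eq_degree]
  rw [SimpleGraph.sum_degrees_eq_twice_card_edges, ← Set.ncard_coe_finset,
    SimpleGraph.coe_edgeFinset]

lemma mem_coreGraphs {m k : ℕ} {G : SimpleGraph V} :
    G ∈ coreGraphs V m k ↔ G.edgeSet.ncard = m ∧ ∀ v, k ≤ degIn G Finset.univ v := by
  simp [coreGraphs, ncard_neighborSet]

lemma degIn_add_degIn_compl (G : SimpleGraph V) (U : Finset V) (v : V) :
    degIn G U v + degIn G Uᶜ v = degIn G Finset.univ v := by
  rw [degIn, degIn, degIn, ← Finset.card_union_of_disjoint]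
  · congr 1
    ext w
    simp only [Finset.mem_union, mem_nbhd, Finset.mem_compl, Finset.mem_univ, true_and]
    tauto
  · rw [Finset.disjoint_left]
    intro w h1 h2
    rw [mem_nbhd] at h1 h2
    exact (Finset.mem_compl.1 h2.1) h1.1

lemma nbhd_congr {G H : SimpleGraph V} {U : Finset V} {v : V}
    (h : ∀ w ∈ U, (G.Adj v w ↔ H.Adj v w)) : nbhd G U v = nbhd H U v := by
  ext w
  rw [mem_nbhd, mem_nbhd]
  exact and_congr_right fun hw => h w hw

lemma mem_edgeSet_of_walk {G H : SimpleGraph V} {U : Finset V}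
    (h : ∀ u ∈ U, ∀ v ∈ U, (G.Adj u v → H.Adj u v)) {u v : V} (p : G.Walk u v)
    (hp : ∀ x ∈ p.support, x ∈ U) : ∀ e ∈ p.edges, e ∈ H.edgeSet := by
  intro e he
  induction e with
  | h x y =>
    exact h x (hp x (p.fst_mem_support_of_mem_edges he)) y
      (hp y (p.snd_mem_support_of_mem_edges he)) (p.adj_of_mem_edges he)

lemma WithinDist.of_agree {G H : SimpleGraph V} {U : Finset V} {r : ℕ}
    (h : ∀ u ∈ U, ∀ v ∈ U, (G.Adj u v → H.Adj u v)) {u v : V} (hG : WithinDist G U r u v) :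
    WithinDist H U r u v := by
  obtain ⟨p, hl, hp⟩ := hG
  exact ⟨p.transfer H (mem_edgeSet_of_walk h p hp), by simpa using hl, by simpa using hp⟩

lemma Joined.of_agree {G H : SimpleGraph V} {U : Finset V} {r : ℕ}
    (h : ∀ u ∈ U, ∀ v ∈ U, (G.Adj u v → H.Adj u v)) {u v : V} (hG : Joined G U r u v) :
    Joined H U r u v := by
  rcases hG with ⟨huv, p, hpp, hl, hp⟩ | ⟨huv, p, hpp, hl, hp⟩
  · exact Or.inl ⟨huv, p.transfer H (mem_edgeSet_of_walk h p hp), hpp.transfer _,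
      by simpa using hl, by simpa using hp⟩
  · exact Or.inr ⟨huv, p.transfer H (mem_edgeSet_of_walk h p hp), hpp.transfer _,
      by simpa using hl, by simpa using hp⟩

lemma withinDist_congr {G H : SimpleGraph V} {U : Finset V} {r : ℕ}
    (h : ∀ u ∈ U, ∀ v ∈ U, (G.Adj u v ↔ H.Adj u v)) {u v : V} :
    WithinDist G U r u v ↔ WithinDist H U r u v :=
  ⟨fun hG => hG.of_agree fun a ha b hb => (h a ha b hb).1,
    fun hH => hH.of_agree fun a ha b hb => (h a ha b hb).2⟩

lemma joined_congr {G H : SimpleGraph V} {U : Finset V} {r : ℕ}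
    (h : ∀ u ∈ U, ∀ v ∈ U, (G.Adj u v ↔ H.Adj u v)) {u v : V} :
    Joined G U r u v ↔ Joined H U r u v :=
  ⟨fun hG => hG.of_agree fun a ha b hb => (h a ha b hb).1,
    fun hH => hH.of_agree fun a ha b hb => (h a ha b hb).2⟩

/-- `G` and `H` have the same edges, except possibly between `X` and `E`. -/
def AgreeOff (X E : Finset V) (G H : SimpleGraph V) : Prop :=
  ∀ u v, ¬ (u ∈ X ∧ v ∈ E) → ¬ (v ∈ X ∧ u ∈ E) → (G.Adj u v ↔ H.Adj u v)

lemma sum_degIn_comm (G : SimpleGraph V) (X E : Finset V) :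
    ∑ v ∈ X, degIn G E v = ∑ v ∈ E, degIn G X v := by
  have := Finset.sum_card_bipartiteAbove_eq_sum_card_bipartiteBelow G.Adj (s := X) (t := E)
  refine Eq.trans (Finset.sum_congr rfl fun v _ => ?_) (this.trans
    (Finset.sum_congr rfl fun v _ => ?_))
  · rw [degIn]
    congr 1
  · rw [degIn]
    congr 1
    ext w
    simp [mem_nbhd, Finset.mem_bipartiteBelow, G.adj_comm]

section Agree

variable {S : Finset V} {Δ : ℝ} {k m : ℕ} {G H : SimpleGraph V}

lemma refinedSet_subset : refinedSet S Δ k H ⊆ highSet S Δ H :=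
  fun _ h => (mem_refinedSet.1 h).1

lemma not_mem_freeSet_of_mem_highSet {v : V} (hv : v ∈ highSet S Δ H) : v ∉ freeSet S Δ k G :=
  fun h => (mem_freeSet.1 h).2 (mem_highSet.1 hv).1

/-- Redistributing the edges between `T'` and `E` while keeping the degrees into `E` of the
vertices of `T'` changes none of the sets of the construction, and keeps the number of edges and
the minimum degree condition: the vertices of `E` have enough neighbours outside `T`. -/
theorem sets_eq_of_agreeOff (hH : H ∈ coreGraphs V m k)
    (hA : AgreeOff (refinedSet S Δ k H) (freeSet S Δ k H) G H)
    (hd : ∀ v ∈ refinedSet S Δ k H,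
      degIn G (freeSet S Δ k H) v = degIn H (freeSet S Δ k H) v) :
    G ∈ coreGraphs V m k ∧ refinedSet S Δ k G = refinedSet S Δ k H ∧
      freeSet S Δ k G = freeSet S Δ k H := by
  set X := refinedSet S Δ k H with hX
  set E := freeSet S Δ k H with hE
  rw [mem_coreGraphs] at hH
  have hXT : ∀ v ∈ X, v ∈ highSet S Δ H := fun v hv => refinedSet_subset hv
  have hTE : ∀ v ∈ highSet S Δ H, v ∉ E := fun v hv => not_mem_freeSet_of_mem_highSet hv
  have hTS : ∀ v ∈ highSet S Δ H, v ∈ S := fun v hv => (mem_highSet.1 hv).1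
  have hES : ∀ v ∈ E, v ∉ S := fun v hv => (mem_freeSet.1 hv).2
  have hnb : ∀ U v, v ∉ X → v ∉ E → nbhd G U v = nbhd H U v := fun U v h1 h2 =>
    nbhd_congr fun w _ => hA v w (fun h => h1 h.1) (fun h => h2 h.2)
  have hdegX : ∀ v, v ∉ E → degIn G Finset.univ v = degIn H Finset.univ v := by
    intro v hvE
    by_cases hvX : v ∈ X
    · rw [← degIn_add_degIn_compl G E, ← degIn_add_degIn_compl H E, hd v hvX]
      congr 1
      rw [degIn, degIn, nbhd_congr]
      intro w hw
      exact hA v w (fun h => Finset.mem_compl.1 hw h.2) (fun h => hvE h.2)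
    · rw [degIn, degIn, hnb _ v hvX hvE]
  have hT : highSet S Δ G = highSet S Δ H := by
    ext v
    rw [mem_highSet, mem_highSet]
    refine and_congr_right fun hv => ?_
    rw [hdegX v fun h => hES v h hv]
  have hcompl : ∀ u ∈ (highSet S Δ H)ᶜ, ∀ v ∈ (highSet S Δ H)ᶜ, (G.Adj u v ↔ H.Adj u v) := by
    intro u hu v hv
    rw [Finset.mem_compl] at hu hv
    exact hA u v (fun h => hu (hXT u h.1)) (fun h => hv (hXT v h.1))
  have hdc : ∀ v ∈ (highSet S Δ H)ᶜ,
      degIn G (highSet S Δ H)ᶜ v = degIn H (highSet S Δ H)ᶜ v := by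
    intro v hv
    rw [degIn, degIn, nbhd_congr fun w hw => hcompl v hv w hw]
  have hB : biasSet S Δ k G = biasSet S Δ k H := by
    ext v
    rw [mem_biasSet, mem_biasSet, hT]
    refine and_congr_right fun _ => exists_congr fun w => and_congr_right fun hw => ?_
    rw [hdc w (Finset.mem_compl.2 hw), withinDist_congr hcompl]
  have hF : freeSet S Δ k G = E := by
    ext v
    rw [hE, mem_freeSet, mem_freeSet, hB]
  have hTB : ∀ u ∈ highSet S Δ H ∪ biasSet S Δ k H, u ∉ E := by
    intro u hu
    rcases Finset.mem_union.1 hu with h | h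
    · exact hTE u h
    · exact fun h' => (mem_freeSet.1 h').1 h
  have hbad : badSet S Δ k G = badSet S Δ k H := by
    ext v
    rw [mem_badSet, mem_badSet, hT, hB]
    refine and_congr_right fun _ => exists_congr fun w => and_congr_right fun _ => ?_
    exact joined_congr fun a ha b hb =>
      hA a b (fun h => hTB b hb h.2) (fun h => hTB a ha h.2)
  have hlow : lowSet S Δ k G = lowSet S Δ k H := by
    ext v
    rw [mem_lowSet, mem_lowSet, hT, hF]
    refine and_congr_right fun hv => ?_
    by_cases hvX : v ∈ X
    · rw [hd v hvX]
    · rw [degIn, degIn, hnb _ v hvX (hTE v hv)]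
  refine ⟨?_, ?_, hF⟩
  · rw [mem_coreGraphs]
    constructor
    · have h1 := sum_degIn G
      have h2 := sum_degIn H
      rw [hH.1] at h2
      rw [← Finset.sum_add_sum_compl E] at h1 h2
      have h3 : ∑ v ∈ Eᶜ, degIn G Finset.univ v = ∑ v ∈ Eᶜ, degIn H Finset.univ v :=
        Finset.sum_congr rfl fun v hv => hdegX v (Finset.mem_compl.1 hv)
      have h4 : ∑ v ∈ E, degIn G Finset.univ v = ∑ v ∈ E, degIn H Finset.univ v := by
        simp_rw [← degIn_add_degIn_compl _ X, Finset.sum_add_distrib]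
        rw [← sum_degIn_comm G, ← sum_degIn_comm H, Finset.sum_congr rfl fun v hv => hd v hv]
        congr 1
        refine Finset.sum_congr rfl fun v hv => ?_
        rw [degIn, degIn, nbhd_congr]
        intro w hw
        exact hA v w (fun h => hTE v (hXT v h.1) hv) (fun h => Finset.mem_compl.1 hw h.1)
      omega
    · intro v
      by_cases hvE : v ∈ E
      · have hvT : v ∈ (highSet S Δ H)ᶜ := Finset.mem_compl.2 fun h => hTE v h hvE
        have : k ≤ degIn G (highSet S Δ H)ᶜ v := by
          rw [hdc v hvT]
          by_contra! h
          exact (mem_freeSet.1 hvE).1 (mem_biasSet_self (Finset.mem_compl.1 hvT) h)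
        have h2 := degIn_add_degIn_compl G (highSet S Δ H) v
        omega
      · rw [hdegX v hvE]
        exact hH.2 v
  · rw [refinedSet, hT, hbad, hlow]
    rfl

lemma mem_revealed_inter (hH : H ∈ coreGraphs V m k) :
    G ∈ coreGraphs V m k ∩ revealed S Δ k H ↔
      AgreeOff (refinedSet S Δ k H) (freeSet S Δ k H) G H ∧
      ∀ v ∈ refinedSet S Δ k H,
        degIn G (freeSet S Δ k H) v = degIn H (freeSet S Δ k H) v := by
  constructor
  · rintro ⟨-, -, -, h1, h2⟩
    exact ⟨h1, h2⟩
  · rintro ⟨h1, h2⟩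
    obtain ⟨h3, h4, h5⟩ := sets_eq_of_agreeOff hH h1 h2
    exact ⟨h3, h4, h5, h1, h2⟩

/-- The graph obtained from `H` by replacing the edges between `X` and `E` by those joining each
`v ∈ X` to the vertices of `N v`. -/
def resample (X E : Finset V) (H : SimpleGraph V) (N : {v // v ∈ X} → Finset V) :
    SimpleGraph V :=
  SimpleGraph.fromRel fun u v =>
    (H.Adj u v ∧ ¬ (u ∈ X ∧ v ∈ E) ∧ ¬ (v ∈ X ∧ u ∈ E)) ∨ ∃ h : u ∈ X, v ∈ N ⟨u, h⟩

lemma resample_agreeOff {X E : Finset V} {N : {v // v ∈ X} → Finset V}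
    (hN : ∀ v, N v ⊆ E) : AgreeOff X E (resample X E H N) H := by
  intro u v h1 h2
  rw [resample, SimpleGraph.fromRel_adj]
  constructor
  · rintro ⟨_, (h | ⟨h, h'⟩) | (h | ⟨h, h'⟩)⟩
    · exact h.1
    · exact absurd ⟨h, hN _ h'⟩ h1
    · exact h.1.symm
    · exact absurd ⟨h, hN _ h'⟩ h2
  · exact fun h => ⟨h.ne, Or.inl (Or.inl ⟨h, h1, h2⟩)⟩

lemma nbhd_resample {X E : Finset V} (hXE : Disjoint X E) {N : {v // v ∈ X} → Finset V}
    (hN : ∀ v, N v ⊆ E) (v : {v // v ∈ X}) : nbhd (resample X E H N) E v = N v := by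
  have hd := Finset.disjoint_left.1 hXE
  ext w
  rw [mem_nbhd, resample, SimpleGraph.fromRel_adj]
  constructor
  · rintro ⟨hw, _, (h | ⟨h, h'⟩) | (h | ⟨h, h'⟩)⟩
    · exact absurd ⟨v.2, hw⟩ h.2.1
    · exact h'
    · exact absurd ⟨v.2, hw⟩ h.2.2
    · exact absurd hw (hd h)
  · intro hw
    refine ⟨hN v hw, ?_, Or.inl (Or.inr ⟨v.2, hw⟩)⟩
    intro h
    exact hd v.2 (h ▸ hN v hw)

instance : MeasurableSingletonClass (SimpleGraph V) where
  measurableSet_singleton G := by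
    have := SimpleGraph.measurable_edgeSet (V := V) (measurableSet_singleton G.edgeSet)
    convert this
    ext G'
    simp

lemma map_uniformOn_of_injOn {α β : Type*} [Finite α] [MeasurableSpace α]
    [MeasurableSingletonClass α] [Finite β] [MeasurableSpace β] [MeasurableSingletonClass β]
    {s : Set α} {f : α → β} (hf : Set.InjOn f s) :
    (uniformOn s).map f = uniformOn (f '' s) := by
  ext t ht
  rw [Measure.map_apply Measurable.of_discrete ht]
  lift s to Finset α using s.toFinite
  lift t to Finset β using t.toFinite
  have h1 : f ⁻¹' (t : Set β) = ((Set.toFinite (f ⁻¹' (t : Set β))).toFinset : Set α) := by simp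
  rw [h1, ← Finset.coe_image, uniformOn_apply_finset, uniformOn_apply_finset,
    Finset.card_image_of_injOn hf]
  congr 2
  rw [← Finset.card_image_of_injOn (f := f) (s := s ∩ _)
    (hf.mono (by simp))]
  congr 1
  ext y
  simp only [Finset.mem_image, Finset.mem_inter, Set.Finite.mem_toFinset, Set.mem_preimage,
    Finset.mem_coe]
  constructor
  · rintro ⟨x, ⟨h, h'⟩, rfl⟩
    exact ⟨⟨x, h, rfl⟩, h'⟩
  · rintro ⟨⟨x, h, rfl⟩, h'⟩
    exact ⟨x, ⟨h, h'⟩, rfl⟩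

/-- Given the revealed information, the neighbourhoods in `E` of the vertices of `T'` are
independent uniform sets of the prescribed sizes: by `sets_eq_of_agreeOff` every choice of such
sets is attained, by exactly one graph. -/
theorem nbhd_indep_uniform (hH : H ∈ coreGraphs V m k) :
    iIndepFun (fun (v : {v // v ∈ refinedSet S Δ k H}) (G : SimpleGraph V) =>
        nbhd G (freeSet S Δ k G) v) (cond (coreLaw V m k) (revealed S Δ k H)) ∧
      ∀ v ∈ refinedSet S Δ k H,
        (cond (coreLaw V m k) (revealed S Δ k H)).map (fun G => nbhd G (freeSet S Δ k G) v) =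
          uniformOn (((freeSet S Δ k H).powersetCard (degIn H (freeSet S Δ k H) v) :
            Finset (Finset V)) : Set (Finset V)) := by
  set X := refinedSet S Δ k H with hX
  set E := freeSet S Δ k H with hE
  set A := coreGraphs V m k ∩ revealed S Δ k H with hA
  have hXE : Disjoint X E := Finset.disjoint_left.2 fun v hv =>
    not_mem_freeSet_of_mem_highSet (refinedSet_subset hv)
  have hμ : cond (coreLaw V m k) (revealed S Δ k H) = uniformOn A := by
    rw [coreLaw, uniformOn, cond_cond_eq_cond_inter MeasurableSet.of_discrete
      MeasurableSet.of_discrete]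
    rfl
  have hHA : H ∈ A := ⟨hH, rfl, rfl, fun _ _ _ _ => Iff.rfl, fun _ _ => rfl⟩
  have hprob : IsProbabilityMeasure (uniformOn A) :=
    isProbabilityMeasure_uniformOn A.toFinite ⟨H, hHA⟩
  set Φ : SimpleGraph V → {v // v ∈ X} → Finset V := fun G v => nbhd G (freeSet S Δ k G) v
    with hΦ
  set f : {v // v ∈ X} → Set (Finset V) := fun v =>
    ((E.powersetCard (degIn H E v) : Finset (Finset V)) : Set (Finset V)) with hf
  have hΦA : ∀ G ∈ A, ∀ v, Φ G v = nbhd G E v := fun G hG v => by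
    rw [hΦ]
    show nbhd G (freeSet S Δ k G) v = _
    rw [hG.2.2.1]
  have hinj : Set.InjOn Φ A := by
    intro G hG G' hG' h
    have hE : ∀ u ∈ X, ∀ w ∈ E, (G.Adj u w ↔ G'.Adj u w) := by
      intro u hu w hw
      have := congrFun h ⟨u, hu⟩
      rw [hΦA G hG, hΦA G' hG'] at this
      have h2 : w ∈ nbhd G E u ↔ w ∈ nbhd G' E u := by rw [this]
      rw [mem_nbhd, mem_nbhd] at h2
      simpa [hw] using h2
    ext u w
    by_cases h1 : u ∈ X ∧ w ∈ E
    · exact hE u h1.1 w h1.2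
    · by_cases h2 : w ∈ X ∧ u ∈ E
      · rw [G.adj_comm, G'.adj_comm]
        exact hE w h2.1 u h2.2
      · exact (hG.2.2.2.1 u w h1 h2).trans (hG'.2.2.2.1 u w h1 h2).symm
  have himage : Φ '' A = Set.univ.pi f := by
    ext N
    simp only [Set.mem_image, Set.mem_univ_pi, hf, Finset.mem_coe, Finset.mem_powersetCard]
    constructor
    · rintro ⟨G, hG, rfl⟩ v
      rw [hΦA G hG]
      exact ⟨fun w hw => (mem_nbhd.1 hw).1, hG.2.2.2.2 v v.2⟩
    · intro hN
      have hN' : ∀ v, N v ⊆ E := fun v => (hN v).1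
      have hmem : resample X E H N ∈ A := by
        rw [hA, mem_revealed_inter hH]
        refine ⟨resample_agreeOff hN', fun v hv => ?_⟩
        have := nbhd_resample (H := H) hXE hN' ⟨v, hv⟩
        rw [degIn, this]
        exact (hN ⟨v, hv⟩).2
      refine ⟨_, hmem, ?_⟩
      funext v
      rw [hΦA _ hmem, nbhd_resample hXE hN']
  have hmap : (uniformOn A).map Φ = Measure.pi fun v => uniformOn (f v) := by
    rw [map_uniformOn_of_injOn hinj, himage, uniformOn_pi]
  have hfprob : ∀ v, IsProbabilityMeasure (uniformOn (f v)) := fun v =>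
    isProbabilityMeasure_uniformOn (Set.toFinite _) ⟨nbhd H E v, by
      simp only [hf, Finset.mem_coe, Finset.mem_powersetCard]
      exact ⟨fun w hw => (mem_nbhd.1 hw).1, rfl⟩⟩
  have hmarg : ∀ v : {v // v ∈ X},
      (uniformOn A).map (fun G => nbhd G (freeSet S Δ k G) v) = uniformOn (f v) := by
    intro v
    have h1 := (measurePreserving_eval (fun v => uniformOn (f v)) v).map_eq
    rw [← hmap, Measure.map_map Measurable.of_discrete Measurable.of_discrete] at h1
    exact h1
  rw [hμ]
  refine ⟨?_, fun v hv => hmarg ⟨v, hv⟩⟩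
  rw [iIndepFun_iff_map_fun_eq_pi_map fun v => Measurable.of_discrete.aemeasurable]
  refine hmap.trans ?_
  congr 1
  funext v
  exact (hmarg v).symm

end Agree

end Resampling

/-! ### Double counting and moments -/

section Counting

open scoped Classical

/-- Double counting along moves: every `a ∈ 𝒜` admits at least `f` moves into `ℬ`, and every
`b ∈ ℬ` is reached by at most `r` moves, since the start of a move is determined by its end and
its label. -/
lemma card_mul_le_card_mul_of_moves {α β κ : Type*} (𝒜 : Finset α) (ℬ : Finset β)
    (Φ : α → Finset κ) (Ψ : β → Finset κ) (step : α → κ → β) (back : β → κ → α) {f r : ℕ}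
    (hf : ∀ a ∈ 𝒜, f ≤ (Φ a).card) (hr : ∀ b ∈ ℬ, (Ψ b).card ≤ r)
    (h : ∀ a ∈ 𝒜, ∀ x ∈ Φ a, step a x ∈ ℬ ∧ x ∈ Ψ (step a x) ∧ back (step a x) x = a) :
    𝒜.card * f ≤ ℬ.card * r := by
  calc 𝒜.card * f ≤ ∑ a ∈ 𝒜, (Φ a).card := by
        rw [← smul_eq_mul]; exact Finset.card_nsmul_le_sum _ _ _ hf
    _ = (𝒜.sigma Φ).card := (Finset.card_sigma _ _).symm
    _ ≤ (ℬ.sigma Ψ).card := by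
        refine Finset.card_le_card_of_injOn (fun p => ⟨step p.1 p.2, p.2⟩) ?_ ?_
        · rintro ⟨a, x⟩ hp
          rw [Finset.mem_coe, Finset.mem_sigma] at hp ⊢
          exact ⟨(h a hp.1 x hp.2).1, (h a hp.1 x hp.2).2.1⟩
        · rintro ⟨a, x⟩ hp ⟨a', x'⟩ hp' heq
          rw [Finset.mem_coe, Finset.mem_sigma] at hp hp'
          simp only [Sigma.mk.injEq, heq_eq_eq] at heq
          obtain ⟨h1, rfl⟩ := heq
          have h2 := (h a hp.1 x hp.2).2.2
          have h3 := (h a' hp'.1 x hp'.2).2.2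
          rw [h1] at h2
          rw [← h2, h3]
    _ = ∑ b ∈ ℬ, (Ψ b).card := Finset.card_sigma _ _
    _ ≤ ℬ.card * r := by
        rw [← smul_eq_mul]; exact Finset.sum_le_card_nsmul _ _ _ hr

/-- A moment bound for the number of patterns `i ∈ I` present in `ω`. If a present pattern is in
conflict with at most `D` present ones, and `j` patterns without conflicts are simultaneously
present for at most `Z ∏ w` of the `ω`, then few `ω` have many present patterns. -/
lemma card_many_present_mul_le {β ι : Type*} (Ω : Finset β) (I : Finset ι) (P : ι → β → Prop)
    (conf : ι → ι → Prop) (D : ℕ) (w : ι → ℝ) (Z : ℝ) (hw : ∀ i ∈ I, 0 ≤ w i) (hZ : 0 ≤ Z)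
    (hD : ∀ ω ∈ Ω, ∀ i ∈ I, P i ω → (I.filter fun i' => P i' ω ∧ conf i i').card ≤ D)
    (j : ℕ) (hP : ∀ l : List ι, l.length = j → (∀ i ∈ l, i ∈ I) →
      l.Pairwise (fun a b => ¬ conf b a) →
      ((Ω.filter fun ω => ∀ i ∈ l, P i ω).card : ℝ) ≤ (l.map w).prod * Z) (X : ℕ) :
    ((Ω.filter fun ω => X ≤ (I.filter fun i => P i ω).card).card : ℝ) *
      ((X - j * D : ℕ) : ℝ) ^ j ≤ (∑ i ∈ I, w i) ^ j * Z := by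
  set Ω' := Ω.filter fun ω => X ≤ (I.filter fun i => P i ω).card with hΩ'
  -- Extend a conflict-free list of `j - s` present patterns one pattern at a time.
  have key : ∀ s ≤ j, ∀ l : List ι, l.length + s = j → (∀ i ∈ l, i ∈ I) →
      l.Pairwise (fun a b => ¬ conf b a) →
      ((Ω'.filter fun ω => ∀ i ∈ l, P i ω).card : ℝ) * ((X - j * D : ℕ) : ℝ) ^ s ≤
        (∑ i ∈ I, w i) ^ s * ((l.map w).prod * Z) := by
    intro s
    induction s with
    | zero =>
      intro _ l hl hlI hlp
      rw [pow_zero, pow_zero, mul_one, one_mul]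
      refine le_trans ?_ (hP l (by omega) hlI hlp)
      exact_mod_cast Finset.card_le_card (Finset.filter_subset_filter _ (Finset.filter_subset _ _))
    | succ s ih =>
      intro hs l hl hlI hlp
      set J := I.filter fun i => ∀ a ∈ l, ¬ conf a i with hJ
      have hcount : (Ω'.filter fun ω => ∀ i ∈ l, P i ω).card * (X - j * D) ≤
          ∑ i ∈ J, (Ω'.filter fun ω => ∀ i' ∈ i :: l, P i' ω).card := by
        have hswap : ∑ i ∈ J, (Ω'.filter fun ω => ∀ i' ∈ i :: l, P i' ω).card =
            ∑ ω ∈ Ω'.filter (fun ω => ∀ i ∈ l, P i ω), (J.filter fun i => P i ω).card := by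
          have := Finset.sum_card_bipartiteAbove_eq_sum_card_bipartiteBelow
            (fun (i : ι) (ω : β) => P i ω) (s := J)
            (t := Ω'.filter (fun ω => ∀ i ∈ l, P i ω))
          refine Eq.trans (Finset.sum_congr rfl fun i _ => ?_) (this.trans
            (Finset.sum_congr rfl fun ω _ => ?_))
          · congr 1
            ext ω
            simp only [List.mem_cons, forall_eq_or_imp, Finset.mem_filter,
              Finset.mem_bipartiteAbove]
            tauto
          · rfl
        rw [hswap, ← smul_eq_mul]
        refine Finset.card_nsmul_le_sum _ _ _ fun ω hω => ?_
        rw [Finset.mem_filter, hΩ', Finset.mem_filter] at hω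
        obtain ⟨⟨hωΩ, hX⟩, hlω⟩ := hω
        have hsub : (I.filter fun i => P i ω) ⊆ (J.filter fun i => P i ω) ∪
            l.toFinset.biUnion (fun a => I.filter fun i' => P i' ω ∧ conf a i') := by
          intro i hi
          rw [Finset.mem_filter] at hi
          rw [Finset.mem_union, Finset.mem_filter, hJ, Finset.mem_filter, Finset.mem_biUnion]
          by_cases h : ∀ a ∈ l, ¬ conf a i
          · exact Or.inl ⟨⟨hi.1, h⟩, hi.2⟩
          · push Not at h
            obtain ⟨a, ha, hc⟩ := h
            exact Or.inr ⟨a, List.mem_toFinset.2 ha, Finset.mem_filter.2 ⟨hi.1, hi.2, hc⟩⟩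
        have h1 := Finset.card_le_card hsub
        have h2 := Finset.card_union_le (J.filter fun i => P i ω)
          (l.toFinset.biUnion (fun a => I.filter fun i' => P i' ω ∧ conf a i'))
        have h3 : (l.toFinset.biUnion (fun a => I.filter fun i' => P i' ω ∧ conf a i')).card ≤
            l.toFinset.card * D := by
          refine Finset.card_biUnion_le_card_mul _ _ _ fun a ha => ?_
          rw [List.mem_toFinset] at ha
          exact hD ω hωΩ a (hlI a ha) (hlω a ha)
        have h4 : l.toFinset.card * D ≤ j * D :=
          Nat.mul_le_mul_right _ ((List.toFinset_card_le l).trans (by omega))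
        omega
      have hmain : ∀ i ∈ J,
          ((Ω'.filter fun ω => ∀ i' ∈ i :: l, P i' ω).card : ℝ) * ((X - j * D : ℕ) : ℝ) ^ s ≤
            (∑ i ∈ I, w i) ^ s * (w i * (l.map w).prod * Z) := by
        intro i hi
        rw [hJ, Finset.mem_filter] at hi
        have := ih (by omega) (i :: l) (by simp; omega)
          (by simpa using ⟨hi.1, hlI⟩) (List.pairwise_cons.2 ⟨hi.2, hlp⟩)
        simpa [mul_assoc] using this
      have hcount' : ((Ω'.filter fun ω => ∀ i ∈ l, P i ω).card : ℝ) * ((X - j * D : ℕ) : ℝ) ≤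
          ∑ i ∈ J, ((Ω'.filter fun ω => ∀ i' ∈ i :: l, P i' ω).card : ℝ) := by
        exact_mod_cast hcount
      have hprod : 0 ≤ (l.map w).prod := by
        refine List.prod_nonneg fun a ha => ?_
        obtain ⟨i, hi, rfl⟩ := List.mem_map.1 ha
        exact hw i (hlI i hi)
      have hsum : 0 ≤ ∑ i ∈ I, w i := Finset.sum_nonneg hw
      calc _ = ((Ω'.filter fun ω => ∀ i ∈ l, P i ω).card : ℝ) * ((X - j * D : ℕ) : ℝ) *
            ((X - j * D : ℕ) : ℝ) ^ s := by ring
        _ ≤ (∑ i ∈ J, ((Ω'.filter fun ω => ∀ i' ∈ i :: l, P i' ω).card : ℝ)) *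
            ((X - j * D : ℕ) : ℝ) ^ s := by gcongr
        _ ≤ ∑ i ∈ J, (∑ i ∈ I, w i) ^ s * (w i * (l.map w).prod * Z) := by
            rw [Finset.sum_mul]
            exact Finset.sum_le_sum hmain
        _ ≤ ∑ i ∈ I, (∑ i ∈ I, w i) ^ s * (w i * (l.map w).prod * Z) := by
            refine Finset.sum_le_sum_of_subset_of_nonneg (Finset.filter_subset _ _) ?_
            intro i hi _
            have := hw i hi
            positivity
        _ = _ := by
            rw [← Finset.mul_sum, ← Finset.sum_mul, ← Finset.sum_mul]
            ring
  have := key j le_rfl [] (by simp) (by simp) List.Pairwise.nil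
  simpa using this

lemma card_le_mul_card_of_fibers {β κ : Type*} [DecidableEq κ] (Ω Ω' : Finset β)
    (key : β → κ) (ρ : ℝ)
    (h : ∀ c, ((Ω'.filter fun ω => key ω = c).card : ℝ) ≤
      ρ * (Ω.filter fun ω => key ω = c).card) :
    (Ω'.card : ℝ) ≤ ρ * Ω.card := by
  have hmaps : ∀ s : Finset β, s ⊆ Ω ∪ Ω' → ∀ ω ∈ s, key ω ∈ (Ω ∪ Ω').image key :=
    fun s hs ω hω => Finset.mem_image_of_mem _ (hs hω)
  rw [Finset.card_eq_sum_card_fiberwise (hmaps Ω' Finset.subset_union_right),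
    Finset.card_eq_sum_card_fiberwise (hmaps Ω Finset.subset_union_left)]
  push_cast
  rw [Finset.mul_sum]
  exact Finset.sum_le_sum fun c _ => h c

end Counting

/-! ### Swapping sets of edges -/

section Swap

open scoped Classical

variable {V : Type u} [Fintype V]

/-- The number of edges in `R` at the vertex `v`. -/
noncomputable def incCount (R : Finset (Sym2 V)) (v : V) : ℕ := (R.filter fun e => v ∈ e).card

/-- The graph obtained from `G` by removing the edges in `R` and adding those in `A`. -/
def swap (G : SimpleGraph V) (R A : Finset (Sym2 V)) : SimpleGraph V :=
  SimpleGraph.fromEdgeSet ((G.edgeSet \ R) ∪ A)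

/-- `R` consists of edges of `G` and `A` of pairs of distinct non-adjacent vertices. -/
structure IsSwap (G : SimpleGraph V) (R A : Finset (Sym2 V)) : Prop where
  mem : ∀ e ∈ R, e ∈ G.edgeSet
  not_mem : ∀ e ∈ A, e ∉ G.edgeSet
  not_diag : ∀ e ∈ A, ¬ e.IsDiag

lemma swap_adj {G : SimpleGraph V} {R A : Finset (Sym2 V)} {u v : V} :
    (swap G R A).Adj u v ↔ ((G.Adj u v ∧ s(u, v) ∉ R) ∨ s(u, v) ∈ A) ∧ u ≠ v := by
  have : G.Adj u v → u ≠ v := fun h => h.ne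
  simp [swap]
  tauto

namespace IsSwap

variable {G : SimpleGraph V} {R A : Finset (Sym2 V)}

lemma edgeSet_eq (h : IsSwap G R A) : (swap G R A).edgeSet = (G.edgeSet \ R) ∪ A := by
  rw [swap, SimpleGraph.edgeSet_fromEdgeSet, sdiff_eq_left, Set.disjoint_left]
  rintro e (he | he) hd
  · exact G.not_isDiag_of_mem_edgeSet he.1 hd
  · exact h.not_diag e he hd

lemma symm (h : IsSwap G R A) : IsSwap (swap G R A) A R where
  mem e he := by
    rw [h.edgeSet_eq]
    exact Or.inr he
  not_mem e he := by
    rw [h.edgeSet_eq]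
    rintro (he' | he')
    · exact he'.2 he
    · exact h.not_mem e he' (h.mem e he)
  not_diag e he := G.not_isDiag_of_mem_edgeSet (h.mem e he)

lemma swap_swap (h : IsSwap G R A) : swap (swap G R A) A R = G := by
  apply SimpleGraph.edgeSet_injective
  rw [h.symm.edgeSet_eq, h.edgeSet_eq]
  ext e
  simp only [Set.mem_union, Set.mem_sdiff, Finset.mem_coe]
  have h1 := h.mem e
  have h2 := h.not_mem e
  tauto

lemma ncard_edgeSet (h : IsSwap G R A) :
    (swap G R A).edgeSet.ncard + R.card = G.edgeSet.ncard + A.card := by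
  rw [h.edgeSet_eq, Set.ncard_union_eq _ (Set.toFinite _) (Set.toFinite _),
    Set.ncard_coe_finset, add_right_comm, ← Set.ncard_coe_finset R,
    Set.ncard_sdiff_add_ncard_of_subset h.mem (Set.toFinite _)]
  rw [Set.disjoint_left]
  exact fun e he he' => h.not_mem e he' he.1

lemma degree_eq (h : IsSwap G R A) (v : V) :
    degIn (swap G R A) Finset.univ v + incCount R v =
      degIn G Finset.univ v + incCount A v := by
  have key : ∀ G : SimpleGraph V, degIn G Finset.univ v = (G.edgeSet ∩ {e | v ∈ e}).ncard := by
    intro G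
    rw [degIn_univ_eq_degree, ← SimpleGraph.card_incidenceFinset_eq_degree,
      ← Set.ncard_coe_finset, SimpleGraph.coe_incidenceFinset]
    rfl
  have hR : incCount R v = ((R : Set (Sym2 V)) ∩ {e | v ∈ e}).ncard := by
    rw [incCount, ← Set.ncard_coe_finset]
    congr 1
    ext; simp
  have hA : incCount A v = ((A : Set (Sym2 V)) ∩ {e | v ∈ e}).ncard := by
    rw [incCount, ← Set.ncard_coe_finset]
    congr 1
    ext; simp
  have hdist : (G.edgeSet \ R) ∩ {e | v ∈ e} =
      (G.edgeSet ∩ {e | v ∈ e}) \ ((R : Set (Sym2 V)) ∩ {e | v ∈ e}) := by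
    ext e
    simp only [Set.mem_inter_iff, Set.mem_sdiff, Set.mem_ofPred_eq]
    tauto
  rw [key, key, hR, hA, h.edgeSet_eq, Set.union_inter_distrib_right,
    Set.ncard_union_eq _ (Set.toFinite _) (Set.toFinite _), add_right_comm,
    hdist, Set.ncard_sdiff_add_ncard_of_subset _ (Set.toFinite _)]
  · exact Set.inter_subset_inter_left _ h.mem
  · rw [Set.disjoint_left]
    exact fun e he he' => h.not_mem e he'.1 he.1.1

end IsSwap

end Swap

/-! ### Stars centred at vertices of large degree -/

section Stars

open scoped Classical

variable {V : Type u} [Fintype V]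

/-- The graphs on `V` with `m` edges and minimum degree at least `k`, as a finite set. -/
noncomputable def coreFin (V : Type u) [Fintype V] (m k : ℕ) : Finset (SimpleGraph V) :=
  Finset.univ.filter fun G => G ∈ coreGraphs V m k

lemma mem_coreFin {m k : ℕ} {G : SimpleGraph V} :
    G ∈ coreFin V m k ↔ G.edgeSet.ncard = m ∧ ∀ v, k ≤ degIn G Finset.univ v := by
  rw [coreFin, Finset.mem_filter, mem_coreGraphs]
  simp

lemma incCount_singleton (e : Sym2 V) (v : V) : incCount {e} v = if v ∈ e then 1 else 0 := by
  rw [incCount, Finset.filter_singleton]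
  split_ifs <;> simp

lemma incCount_pair {e f : Sym2 V} (h : e ≠ f) (v : V) :
    incCount {e, f} v = (if v ∈ e then 1 else 0) + if v ∈ f then 1 else 0 := by
  rw [incCount, Finset.filter_insert, Finset.filter_singleton]
  split_ifs <;> simp [h]

lemma card_adj_pairs (G : SimpleGraph V) :
    (Finset.univ.filter fun p : V × V => G.Adj p.1 p.2).card = 2 * G.edgeSet.ncard := by
  rw [← sum_degIn, ← Finset.univ_product_univ, Finset.card_filter, Finset.sum_product]
  refine Finset.sum_congr rfl fun v _ => ?_
  rw [← Finset.card_filter]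
  rfl

lemma card_nonadj_pairs (G : SimpleGraph V) :
    (Finset.univ.filter fun p : V × V => p.1 ≠ p.2 ∧ ¬ G.Adj p.1 p.2).card +
      2 * G.edgeSet.ncard + Fintype.card V = Fintype.card V ^ 2 := by
  have h1 : (Finset.univ.filter fun p : V × V => p.1 ≠ p.2 ∧ ¬ G.Adj p.1 p.2).card +
      (Finset.univ.filter fun p : V × V => G.Adj p.1 p.2).card =
      (Finset.univ.filter fun p : V × V => p.1 ≠ p.2).card := by
    rw [← Finset.card_union_of_disjoint]
    · congr 1
      ext p
      have : G.Adj p.1 p.2 → p.1 ≠ p.2 := fun h => h.ne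
      simp
      tauto
    · rw [Finset.disjoint_left]
      intro p hp hp'
      simp at hp hp'
      tauto
  have h2 : (Finset.univ.filter fun p : V × V => p.1 ≠ p.2).card + Fintype.card V =
      Fintype.card V ^ 2 := by
    have h3 : (Finset.univ.filter fun p : V × V => p.1 = p.2).card = Fintype.card V := by
      have : (Finset.univ.filter fun p : V × V => p.1 = p.2) =
          (Finset.univ : Finset V).diag := by
        ext p; simp
      rw [this, Finset.diag_card, Finset.card_univ]
    have h4 := Finset.card_filter_add_card_filter_not (s := (Finset.univ : Finset (V × V)))
      (fun p => p.1 = p.2)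
    rw [h3, Finset.card_univ, Fintype.card_prod] at h4
    rw [sq, ← h4, add_comm]
  rw [card_adj_pairs] at h1
  omega

lemma card_nonneighbors (G : SimpleGraph V) (x : V) :
    (Finset.univ.filter fun z => z ≠ x ∧ ¬ G.Adj x z).card + degIn G Finset.univ x + 1 =
      Fintype.card V := by
  have h1 : (Finset.univ.filter fun z => z ≠ x ∧ ¬ G.Adj x z) =
      (insert x (nbhd G Finset.univ x))ᶜ := by
    ext z
    simp [mem_nbhd]
  have h2 : x ∉ nbhd G Finset.univ x := by simp [mem_nbhd]
  have h3 := Finset.card_add_card_compl (insert x (nbhd G Finset.univ x))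
  rw [Finset.card_insert_of_notMem h2] at h3
  rw [h1, degIn]
  omega

/-- The event that all pairs `(v, x) ∈ F` are edges and that every centre `v` of `F` keeps degree
at least `k` when its edges in `F` are removed. -/
noncomputable def starEvent (m k : ℕ) (F : Finset (V × V)) : Finset (SimpleGraph V) :=
  (coreFin V m k).filter fun G => (∀ e ∈ F, G.Adj e.1 e.2) ∧
    ∀ e ∈ F, k + (F.filter fun e' => e'.1 = e.1).card ≤ degIn G Finset.univ e.1

lemma mem_starEvent_of_swap {m k : ℕ} {F : Finset (V × V)} {v x : V}
    (hvx : (v, x) ∉ F) (hbip : ∀ e ∈ insert (v, x) F, ∀ e' ∈ insert (v, x) F, e.2 ≠ e'.1)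
    {G : SimpleGraph V} (hG : G ∈ starEvent m k (insert (v, x) F)) {a : Sym2 V}
    (hs : IsSwap G {s(v, x)} {a}) (hx : k ≤ degIn (swap G {s(v, x)} {a}) Finset.univ x) :
    swap G {s(v, x)} {a} ∈ starEvent m k F := by
  rw [starEvent, Finset.mem_filter, mem_coreFin] at hG ⊢
  obtain ⟨⟨hm, hk⟩, hadj, hdeg⟩ := hG
  have hdeg' : ∀ u, u ≠ x → degIn G Finset.univ u ≤
      degIn (swap G {s(v, x)} {a}) Finset.univ u + if u = v then 1 else 0 := by
    intro u hu
    have := hs.degree_eq u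
    rw [incCount_singleton, incCount_singleton] at this
    have h3 : u ∈ s(v, x) ↔ u = v := by simp [hu]
    simp only [h3] at this
    omega
  have hcount : ∀ u, ((insert (v, x) F).filter fun e' => e'.1 = u).card =
      (F.filter fun e' => e'.1 = u).card + if u = v then 1 else 0 := by
    intro u
    rw [Finset.filter_insert]
    by_cases h : v = u
    · rw [if_pos h, if_pos h.symm, Finset.card_insert_of_notMem]
      simp [hvx]
    · rw [if_neg h, if_neg fun h' => h h'.symm, add_zero]
  have hxc : ∀ e ∈ insert (v, x) F, e.1 ≠ x := fun e he h =>
    hbip (v, x) (Finset.mem_insert_self _ _) e he h.symm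
  refine ⟨⟨?_, fun u => ?_⟩, fun e he => ?_, fun e he => ?_⟩
  · have := hs.ncard_edgeSet
    simp at this
    omega
  · by_cases hu : u = x
    · rw [hu]; exact hx
    · have h1 := hdeg' u hu
      by_cases huv : u = v
      · have h2 := hdeg (v, x) (Finset.mem_insert_self _ _)
        rw [hcount, if_pos rfl] at h2
        rw [if_pos huv, huv] at h1
        rw [huv]
        simp only at h2
        omega
      · rw [if_neg huv] at h1
        exact (hk u).trans h1
  · rw [swap_adj]
    refine ⟨Or.inl ⟨hadj e (Finset.mem_insert_of_mem he), ?_⟩,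
      (hadj e (Finset.mem_insert_of_mem he)).ne⟩
    rw [Finset.mem_singleton, Sym2.eq_iff]
    rintro (⟨h1, h2⟩ | ⟨h1, h2⟩)
    · exact hvx (by rw [← h1, ← h2]; exact he)
    · exact hxc e (Finset.mem_insert_of_mem he) h1
  · have h1 := hdeg e (Finset.mem_insert_of_mem he)
    rw [hcount] at h1
    have h2 := hdeg' e.1 (hxc e (Finset.mem_insert_of_mem he))
    omega

/-- Removing one edge `vx` of a star costs a factor `O(1/n)`. If `x` has degree above `k` the edge
is moved to an arbitrary non-adjacent pair, otherwise it is rotated about `x`. -/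
lemma card_starEvent_insert_le {m k : ℕ} {F : Finset (V × V)} {v x : V}
    (hvx : (v, x) ∉ F) (hbip : ∀ e ∈ insert (v, x) F, ∀ e' ∈ insert (v, x) F, e.2 ≠ e'.1)
    {κ : ℝ} {f g : ℕ} (hf : 0 < f) (hg : 0 < g)
    (hfN : f + 2 * m + Fintype.card V ≤ Fintype.card V ^ 2)
    (hgN : g + k + 1 ≤ Fintype.card V) (hκ : 2 * m / f + k / g ≤ κ) :
    ((starEvent m k (insert (v, x) F)).card : ℝ) ≤ κ * (starEvent m k F).card := by
  set Ω := starEvent m k (insert (v, x) F) with hΩ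
  have hmem : ∀ G ∈ Ω, G.edgeSet.ncard = m ∧ G.Adj v x ∧ k ≤ degIn G Finset.univ x := by
    intro G hG
    rw [hΩ, starEvent, Finset.mem_filter, mem_coreFin] at hG
    exact ⟨hG.1.1, hG.2.1 (v, x) (Finset.mem_insert_self _ _), hG.1.2 x⟩
  have hA : (Ω.filter fun G => k < degIn G Finset.univ x).card * f ≤
      (starEvent m k F).card * (2 * m) := by
    refine card_mul_le_card_mul_of_moves _ _
      (fun G => Finset.univ.filter fun p : V × V => p.1 ≠ p.2 ∧ ¬ G.Adj p.1 p.2)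
      (fun G => Finset.univ.filter fun p : V × V => G.Adj p.1 p.2)
      (fun G p => swap G {s(v, x)} {s(p.1, p.2)}) (fun G p => swap G {s(p.1, p.2)} {s(v, x)})
      ?_ ?_ ?_
    · intro G hG
      have h1 := card_nonadj_pairs G
      rw [(hmem G (Finset.mem_filter.1 hG).1).1] at h1
      omega
    · intro G hG
      rw [starEvent, Finset.mem_filter, mem_coreFin] at hG
      rw [card_adj_pairs, hG.1.1]
    · intro G hG p hp
      rw [Finset.mem_filter] at hG hp
      have hs : IsSwap G {s(v, x)} {s(p.1, p.2)} := by
        refine ⟨?_, ?_, ?_⟩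
        · simpa using (hmem G hG.1).2.1
        · simpa using hp.2.2
        · simpa using hp.2.1
      refine ⟨mem_starEvent_of_swap hvx hbip hG.1 hs ?_, ?_, hs.swap_swap⟩
      · have := hs.degree_eq x
        rw [incCount_singleton, incCount_singleton, if_pos (by simp)] at this
        omega
      · rw [Finset.mem_filter, swap_adj]
        simp [hp.2.1]
  have hB : (Ω.filter fun G => ¬ k < degIn G Finset.univ x).card * g ≤
      (starEvent m k F).card * k := by
    refine le_trans (card_mul_le_card_mul_of_moves _
      ((starEvent m k F).filter fun G => degIn G Finset.univ x ≤ k)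
      (fun G => Finset.univ.filter fun z : V => z ≠ x ∧ ¬ G.Adj x z)
      (fun G => nbhd G Finset.univ x)
      (fun G z => swap G {s(v, x)} {s(x, z)}) (fun G z => swap G {s(x, z)} {s(v, x)})
      ?_ ?_ ?_) (Nat.mul_le_mul_right _ (Finset.card_le_card (Finset.filter_subset _ _)))
    · intro G hG
      rw [Finset.mem_filter] at hG
      have h1 := card_nonneighbors G x
      omega
    · intro G hG
      exact (Finset.mem_filter.1 hG).2
    · intro G hG z hz
      rw [Finset.mem_filter] at hG hz
      have hs : IsSwap G {s(v, x)} {s(x, z)} := by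
        refine ⟨?_, ?_, ?_⟩
        · simpa using (hmem G hG.1).2.1
        · simpa using hz.2.2
        · simpa using hz.2.1.symm
      have hd := hs.degree_eq x
      rw [incCount_singleton, incCount_singleton, if_pos (by simp), if_pos (by simp)] at hd
      have hkx := (hmem G hG.1).2.2
      refine ⟨Finset.mem_filter.2 ⟨mem_starEvent_of_swap hvx hbip hG.1 hs ?_, ?_⟩, ?_,
        hs.swap_swap⟩
      · omega
      · omega
      · rw [mem_nbhd, swap_adj]
        simp [hz.2.1.symm]
  have hsplit := Finset.card_filter_add_card_filter_not (s := Ω)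
    (fun G => k < degIn G Finset.univ x)
  have hA' : ((Ω.filter fun G => k < degIn G Finset.univ x).card : ℝ) ≤
      (starEvent m k F).card * (2 * m / f) := by
    rw [← mul_div_assoc, le_div_iff₀ (by positivity)]
    exact_mod_cast hA
  have hB' : ((Ω.filter fun G => ¬ k < degIn G Finset.univ x).card : ℝ) ≤
      (starEvent m k F).card * (k / g) := by
    rw [← mul_div_assoc, le_div_iff₀ (by positivity)]
    exact_mod_cast hB
  calc (Ω.card : ℝ) = (Ω.filter fun G => k < degIn G Finset.univ x).card +
        (Ω.filter fun G => ¬ k < degIn G Finset.univ x).card := by exact_mod_cast hsplit.symm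
    _ ≤ (starEvent m k F).card * (2 * m / f) + (starEvent m k F).card * (k / g) :=
        add_le_add hA' hB'
    _ = (2 * m / f + k / g) * (starEvent m k F).card := by ring
    _ ≤ κ * (starEvent m k F).card := by gcongr

lemma card_starEvent_le {m k : ℕ} {κ : ℝ} {f g : ℕ} (hf : 0 < f) (hg : 0 < g)
    (hfN : f + 2 * m + Fintype.card V ≤ Fintype.card V ^ 2)
    (hgN : g + k + 1 ≤ Fintype.card V) (hκ : 2 * m / f + k / g ≤ κ) (F : Finset (V × V))
    (hbip : ∀ e ∈ F, ∀ e' ∈ F, e.2 ≠ e'.1) :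
    ((starEvent m k F).card : ℝ) ≤ κ ^ F.card * (coreFin V m k).card := by
  have hκ0 : 0 ≤ κ := le_trans (by positivity) hκ
  induction F using Finset.induction_on with
  | empty => simp [starEvent]
  | insert e F he ih =>
    obtain ⟨v, x⟩ := e
    refine (card_starEvent_insert_le he hbip hf hg hfN hgN hκ).trans ?_
    rw [Finset.card_insert_of_notMem he, pow_succ', mul_assoc]
    gcongr
    exact ih fun e he e' he' => hbip e (Finset.mem_insert_of_mem he) e'
      (Finset.mem_insert_of_mem he')

/-- The star with centre `p.1` and leaves `p.2` is present in `G`, and the centre has degree at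
least `k` larger than the number of leaves. -/
def StarPresent (k : ℕ) (p : V × Finset V) (G : SimpleGraph V) : Prop :=
  p.2 ⊆ nbhd G Finset.univ p.1 ∧ k + p.2.card ≤ degIn G Finset.univ p.1

lemma exists_starEdges (r : ℕ) (l : List (V × Finset V)) (hr : ∀ p ∈ l, p.2.card = r)
    (hl : l.Pairwise fun a b => a.1 ≠ b.1) :
    ∃ F : Finset (V × V), F.card = r * l.length ∧
      ∀ e, e ∈ F ↔ ∃ p ∈ l, e.1 = p.1 ∧ e.2 ∈ p.2 := by
  induction l with
  | nil => exact ⟨∅, by simp, by simp⟩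
  | cons p l ih =>
    rw [List.pairwise_cons] at hl
    obtain ⟨F, hF, hF'⟩ := ih (fun q hq => hr q (List.mem_cons_of_mem _ hq)) hl.2
    refine ⟨p.2.image (fun y => (p.1, y)) ∪ F, ?_, ?_⟩
    · rw [Finset.card_union_of_disjoint, hF, Finset.card_image_of_injective _
        (Prod.mk_right_injective _), hr p List.mem_cons_self, List.length_cons]
      · ring
      · rw [Finset.disjoint_left]
        rintro e he he'
        obtain ⟨y, hy, rfl⟩ := Finset.mem_image.1 he
        obtain ⟨q, hq, h1, -⟩ := (hF' _).1 he'
        exact hl.1 q hq h1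
    · rintro ⟨a, b⟩
      simp only [Finset.mem_union, Finset.mem_image, hF', List.mem_cons, exists_eq_or_imp,
        Prod.mk.injEq]
      refine or_congr ⟨?_, ?_⟩ Iff.rfl
      · rintro ⟨y, hy, rfl, rfl⟩
        exact ⟨rfl, hy⟩
      · rintro ⟨rfl, h⟩
        exact ⟨b, h, rfl, rfl⟩

/-- Vertex-disjoint stars with `r` leaves each are simultaneously present for at most a proportion
`κ ^ (r j)` of the graphs, where `j` is their number. -/
lemma card_stars_le {m k : ℕ} {κ : ℝ} {f g : ℕ} (hf : 0 < f) (hg : 0 < g)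
    (hfN : f + 2 * m + Fintype.card V ≤ Fintype.card V ^ 2)
    (hgN : g + k + 1 ≤ Fintype.card V) (hκ : 2 * m / f + k / g ≤ κ) (r : ℕ)
    (l : List (V × Finset V)) (hr : ∀ p ∈ l, p.2.card = r) (hv : ∀ p ∈ l, p.1 ∉ p.2)
    (hl : l.Pairwise fun a b => Disjoint (insert a.1 a.2) (insert b.1 b.2)) :
    (((coreFin V m k).filter fun G => ∀ p ∈ l, StarPresent k p G).card : ℝ) ≤
      (l.map fun _ => κ ^ r).prod * (coreFin V m k).card := by
  have hne : l.Pairwise fun a b => a.1 ≠ b.1 := by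
    refine hl.imp fun {a b} h hab => ?_
    refine Finset.disjoint_left.1 h (Finset.mem_insert_self _ _) ?_
    rw [hab]
    exact Finset.mem_insert_self _ _
  obtain ⟨F, hF, hF'⟩ := exists_starEdges r l hr hne
  have hall : ∀ p ∈ l, ∀ q ∈ l, p ≠ q → Disjoint (insert p.1 p.2) (insert q.1 q.2) := by
    intro p hp q hq hpq
    refine (List.Pairwise.forall_of_forall_of_flip
      (R := fun a b => a ≠ b → Disjoint (insert a.1 a.2) (insert b.1 b.2)) ?_ ?_ ?_) hp hq hpq
    · intro x _ h; exact absurd rfl h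
    · exact hl.imp fun {a b} h (_ : a ≠ b) => h
    · exact hl.imp fun {a b} h (_ : b ≠ a) => h.symm
  have hbip : ∀ e ∈ F, ∀ e' ∈ F, e.2 ≠ e'.1 := by
    intro e he e' he' h
    obtain ⟨p, hp, h1, h2⟩ := (hF' e).1 he
    obtain ⟨q, hq, h3, h4⟩ := (hF' e').1 he'
    by_cases hpq : p = q
    · subst hpq
      exact hv p hp (h3 ▸ h ▸ h2)
    · exact Finset.disjoint_left.1 (hall p hp q hq hpq) (Finset.mem_insert_of_mem h2)
        (by rw [h, h3]; exact Finset.mem_insert_self _ _)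
  rw [List.map_const', List.prod_replicate, ← pow_mul, ← hF]
  refine le_trans ?_ (card_starEvent_le hf hg hfN hgN hκ F hbip)
  rw [Nat.cast_le]
  refine Finset.card_le_card fun G hG => ?_
  rw [Finset.mem_filter] at hG
  rw [starEvent, Finset.mem_filter]
  refine ⟨hG.1, fun e he => ?_, fun e he => ?_⟩
  · obtain ⟨p, hp, h1, h2⟩ := (hF' e).1 he
    rw [h1]
    exact (mem_nbhd.1 ((hG.2 p hp).1 h2)).2
  · obtain ⟨p, hp, h1, h2⟩ := (hF' e).1 he
    refine le_trans ?_ (h1 ▸ (hG.2 p hp).2)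
    refine Nat.add_le_add_left ?_ _
    refine (Finset.card_le_card (t := p.2.image fun y => (p.1, y)) fun e' he' => ?_).trans
      Finset.card_image_le
    rw [Finset.mem_filter] at he'
    obtain ⟨q, hq, h3, h4⟩ := (hF' e').1 he'.1
    have hpq : p = q := by
      by_contra hpq
      refine Finset.disjoint_left.1 (hall p hp q hq hpq) (Finset.mem_insert_self _ _) ?_
      rw [← h1, ← he'.2, h3]
      exact Finset.mem_insert_self _ _
    subst hpq
    exact Finset.mem_image.2 ⟨e'.2, h4, by rw [← h3]⟩

end Stars

/-! ### Bounds for the degrees and their moments -/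

section DegreeBounds

open scoped Classical

variable {V : Type u} [Fintype V]

/-- The possible stars with `r` leaves. -/
noncomputable def starPatterns (V : Type u) [Fintype V] (r : ℕ) : Finset (V × Finset V) :=
  (Finset.univ ×ˢ (Finset.univ : Finset V).powersetCard r).filter fun p => p.1 ∉ p.2

lemma mem_starPatterns {r : ℕ} {p : V × Finset V} :
    p ∈ starPatterns V r ↔ p.2.card = r ∧ p.1 ∉ p.2 := by
  simp [starPatterns, Finset.mem_powersetCard]

lemma card_starPatterns_le (r : ℕ) :
    (starPatterns V r).card ≤ Fintype.card V ^ (r + 1) := by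
  refine (Finset.card_filter_le _ _).trans ?_
  rw [Finset.card_product, Finset.card_powersetCard, Finset.card_univ, pow_succ']
  exact Nat.mul_le_mul_left _ (Nat.choose_le_pow _ _)

lemma choose_le_card_starPresent {k r : ℕ} (G : SimpleGraph V) :
    ∑ v ∈ Finset.univ.filter (fun v => k + r ≤ degIn G Finset.univ v),
        (degIn G Finset.univ v).choose r ≤
      ((starPatterns V r).filter fun p => StarPresent k p G).card := by
  have : ∑ v ∈ Finset.univ.filter (fun v => k + r ≤ degIn G Finset.univ v),
      (degIn G Finset.univ v).choose r =
      ((Finset.univ.filter (fun v => k + r ≤ degIn G Finset.univ v)).sigma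
        fun v => (nbhd G Finset.univ v).powersetCard r).card := by
    rw [Finset.card_sigma]
    exact Finset.sum_congr rfl fun v _ => (Finset.card_powersetCard _ _).symm
  rw [this]
  refine Finset.card_le_card_of_injOn (fun p => (p.1, p.2)) ?_ ?_
  · rintro ⟨v, A⟩ h
    simp only [Finset.coe_sigma, Set.mem_sigma_iff, Finset.mem_coe, Finset.mem_filter,
      Finset.mem_univ, true_and, Finset.mem_powersetCard] at h
    obtain ⟨h1, h2, h3⟩ := h
    rw [Finset.mem_coe, Finset.mem_filter, mem_starPatterns]
    refine ⟨⟨h3, fun hv => ?_⟩, h2, by rw [h3]; exact h1⟩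
    exact G.irrefl (mem_nbhd.1 (h2 hv)).2
  · rintro ⟨v, A⟩ - ⟨v', A'⟩ - h
    simp only [Prod.mk.injEq] at h
    obtain ⟨rfl, rfl⟩ := h
    rfl

/-- Few graphs have a vertex of degree at least `M`. -/
lemma card_large_degree_mul_le {m k : ℕ} {κ : ℝ} {f g : ℕ} (hf : 0 < f) (hg : 0 < g)
    (hfN : f + 2 * m + Fintype.card V ≤ Fintype.card V ^ 2)
    (hgN : g + k + 1 ≤ Fintype.card V) (hκ : 2 * m / f + k / g ≤ κ) (r M : ℕ)
    (hM : k + r ≤ M) :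
    (((coreFin V m k).filter fun G => ∃ v, M ≤ degIn G Finset.univ v).card : ℝ) * M.choose r ≤
      (Fintype.card V : ℝ) ^ (r + 1) * κ ^ r * (coreFin V m k).card := by
  have hκ0 : 0 ≤ κ := le_trans (by positivity) hκ
  have h := card_many_present_mul_le (coreFin V m k) (starPatterns V r) (StarPresent k)
    (fun _ _ => False) 0 (fun _ => κ ^ r) (coreFin V m k).card (fun _ _ => by positivity)
    (by positivity) (by simp) 1 (by
      intro l hl hlI _
      have := card_stars_le hf hg hfN hgN hκ r l
        (fun p hp => (mem_starPatterns.1 (hlI p hp)).1)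
        (fun p hp => (mem_starPatterns.1 (hlI p hp)).2) (by
          obtain ⟨p, rfl⟩ := List.length_eq_one_iff.1 hl
          simp)
      convert this) (M.choose r)
  rw [mul_zero, Nat.sub_zero, pow_one, pow_one, Finset.sum_const, nsmul_eq_mul] at h
  refine le_trans ?_ (h.trans ?_)
  · gcongr
    rintro ⟨v, hv⟩
    refine le_trans ?_ (choose_le_card_starPresent G)
    refine le_trans (Nat.choose_le_choose r hv) ?_
    exact Finset.single_le_sum (f := fun v => (degIn G Finset.univ v).choose r)
      (fun _ _ => Nat.zero_le _) (Finset.mem_filter.2 ⟨Finset.mem_univ v, hM.trans hv⟩)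
  · gcongr
    exact_mod_cast card_starPatterns_le r

/-- The graphs of the model with all degrees at most `M`. -/
noncomputable def boundedCore (V : Type u) [Fintype V] (m k M : ℕ) : Finset (SimpleGraph V) :=
  (coreFin V m k).filter fun G => ∀ v, degIn G Finset.univ v ≤ M

lemma mem_boundedCore {m k M : ℕ} {G : SimpleGraph V} :
    G ∈ boundedCore V m k M ↔ G.edgeSet.ncard = m ∧ (∀ v, k ≤ degIn G Finset.univ v) ∧
      ∀ v, degIn G Finset.univ v ≤ M := by
  rw [boundedCore, Finset.mem_filter, mem_coreFin, and_assoc]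

/-- Two stars are in conflict if they share a vertex. -/
def StarConflict (p q : V × Finset V) : Prop :=
  ¬ Disjoint (insert p.1 p.2) (insert q.1 q.2)

lemma card_starConflict_le {k r M : ℕ} {G : SimpleGraph V}
    (hG : ∀ v, degIn G Finset.univ v ≤ M) {p : V × Finset V} (hp : p ∈ starPatterns V r) :
    ((starPatterns V r).filter fun q => StarPresent k q G ∧ StarConflict p q).card ≤
      (r + 1) * ((M + 1) * M ^ r) := by
  rw [mem_starPatterns] at hp
  -- the centre of a star through `y` is `y` or a neighbour of `y`
  have hsub : ((starPatterns V r).filter fun q => StarPresent k q G ∧ StarConflict p q) ⊆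
      (insert p.1 p.2).biUnion fun y => (insert y (nbhd G Finset.univ y)).biUnion fun c =>
        ((nbhd G Finset.univ c).powersetCard r).image (Prod.mk c) := by
    rintro ⟨c, A⟩ hq
    rw [Finset.mem_filter, mem_starPatterns, StarConflict, Finset.not_disjoint_iff] at hq
    obtain ⟨⟨h1, h2⟩, ⟨h3, h4⟩, y, hy, hy'⟩ := hq
    simp only [Finset.mem_biUnion, Finset.mem_image, Finset.mem_powersetCard]
    refine ⟨y, hy, c, ?_, A, ⟨h3, h1⟩, rfl⟩
    rw [Finset.mem_insert] at hy' ⊢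
    rcases hy' with h | h
    · exact Or.inl h.symm
    · exact Or.inr (mem_nbhd.2 ⟨Finset.mem_univ _, (mem_nbhd.1 (h3 h)).2.symm⟩)
  refine (Finset.card_le_card hsub).trans ?_
  refine (Finset.card_biUnion_le_card_mul _ _ ((M + 1) * M ^ r) fun y _ => ?_).trans ?_
  · refine (Finset.card_biUnion_le_card_mul _ _ (M ^ r) fun c _ => ?_).trans ?_
    · refine Finset.card_image_le.trans ?_
      rw [Finset.card_powersetCard]
      exact (Nat.choose_le_pow _ _).trans (Nat.pow_le_pow_left (hG c) r)
    · refine Nat.mul_le_mul_right _ ((Finset.card_insert_le _ _).trans ?_)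
      exact Nat.add_le_add_right (hG y) 1
  · refine Nat.mul_le_mul_right _ ((Finset.card_insert_le _ _).trans ?_)
    rw [hp.1]

/-- Few graphs contain many stars with `r` leaves. -/
lemma card_many_stars_mul_le {m k : ℕ} {κ : ℝ} {f g : ℕ} (hf : 0 < f) (hg : 0 < g)
    (hfN : f + 2 * m + Fintype.card V ≤ Fintype.card V ^ 2)
    (hgN : g + k + 1 ≤ Fintype.card V) (hκ : 2 * m / f + k / g ≤ κ) (r M j X : ℕ) :
    (((boundedCore V m k M).filter fun G =>
        X ≤ ∑ v ∈ Finset.univ.filter (fun v => k + r ≤ degIn G Finset.univ v),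
          (degIn G Finset.univ v).choose r).card : ℝ) *
        ((X - j * ((r + 1) * ((M + 1) * M ^ r)) : ℕ) : ℝ) ^ j ≤
      ((Fintype.card V : ℝ) ^ (r + 1) * κ ^ r) ^ j * (coreFin V m k).card := by
  have hκ0 : 0 ≤ κ := le_trans (by positivity) hκ
  have hP : ∀ l : List (V × Finset V), l.length = j → (∀ i ∈ l, i ∈ starPatterns V r) →
      l.Pairwise (fun a b => ¬ StarConflict b a) →
      (((boundedCore V m k M).filter fun G => ∀ p ∈ l, StarPresent k p G).card : ℝ) ≤
        (l.map fun _ => κ ^ r).prod * (coreFin V m k).card := by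
    intro l hl hlI hlp
    refine le_trans ?_ (card_stars_le hf hg hfN hgN hκ r l
      (fun p hp => (mem_starPatterns.1 (hlI p hp)).1)
      (fun p hp => (mem_starPatterns.1 (hlI p hp)).2)
      (hlp.imp fun {a b} h => (not_not.1 h).symm))
    rw [Nat.cast_le]
    exact Finset.card_le_card (Finset.filter_subset_filter _ (Finset.filter_subset _ _))
  have h := card_many_present_mul_le (boundedCore V m k M) (starPatterns V r) (StarPresent k)
    StarConflict ((r + 1) * ((M + 1) * M ^ r))
    (fun _ => κ ^ r) (coreFin V m k).card (fun _ _ => by positivity) (by positivity)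
    (fun G hG p hp _ => card_starConflict_le (mem_boundedCore.1 hG).2.2 hp) j
    (fun l h1 h2 h3 => by convert hP l h1 h2 h3) X
  rw [Finset.sum_const, nsmul_eq_mul] at h
  refine le_trans ?_ (h.trans ?_)
  · gcongr
    exact choose_le_card_starPresent _
  · gcongr
    exact_mod_cast card_starPatterns_le r

lemma cube_le_choose_three {d : ℕ} (hd : 3 ≤ d) : d ^ 3 ≤ 27 * d.choose 3 := by
  obtain ⟨e, rfl⟩ := Nat.exists_eq_add_of_le hd
  have h : 6 * (3 + e).choose 3 = (e + 3) * (e + 2) * (e + 1) := by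
    have := Nat.descFactorial_eq_factorial_mul_choose (3 + e) 3
    simp only [Nat.descFactorial, Nat.factorial] at this
    rw [show 3 + e - 2 = e + 1 by omega, show 3 + e - 1 = e + 2 by omega,
      show 3 + e - 0 = e + 3 by omega] at this
    nlinarith
  have h2 : 2 * (3 + e) ^ 3 ≤ 9 * ((e + 3) * (e + 2) * (e + 1)) := by
    ring_nf
    nlinarith [Nat.zero_le (e ^ 3), Nat.zero_le (e ^ 2)]
  omega

/-- The square of the degrees summed over the vertices of large degree is small compared with the
number of stars with three leaves. -/
lemma sum_sq_large_le {k X : ℕ} {Δ : ℝ} (hΔ : (k : ℝ) + 3 ≤ Δ) (d : V → ℕ)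
    (hX : ∑ v ∈ Finset.univ.filter (fun v => k + 3 ≤ d v), (d v).choose 3 ≤ X) :
    ∑ v ∈ Finset.univ.filter (fun v => Δ ≤ d v), (d v : ℝ) ^ 2 ≤ 27 * X / Δ := by
  have hΔ0 : 0 < Δ := lt_of_lt_of_le (by positivity) hΔ
  rw [le_div_iff₀ hΔ0, Finset.sum_mul]
  have h1 : ∀ v ∈ Finset.univ.filter (fun v => Δ ≤ d v),
      (d v : ℝ) ^ 2 * Δ ≤ 27 * ((d v).choose 3 : ℝ) := by
    intro v hv
    rw [Finset.mem_filter] at hv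
    have h3 : 3 ≤ d v := by
      have : (3 : ℝ) ≤ d v := by linarith [hv.2, (Nat.cast_nonneg k : (0 : ℝ) ≤ k)]
      exact_mod_cast this
    calc (d v : ℝ) ^ 2 * Δ ≤ (d v : ℝ) ^ 2 * d v := by gcongr; exact hv.2
      _ = ((d v ^ 3 : ℕ) : ℝ) := by push_cast; ring
      _ ≤ ((27 * (d v).choose 3 : ℕ) : ℝ) := by exact_mod_cast cube_le_choose_three h3
      _ = _ := by push_cast; ring
  refine (Finset.sum_le_sum h1).trans ?_
  rw [← Finset.mul_sum]
  gcongr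
  rw [← Nat.cast_sum, Nat.cast_le]
  refine le_trans (Finset.sum_le_sum_of_subset ?_) hX
  intro v hv
  rw [Finset.mem_filter] at hv ⊢
  refine ⟨hv.1, ?_⟩
  exact_mod_cast hΔ.trans hv.2

lemma sum_sq_le {k X : ℕ} (d : V → ℕ)
    (hX : ∑ v ∈ Finset.univ.filter (fun v => k + 3 ≤ d v), (d v).choose 3 ≤ X) :
    ∑ v, (d v) ^ 2 ≤ (k + 3) ^ 2 * Fintype.card V + 27 * X := by
  rw [← Finset.sum_filter_add_sum_filter_not _ (fun v => k + 3 ≤ d v), add_comm]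
  refine add_le_add ?_ ?_
  · refine (Finset.sum_le_card_nsmul _ _ ((k + 3) ^ 2) fun v hv => ?_).trans ?_
    · have := (Finset.mem_filter.1 hv).2
      exact Nat.pow_le_pow_left (by omega) 2
    · rw [smul_eq_mul, mul_comm]
      exact Nat.mul_le_mul_left _ (Finset.card_filter_le _ _)
  · refine le_trans ?_ (Nat.mul_le_mul_left 27 hX)
    rw [Finset.mul_sum]
    refine Finset.sum_le_sum fun v hv => ?_
    have := (Finset.mem_filter.1 hv).2
    exact (Nat.pow_le_pow_right (by omega) (by norm_num)).trans
      (cube_le_choose_three (by omega))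

end DegreeBounds

/-! ### Vertices of small degree -/

section LowerTail

open scoped Classical

variable {V : Type u} [Fintype V]

lemma card_adj_pairs_fst_mem (G : SimpleGraph V) (A : Finset V) :
    (Finset.univ.filter fun p : V × V => G.Adj p.1 p.2 ∧ p.1 ∈ A).card =
      ∑ v ∈ A, degIn G Finset.univ v := by
  have : (Finset.univ.filter fun p : V × V => G.Adj p.1 p.2 ∧ p.1 ∈ A).card =
      (A.sigma fun v => nbhd G Finset.univ v).card := by
    refine Finset.card_bij (fun p _ => ⟨p.1, p.2⟩) ?_ ?_ ?_
    · rintro ⟨a, b⟩ h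
      simp [mem_nbhd] at h ⊢
      tauto
    · rintro ⟨a, b⟩ _ ⟨a', b'⟩ _ h
      simpa using h
    · rintro ⟨a, b⟩ h
      simp [mem_nbhd] at h
      exact ⟨(a, b), by simp; tauto, rfl⟩
  rw [this, Finset.card_sigma]
  rfl

lemma card_adj_pairs_snd_mem (G : SimpleGraph V) (A : Finset V) :
    (Finset.univ.filter fun p : V × V => G.Adj p.1 p.2 ∧ p.2 ∈ A).card =
      ∑ v ∈ A, degIn G Finset.univ v := by
  rw [← card_adj_pairs_fst_mem]
  refine Finset.card_bij (fun p _ => p.swap) ?_ ?_ ?_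
  · rintro ⟨a, b⟩ h
    simp at h ⊢
    exact ⟨h.1.symm, h.2⟩
  · rintro ⟨a, b⟩ _ ⟨a', b'⟩ _ h
    simp at h ⊢
    tauto
  · rintro ⟨a, b⟩ h
    simp at h
    exact ⟨(b, a), by simp; exact ⟨h.1.symm, h.2⟩, rfl⟩

/-- The total excess of the degrees over `k` is carried by the vertices of degree above `k`. -/
lemma excess_le_sum {m k : ℕ} {G : SimpleGraph V} (hm : G.edgeSet.ncard = m) :
    2 * m ≤ k * Fintype.card V +
      ∑ v ∈ Finset.univ.filter (fun v => k < degIn G Finset.univ v), degIn G Finset.univ v := by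
  rw [← hm, ← sum_degIn,
    ← Finset.sum_filter_add_sum_filter_not _ (fun v => k < degIn G Finset.univ v), add_comm]
  refine Nat.add_le_add_right ?_ _
  refine (Finset.sum_le_card_nsmul _ _ k fun v hv => ?_).trans ?_
  · exact not_lt.1 (Finset.mem_filter.1 hv).2
  · rw [smul_eq_mul, mul_comm]
    exact Nat.mul_le_mul_left _ (Finset.card_filter_le _ _)

/-- The graphs of bounded degree in which all vertices of the list `l` have degree below `D`. -/
noncomputable def lowEvent (V : Type u) [Fintype V] (m k M D : ℕ) (l : List V) :
    Finset (SimpleGraph V) :=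
  (boundedCore V m k M).filter fun G => ∀ v ∈ l, degIn G Finset.univ v < D

/-- Raising the degree of `v` by one: an edge `zy` with `y` of degree above `k` is replaced by
`zv`. -/
lemma card_degree_eq_mul_le {m k M D : ℕ} (hDM : D ≤ M) {l : List V} {v : V} (hv : v ∉ l)
    {a : ℕ} (ha : a < D) {f : ℕ} (hf : f + k * Fintype.card V + D * M ≤ 2 * m) :
    ((lowEvent V m k M D l).filter fun G => degIn G Finset.univ v = a).card * f ≤
      ((lowEvent V m k M D l).filter fun G => degIn G Finset.univ v = a + 1).card *
        (D * Fintype.card V) := by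
  refine card_mul_le_card_mul_of_moves _ _
    (fun G => Finset.univ.filter fun p : V × V =>
      (G.Adj p.1 p.2 ∧ k < degIn G Finset.univ p.2) ∧ p.1 ≠ v ∧ ¬ G.Adj v p.1)
    (fun G => nbhd G Finset.univ v ×ˢ Finset.univ)
    (fun G p => swap G {s(p.1, p.2)} {s(p.1, v)}) (fun G p => swap G {s(p.1, v)} {s(p.1, p.2)})
    ?_ ?_ ?_
  · intro G hG
    rw [Finset.mem_filter, lowEvent, Finset.mem_filter, mem_boundedCore] at hG
    obtain ⟨⟨⟨hm, hk, hM⟩, hl⟩, hd⟩ := hG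
    have h1 := excess_le_sum (k := k) hm
    rw [← card_adj_pairs_snd_mem] at h1
    have h2 : (Finset.univ.filter fun p : V × V => G.Adj p.1 p.2 ∧
        p.1 ∈ insert v (nbhd G Finset.univ v)).card ≤ D * M := by
      rw [card_adj_pairs_fst_mem]
      refine (Finset.sum_le_card_nsmul _ _ M fun u _ => hM u).trans ?_
      rw [smul_eq_mul]
      refine Nat.mul_le_mul_right _ ((Finset.card_insert_le _ _).trans ?_)
      have : (nbhd G Finset.univ v).card = a := hd
      omega
    have h3 := Finset.card_le_card (s := Finset.univ.filter fun p : V × V => G.Adj p.1 p.2 ∧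
        p.2 ∈ Finset.univ.filter (fun v => k < degIn G Finset.univ v))
      (t := (Finset.univ.filter fun p : V × V =>
        (G.Adj p.1 p.2 ∧ k < degIn G Finset.univ p.2) ∧ p.1 ≠ v ∧ ¬ G.Adj v p.1) ∪
        (Finset.univ.filter fun p : V × V => G.Adj p.1 p.2 ∧
          p.1 ∈ insert v (nbhd G Finset.univ v))) (by
        intro p
        simp only [Finset.mem_union, Finset.mem_filter, Finset.mem_univ, true_and,
          Finset.mem_insert, mem_nbhd]
        tauto)
    have h4 := Finset.card_union_le (Finset.univ.filter fun p : V × V =>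
        (G.Adj p.1 p.2 ∧ k < degIn G Finset.univ p.2) ∧ p.1 ≠ v ∧ ¬ G.Adj v p.1)
        (Finset.univ.filter fun p : V × V => G.Adj p.1 p.2 ∧
          p.1 ∈ insert v (nbhd G Finset.univ v))
    omega
  · intro G hG
    have : (nbhd G Finset.univ v).card = a + 1 := (Finset.mem_filter.1 hG).2
    rw [Finset.card_product, Finset.card_univ, this]
    exact Nat.mul_le_mul_right _ ha
  · rintro G hG ⟨z, y⟩ hp
    rw [Finset.mem_filter, lowEvent, Finset.mem_filter, mem_boundedCore] at hG
    obtain ⟨⟨⟨hm, hk, hM⟩, hl⟩, hd⟩ := hG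
    simp only [Finset.mem_filter, Finset.mem_univ, true_and] at hp
    obtain ⟨⟨hzy, hy⟩, hzv, hvz⟩ := hp
    have hyv : y ≠ v := fun h => hvz (h ▸ hzy.symm)
    have hs : IsSwap G {s(z, y)} {s(z, v)} := by
      refine ⟨?_, ?_, ?_⟩
      · simpa using hzy
      · simpa using fun h : G.Adj z v => hvz h.symm
      · simpa using hzv
    have hdeg : ∀ u, degIn (swap G {s(z, y)} {s(z, v)}) Finset.univ u + (if u = y then 1 else 0)
        = degIn G Finset.univ u + if u = v then 1 else 0 := by
      intro u
      have := hs.degree_eq u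
      rw [incCount_singleton, incCount_singleton] at this
      by_cases hu : u = z
      · subst hu
        simp at this
        rw [if_neg hzy.ne, if_neg hzv]
        omega
      · simpa [hu] using this
    dsimp only
    refine ⟨?_, ?_, hs.swap_swap⟩
    · rw [Finset.mem_filter, lowEvent, Finset.mem_filter, mem_boundedCore]
      refine ⟨⟨⟨?_, fun u => ?_, fun u => ?_⟩, fun u hu => ?_⟩, ?_⟩
      · have := hs.ncard_edgeSet
        simp at this
        omega
      · have h1 := hdeg u
        have h2 := hk u
        by_cases huy : u = y
        · subst huy
          simp at h1
          omega
        · rw [if_neg huy] at h1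
          omega
      · have h1 := hdeg u
        have h2 := hM u
        by_cases huv : u = v
        · subst huv
          simp at h1
          omega
        · rw [if_neg huv] at h1
          omega
      · have h1 := hdeg u
        have h2 := hl u hu
        have huv : u ≠ v := fun h => hv (h ▸ hu)
        rw [if_neg huv] at h1
        omega
      · have h1 := hdeg v
        rw [if_neg hyv.symm, if_pos rfl] at h1
        omega
    · simp only [Finset.mem_product, mem_nbhd, swap_adj, Finset.mem_univ, and_true, true_and]
      exact ⟨Or.inr (by rw [Finset.mem_singleton, Sym2.eq_swap]), hzv.symm⟩

/-- Conditioning a further vertex to have degree below `D` costs a factor bounded away from `1`. -/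
lemma card_lowEvent_cons_le {m k M D : ℕ} (hDM : D ≤ M) {l : List V} {v : V} (hv : v ∉ l)
    {f : ℕ} (hf0 : 0 < f) (hf : f + k * Fintype.card V + D * M ≤ 2 * m) {ρ : ℝ} (hρ1 : 1 ≤ ρ)
    (hρ : (D : ℝ) * Fintype.card V / f ≤ ρ) :
    ((lowEvent V m k M D (v :: l)).card : ℝ) ≤
      (D * ρ ^ D / (1 + D * ρ ^ D)) * (lowEvent V m k M D l).card := by
  set Ω := lowEvent V m k M D l with hΩ
  set N : ℕ → ℝ := fun a => ((Ω.filter fun G => degIn G Finset.univ v = a).card : ℝ) with hN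
  have hstep : ∀ a < D, N a ≤ ρ * N (a + 1) := by
    intro a ha
    have h1 := card_degree_eq_mul_le hDM hv ha hf
    have h2 : N a * f ≤ N (a + 1) * (D * Fintype.card V) := by
      simp only [hN]
      exact_mod_cast h1
    have h3 : N a ≤ N (a + 1) * (D * Fintype.card V / f) := by
      rw [← mul_div_assoc, le_div_iff₀ (by positivity)]
      exact h2
    refine h3.trans ?_
    rw [mul_comm]
    exact mul_le_mul_of_nonneg_right hρ (Nat.cast_nonneg _)
  have hiter : ∀ s, s ≤ D → N (D - s) ≤ ρ ^ s * N D := by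
    intro s
    induction s with
    | zero => intro _; simp
    | succ s ih =>
      intro hs
      have h1 := hstep (D - (s + 1)) (by omega)
      rw [show D - (s + 1) + 1 = D - s by omega] at h1
      refine h1.trans ?_
      rw [pow_succ', mul_assoc]
      exact mul_le_mul_of_nonneg_left (ih (by omega)) (by linarith)
  have hall : ∀ a < D, N a ≤ ρ ^ D * N D := by
    intro a ha
    have h1 := hiter (D - a) (by omega)
    rw [show D - (D - a) = a by omega] at h1
    refine h1.trans (mul_le_mul_of_nonneg_right ?_ (Nat.cast_nonneg _))
    exact pow_le_pow_right₀ hρ1 (by omega)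
  have hlow : ((lowEvent V m k M D (v :: l)).card : ℝ) = ∑ a ∈ Finset.range D, N a := by
    have h1 : lowEvent V m k M D (v :: l) = Ω.filter fun G => degIn G Finset.univ v < D := by
      ext G
      simp only [hΩ, lowEvent, Finset.mem_filter, List.mem_cons, forall_eq_or_imp]
      tauto
    rw [h1, Finset.card_eq_sum_card_fiberwise (f := fun G => degIn G Finset.univ v)
      (t := Finset.range D)]
    · push_cast
      refine Finset.sum_congr rfl fun a ha => ?_
      simp only [hN]
      congr 2
      ext G
      simp only [Finset.mem_filter]
      constructor
      · rintro ⟨⟨h1, h2⟩, h3⟩; exact ⟨h1, h3⟩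
      · rintro ⟨h1, h3⟩; exact ⟨⟨h1, h3 ▸ Finset.mem_range.1 ha⟩, h3⟩
    · intro G hG
      simpa using (Finset.mem_filter.1 hG).2
  have hle : ((lowEvent V m k M D (v :: l)).card : ℝ) ≤ D * ρ ^ D * N D := by
    rw [hlow]
    refine (Finset.sum_le_card_nsmul _ _ (ρ ^ D * N D) fun a ha =>
      hall a (Finset.mem_range.1 ha)).trans ?_
    rw [Finset.card_range, nsmul_eq_mul, mul_assoc]
  have hsum : ((lowEvent V m k M D (v :: l)).card : ℝ) + N D ≤ Ω.card := by
    simp only [hN]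
    rw [← Nat.cast_add, Nat.cast_le, ← Finset.card_union_of_disjoint]
    · refine Finset.card_le_card (Finset.union_subset ?_ (Finset.filter_subset _ _))
      intro G
      simp only [hΩ, lowEvent, Finset.mem_filter, List.mem_cons, forall_eq_or_imp]
      tauto
    · rw [Finset.disjoint_left]
      intro G hG hG'
      rw [lowEvent, Finset.mem_filter] at hG
      have h1 := hG.2 v (List.mem_cons_self)
      have h2 := (Finset.mem_filter.1 hG').2
      omega
  have hpos : 0 ≤ (D : ℝ) * ρ ^ D := by positivity
  rw [div_mul_eq_mul_div, le_div_iff₀ (by linarith)]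
  nlinarith

/-- Few graphs have many vertices in `S` of degree below `D`. -/
lemma card_many_low_mul_le {m k M D : ℕ} (hDM : D ≤ M) (S : Finset V)
    {f : ℕ} (hf0 : 0 < f) (hf : f + k * Fintype.card V + D * M ≤ 2 * m) {ρ : ℝ} (hρ1 : 1 ≤ ρ)
    (hρ : (D : ℝ) * Fintype.card V / f ≤ ρ) (j X : ℕ) :
    (((boundedCore V m k M).filter fun G =>
        X ≤ (S.filter fun v => degIn G Finset.univ v < D).card).card : ℝ) *
        ((X - j : ℕ) : ℝ) ^ j ≤
      (S.card * (D * ρ ^ D / (1 + D * ρ ^ D))) ^ j * (boundedCore V m k M).card := by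
  have hw : (0 : ℝ) ≤ D * ρ ^ D / (1 + D * ρ ^ D) := by positivity
  have hP : ∀ l : List V, l.Nodup → ((lowEvent V m k M D l).card : ℝ) ≤
      (l.map fun _ => (D * ρ ^ D / (1 + D * ρ ^ D) : ℝ)).prod * (boundedCore V m k M).card := by
    intro l hl
    induction l with
    | nil => simp [lowEvent]
    | cons v l ih =>
      rw [List.nodup_cons] at hl
      refine (card_lowEvent_cons_le hDM hl.1 hf0 hf hρ1 hρ).trans ?_
      rw [List.map_cons, List.prod_cons, mul_assoc]
      exact mul_le_mul_of_nonneg_left (ih hl.2) hw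
  have h := card_many_present_mul_le (boundedCore V m k M) S
    (fun v G => degIn G Finset.univ v < D) (fun a b => a = b) 1
    (fun _ => D * ρ ^ D / (1 + D * ρ ^ D)) (boundedCore V m k M).card (fun _ _ => hw)
    (by positivity)
    (fun G _ v _ _ => by
      refine (Finset.card_le_card (t := {v}) fun x hx => ?_).trans (by simp)
      have hx' := (@Finset.mem_filter _ _ (_) _ _).1 hx
      simpa using hx'.2.2.symm) j
    (fun l _ _ h3 => by
      convert hP l (h3.imp fun {a b} h (hab : a = b) => h hab.symm)
      rw [lowEvent]
      congr!) X
  rw [Finset.sum_const, nsmul_eq_mul, mul_one] at h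
  convert h

end LowerTail

/-! ### Short trails for a given degree sequence -/

section Trails

open scoped Classical

variable {V : Type u} [Fintype V]

/-- The graphs with degree sequence `d`. -/
noncomputable def fixedDegree (d : V → ℕ) : Finset (SimpleGraph V) :=
  Finset.univ.filter fun G => ∀ v, degIn G Finset.univ v = d v

/-- The graphs with degree sequence `d` containing all the edges in the list `L`. -/
noncomputable def edgesEvent (d : V → ℕ) (L : List (V × V)) : Finset (SimpleGraph V) :=
  (fixedDegree d).filter fun G => ∀ e ∈ L, G.Adj e.1 e.2

lemma mem_edgesEvent {d : V → ℕ} {L : List (V × V)} {G : SimpleGraph V} :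
    G ∈ edgesEvent d L ↔ (∀ v, degIn G Finset.univ v = d v) ∧ ∀ e ∈ L, G.Adj e.1 e.2 := by
  simp [edgesEvent, fixedDegree]

/-- The switch replacing the edges `xy` and `zw` by `xz` and `yw` bounds the probability of a
further edge `xy` for a given degree sequence. -/
lemma card_edgesEvent_cons_mul_le {d : V → ℕ} {M : ℕ} (hd : ∀ v, d v ≤ M) {L : List (V × V)}
    {x y : V} (hxy : s(x, y) ∉ L.map fun e => s(e.1, e.2)) {f : ℕ}
    (hf : f + 2 * ((M + 1) * M) + 2 * L.length ≤ ∑ v, d v) :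
    (edgesEvent d ((x, y) :: L)).card * f ≤ (edgesEvent d L).card * (d x * d y) := by
  refine card_mul_le_card_mul_of_moves _ _
    (fun G => Finset.univ.filter fun p : V × V =>
      (G.Adj p.1 p.2 ∧ s(p.1, p.2) ∉ L.map fun e => s(e.1, e.2)) ∧
      p.1 ∉ insert x (nbhd G Finset.univ x) ∧ p.2 ∉ insert y (nbhd G Finset.univ y))
    (fun G => nbhd G Finset.univ x ×ˢ nbhd G Finset.univ y)
    (fun G p => swap G {s(x, y), s(p.1, p.2)} {s(x, p.1), s(y, p.2)})
    (fun G p => swap G {s(x, p.1), s(y, p.2)} {s(x, y), s(p.1, p.2)}) ?_ ?_ ?_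
  · intro G hG
    rw [mem_edgesEvent] at hG
    have hdM : ∀ v, degIn G Finset.univ v ≤ M := fun v => (hG.1 v).le.trans (hd v)
    have h0 : (Finset.univ.filter fun p : V × V => G.Adj p.1 p.2).card = ∑ v, d v := by
      rw [card_adj_pairs, ← sum_degIn]
      exact Finset.sum_congr rfl fun v _ => hG.1 v
    have hnb : ∀ v, ∑ u ∈ insert v (nbhd G Finset.univ v), degIn G Finset.univ u ≤
        (M + 1) * M := by
      intro v
      refine (Finset.sum_le_card_nsmul _ _ M fun u _ => hdM u).trans ?_
      rw [smul_eq_mul]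
      refine Nat.mul_le_mul_right _ ((Finset.card_insert_le _ _).trans ?_)
      exact Nat.add_le_add_right (hdM v) 1
    have h1 := (card_adj_pairs_fst_mem G (insert x (nbhd G Finset.univ x))).le.trans (hnb x)
    have h2 := (card_adj_pairs_snd_mem G (insert y (nbhd G Finset.univ y))).le.trans (hnb y)
    have h3 : (L.toFinset ∪ L.toFinset.image Prod.swap).card ≤ 2 * L.length := by
      refine (Finset.card_union_le _ _).trans ?_
      have := List.toFinset_card_le L
      have := Finset.card_image_le (s := L.toFinset) (f := Prod.swap)
      omega
    have hsub : (Finset.univ.filter fun p : V × V => G.Adj p.1 p.2) ⊆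
        (Finset.univ.filter fun p : V × V =>
          (G.Adj p.1 p.2 ∧ s(p.1, p.2) ∉ L.map fun e => s(e.1, e.2)) ∧
          p.1 ∉ insert x (nbhd G Finset.univ x) ∧ p.2 ∉ insert y (nbhd G Finset.univ y)) ∪
        ((Finset.univ.filter fun p : V × V => G.Adj p.1 p.2 ∧
          p.1 ∈ insert x (nbhd G Finset.univ x)) ∪
        ((Finset.univ.filter fun p : V × V => G.Adj p.1 p.2 ∧
          p.2 ∈ insert y (nbhd G Finset.univ y)) ∪
        (L.toFinset ∪ L.toFinset.image Prod.swap))) := by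
      rintro ⟨z, w⟩ h
      by_cases hL : s(z, w) ∈ L.map fun e => s(e.1, e.2)
      · refine Finset.mem_union_right _ (Finset.mem_union_right _ (Finset.mem_union_right _ ?_))
        obtain ⟨⟨a, b⟩, hab, heq⟩ := List.mem_map.1 hL
        rw [Sym2.eq_iff] at heq
        rw [Finset.mem_union, Finset.mem_image]
        rcases heq with ⟨rfl, rfl⟩ | ⟨rfl, rfl⟩
        · exact Or.inl (List.mem_toFinset.2 hab)
        · exact Or.inr ⟨_, List.mem_toFinset.2 hab, rfl⟩
      · rw [Finset.mem_filter] at h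
        simp only [Finset.mem_union, Finset.mem_filter, Finset.mem_univ, true_and, h.2, hL,
          not_false_eq_true]
        tauto
    have h4 := Finset.card_le_card hsub
    have h5 := h4.trans ((Finset.card_union_le _ _).trans (Nat.add_le_add_left
      ((Finset.card_union_le _ _).trans (Nat.add_le_add_left (Finset.card_union_le _ _) _)) _))
    rw [h0] at h5
    omega
  · intro G hG
    rw [mem_edgesEvent] at hG
    rw [Finset.card_product, ← hG.1 x, ← hG.1 y]
    rfl
  · rintro G hG ⟨z, w⟩ hp
    rw [mem_edgesEvent] at hG
    have hxyG : G.Adj x y := hG.2 (x, y) List.mem_cons_self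
    simp only [Finset.mem_filter, Finset.mem_univ, true_and, Finset.mem_insert, mem_nbhd,
      not_or] at hp
    obtain ⟨⟨hzw, hL⟩, ⟨hzx, hxz⟩, hwy, hyw⟩ := hp
    have hzy : z ≠ y := fun h => hxz (h ▸ hxyG)
    have hwx : w ≠ x := fun h => hyw (h ▸ hxyG.symm)
    have hne1 : s(x, y) ≠ s(z, w) := by
      rw [Ne, Sym2.eq_iff]
      rintro (⟨h, -⟩ | ⟨h, -⟩)
      · exact hzx h.symm
      · exact hwx h.symm
    have hne2 : s(x, z) ≠ s(y, w) := by
      rw [Ne, Sym2.eq_iff]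
      rintro (⟨h, -⟩ | ⟨h, -⟩)
      · exact hxyG.ne h
      · exact hwx h.symm
    have hs : IsSwap G {s(x, y), s(z, w)} {s(x, z), s(y, w)} := by
      refine ⟨?_, ?_, ?_⟩
      · simp [hxyG, hzw]
      · simp [hxz, hyw]
      · simp [Ne.symm hzx, Ne.symm hwy]
    dsimp only
    refine ⟨?_, ?_, hs.swap_swap⟩
    · rw [mem_edgesEvent]
      refine ⟨fun v => ?_, fun e he => ?_⟩
      · have := hs.degree_eq v
        rw [incCount_pair hne1, incCount_pair hne2, hG.1 v] at this
        have hinc : ((if v ∈ s(x, y) then 1 else 0) + if v ∈ s(z, w) then 1 else 0) =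
            ((if v ∈ s(x, z) then 1 else 0) + if v ∈ s(y, w) then 1 else 0) := by
          simp only [Sym2.mem_iff]
          by_cases h1 : v = x
          · subst h1
            simp [Ne.symm hzx, Ne.symm hwx, hxyG.ne]
          · by_cases h2 : v = y
            · subst h2
              simp [Ne.symm hwy, Ne.symm hzy, hxyG.ne.symm]
            · simp [h1, h2]
              by_cases h3 : v = z
              · subst h3; simp [hzw.ne]
              · simp [h3]
        omega
      · rw [swap_adj]
        refine ⟨Or.inl ⟨hG.2 e (List.mem_cons_of_mem _ he), ?_⟩,
          (hG.2 e (List.mem_cons_of_mem _ he)).ne⟩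
        rw [Finset.mem_insert, Finset.mem_singleton, not_or]
        exact ⟨fun h => hxy (h ▸ List.mem_map_of_mem (f := fun e : V × V => s(e.1, e.2)) he),
          fun h => hL (h ▸ List.mem_map_of_mem (f := fun e : V × V => s(e.1, e.2)) he)⟩
    · rw [Finset.mem_product, mem_nbhd, mem_nbhd, swap_adj, swap_adj]
      simp [Ne.symm hzx, Ne.symm hwy]

lemma card_edgesEvent_le {d : V → ℕ} {M : ℕ} (hd : ∀ v, d v ≤ M) {f : ℕ} (hf0 : 0 < f)
    (L : List (V × V)) (hL : (L.map fun e => s(e.1, e.2)).Nodup)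
    (hf : f + 2 * ((M + 1) * M) + 2 * L.length ≤ ∑ v, d v) :
    ((edgesEvent d L).card : ℝ) ≤
      (L.map fun e => ((d e.1 : ℝ) * d e.2 / f)).prod * (fixedDegree d).card := by
  induction L with
  | nil => simp [edgesEvent]
  | cons e L ih =>
    rw [List.map_cons, List.nodup_cons] at hL
    rw [List.length_cons] at hf
    have h1 := card_edgesEvent_cons_mul_le hd (L := L) (x := e.1) (y := e.2) hL.1 (f := f)
      (by omega)
    have h2 : ((edgesEvent d (e :: L)).card : ℝ) ≤
        (d e.1 : ℝ) * d e.2 / f * (edgesEvent d L).card := by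
      rw [div_mul_eq_mul_div, le_div_iff₀ (by positivity), mul_comm (_ * _) (_ : ℝ)]
      exact_mod_cast h1
    rw [List.map_cons, List.prod_cons, mul_assoc]
    exact h2.trans (mul_le_mul_of_nonneg_left (ih hL.2 (by omega)) (by positivity))

/-- The consecutive pairs of a sequence of vertices. -/
def seqPairs {l : ℕ} (x : Fin (l + 1) → V) : List (V × V) :=
  List.ofFn fun i : Fin l => (x i.castSucc, x i.succ)

lemma mem_seqPairs {l : ℕ} {x : Fin (l + 1) → V} {e : V × V} :
    e ∈ seqPairs x ↔ ∃ i : Fin l, (x i.castSucc, x i.succ) = e := by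
  simp [seqPairs, List.mem_ofFn]

/-- The sequences of `l + 1` vertices which start and end in `T` and whose consecutive pairs are
distinct as unordered pairs: the possible trails of length `l` between vertices of `T`, closed
ones included. -/
noncomputable def trailPatterns (T : Finset V) (l : ℕ) : Finset (Fin (l + 1) → V) :=
  Finset.univ.filter fun x => x 0 ∈ T ∧ x (Fin.last l) ∈ T ∧
    ((seqPairs x).map fun e => s(e.1, e.2)).Nodup

/-- All consecutive pairs of the sequence `x` are edges of `G`. -/
def SeqPresent {l : ℕ} (x : Fin (l + 1) → V) (G : SimpleGraph V) : Prop :=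
  ∀ e ∈ seqPairs x, G.Adj e.1 e.2

/-- Two sequences are in conflict if they share a vertex. -/
def SeqConflict {l : ℕ} (x y : Fin (l + 1) → V) : Prop := ∃ a b, x a = y b

lemma seqPresent_iff {l : ℕ} {x : Fin (l + 1) → V} {G : SimpleGraph V} :
    SeqPresent x G ↔ ∀ i : Fin l, G.Adj (x i.castSucc) (x i.succ) := by
  constructor
  · exact fun h i => h _ (mem_seqPairs.2 ⟨i, rfl⟩)
  · intro h e he
    obtain ⟨i, rfl⟩ := mem_seqPairs.1 he
    exact h i

/-- In a graph of maximum degree `M` at most `M ^ l` walks of length `l` pass through a given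
vertex at a given time. -/
lemma card_seqPresent_through_le {G : SimpleGraph V} {M : ℕ}
    (hG : ∀ v, degIn G Finset.univ v ≤ M) (v : V) (l : ℕ) (b : Fin (l + 1)) :
    (Finset.univ.filter fun x : Fin (l + 1) → V => SeqPresent x G ∧ x b = v).card ≤ M ^ l := by
  induction l with
  | zero =>
    rw [pow_zero, Finset.card_le_one]
    intro x hx y hy
    simp only [Finset.mem_filter, Finset.mem_univ, true_and] at hx hy
    funext i
    rw [show i = b from Fin.ext (by omega), hx.2, hy.2]
  | succ l ih =>
    rw [pow_succ]
    induction b using Fin.cases with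
    | zero =>
      refine le_trans ?_ (Nat.mul_le_mul_right M (ih 0))
      refine le_trans ?_ (Finset.sum_le_card_nsmul _
        (fun t : Fin (l + 1) → V => (nbhd G Finset.univ (t (Fin.last l))).card) M
        fun t _ => hG _)
      rw [← Finset.card_sigma]
      refine Finset.card_le_card_of_injOn (fun x => ⟨Fin.init x, x (Fin.last _)⟩) ?_ ?_
      · intro x hx
        simp only [Finset.coe_filter, Finset.mem_univ, true_and, Set.mem_ofPred_eq,
          seqPresent_iff] at hx
        simp only [Finset.coe_sigma, Set.mem_sigma_iff, Finset.mem_coe, Finset.mem_filter,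
          Finset.mem_univ, true_and, mem_nbhd, seqPresent_iff]
        exact ⟨⟨fun i => hx.1 i.castSucc, hx.2⟩, hx.1 (Fin.last l)⟩
      · intro x _ y _ h
        simp only [Sigma.mk.injEq, heq_eq_eq] at h
        rw [← Fin.snoc_init_self x, ← Fin.snoc_init_self y, h.1, h.2]
    | succ b =>
      refine le_trans ?_ (Nat.mul_le_mul_right M (ih b))
      refine le_trans ?_ (Finset.sum_le_card_nsmul _
        (fun t : Fin (l + 1) → V => (nbhd G Finset.univ (t 0)).card) M fun t _ => hG _)
      rw [← Finset.card_sigma]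
      refine Finset.card_le_card_of_injOn (fun x => ⟨Fin.tail x, x 0⟩) ?_ ?_
      · intro x hx
        simp only [Finset.coe_filter, Finset.mem_univ, true_and, Set.mem_ofPred_eq,
          seqPresent_iff] at hx
        simp only [Finset.coe_sigma, Set.mem_sigma_iff, Finset.mem_coe, Finset.mem_filter,
          Finset.mem_univ, true_and, mem_nbhd, seqPresent_iff]
        exact ⟨⟨fun i => hx.1 i.succ, hx.2⟩, (hx.1 0).symm⟩
      · intro x _ y _ h
        simp only [Sigma.mk.injEq, heq_eq_eq] at h
        rw [← Fin.cons_self_tail x, ← Fin.cons_self_tail y, h.1, h.2]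

lemma card_seqConflict_le {G : SimpleGraph V} {M : ℕ} (hG : ∀ v, degIn G Finset.univ v ≤ M)
    {l : ℕ} (T : Finset V) (x : Fin (l + 1) → V) :
    ((trailPatterns T l).filter fun y => SeqPresent y G ∧ SeqConflict x y).card ≤
      (l + 1) * ((l + 1) * M ^ l) := by
  have hsub : ((trailPatterns T l).filter fun y => SeqPresent y G ∧ SeqConflict x y) ⊆
      (Finset.univ : Finset (Fin (l + 1))).biUnion fun a =>
        (Finset.univ : Finset (Fin (l + 1))).biUnion fun b =>
          Finset.univ.filter fun y : Fin (l + 1) → V => SeqPresent y G ∧ y b = x a := by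
    intro y hy
    rw [Finset.mem_filter] at hy
    obtain ⟨-, h1, a, b, hab⟩ := hy
    simp only [Finset.mem_biUnion, Finset.mem_univ, true_and, Finset.mem_filter]
    exact ⟨a, b, h1, hab.symm⟩
  refine (Finset.card_le_card hsub).trans ?_
  refine (Finset.card_biUnion_le_card_mul _ _ ((l + 1) * M ^ l) fun a _ => ?_).trans (by simp)
  refine (Finset.card_biUnion_le_card_mul _ _ (M ^ l) fun b _ => ?_).trans (by simp)
  exact card_seqPresent_through_le hG _ _ _

lemma sum_seq_prod (T : Finset V) (g : V → ℝ) (l : ℕ) (h : V → ℝ) :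
    ∑ x : Fin (l + 2) → V, h (x 0) * ((∏ i : Fin (l + 1), g (x i.castSucc) * g (x i.succ)) *
      if x (Fin.last (l + 1)) ∈ T then 1 else 0) =
      (∑ v, h v * g v) * ((∑ v, g v ^ 2) ^ l * ∑ v ∈ T, g v) := by
  have hstep : ∀ (l : ℕ) (h : V → ℝ),
      ∑ x : Fin (l + 2) → V, h (x 0) * ((∏ i : Fin (l + 1), g (x i.castSucc) * g (x i.succ)) *
        if x (Fin.last (l + 1)) ∈ T then 1 else 0) =
      (∑ v, h v * g v) * ∑ x : Fin (l + 1) → V, g (x 0) *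
        ((∏ i : Fin l, g (x i.castSucc) * g (x i.succ)) *
          if x (Fin.last l) ∈ T then 1 else 0) := by
    intro l h
    rw [← (Fin.consEquiv fun _ => V).sum_comp, Fintype.sum_prod_type, Finset.sum_mul_sum]
    refine Finset.sum_congr rfl fun v _ => Finset.sum_congr rfl fun t _ => ?_
    rw [Fin.prod_univ_succ]
    simp only [Fin.consEquiv_apply, Fin.cons_zero, Fin.castSucc_zero, Fin.cons_succ,
      ← Fin.succ_castSucc, ← Fin.succ_last]
    ring
  rw [hstep]
  congr 1
  induction l with
  | zero =>
    rw [← (Equiv.funUnique (Fin 1) V).symm.sum_comp]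
    simp [Finset.sum_ite_mem]
  | succ l ih =>
    rw [hstep, ih, pow_succ']
    simp_rw [← sq]
    ring

/-- Given a degree sequence with all degrees at most `M`, few graphs contain many trails of length
`l + 1` between vertices of `T`. -/
lemma card_many_trails_mul_le {d : V → ℕ} {M : ℕ} (hd : ∀ v, d v ≤ M) {f : ℕ} (hf0 : 0 < f)
    (T : Finset V) (l j X : ℕ) (hf : f + 2 * ((M + 1) * M) + 2 * (j * (l + 1)) ≤ ∑ v, d v) :
    (((fixedDegree d).filter fun G =>
        X ≤ ((trailPatterns T (l + 1)).filter fun x => SeqPresent x G).card).card : ℝ) *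
        ((X - j * ((l + 2) * ((l + 2) * M ^ (l + 1))) : ℕ) : ℝ) ^ j ≤
      ((∑ v ∈ T, (d v : ℝ)) ^ 2 * (∑ v, (d v : ℝ) ^ 2) ^ l / (f : ℝ) ^ (l + 1)) ^ j *
        (fixedDegree d).card := by
  set w : (Fin (l + 2) → V) → ℝ := fun x =>
    ((seqPairs x).map fun e => ((d e.1 : ℝ) * d e.2 / f)).prod with hw
  have hw0 : ∀ x, 0 ≤ w x := fun x => by
    refine List.prod_nonneg fun a ha => ?_
    obtain ⟨e, -, rfl⟩ := List.mem_map.1 ha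
    positivity
  have hprod : ∀ L : List (Fin (l + 2) → V),
      ((L.flatMap seqPairs).map fun e => ((d e.1 : ℝ) * d e.2 / f)).prod = (L.map w).prod := by
    intro L
    induction L with
    | nil => simp
    | cons x L ih => rw [List.flatMap_cons, List.map_append, List.prod_append, ih]; rfl
  have hlen : ∀ L : List (Fin (l + 2) → V), (L.flatMap seqPairs).length = L.length * (l + 1) := by
    intro L
    induction L with
    | nil => simp
    | cons x L ih =>
      rw [List.flatMap_cons, List.length_append, ih, List.length_cons]
      simp [seqPairs]
      ring
  have hP : ∀ L : List (Fin (l + 2) → V), L.length = j → (∀ x ∈ L, x ∈ trailPatterns T (l + 1)) →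
      L.Pairwise (fun a b => ¬ SeqConflict b a) →
      (((fixedDegree d).filter fun G => ∀ x ∈ L, SeqPresent x G).card : ℝ) ≤
        (L.map w).prod * (fixedDegree d).card := by
    intro L hL hLI hLp
    rw [← hprod]
    refine le_trans ?_ (card_edgesEvent_le hd hf0 (L.flatMap seqPairs) ?_ ?_)
    · rw [Nat.cast_le]
      refine Finset.card_le_card fun G hG => ?_
      rw [Finset.mem_filter] at hG
      rw [edgesEvent, Finset.mem_filter]
      refine ⟨hG.1, fun e he => ?_⟩
      obtain ⟨x, hx, hxe⟩ := List.mem_flatMap.1 he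
      exact hG.2 x hx e hxe
    · rw [List.map_flatMap, List.nodup_flatMap]
      refine ⟨fun x hx => (Finset.mem_filter.1 (hLI x hx)).2.2.2, hLp.imp ?_⟩
      intro x y hxy e hex hey
      apply hxy
      simp only [List.mem_map, mem_seqPairs] at hex hey
      obtain ⟨_, ⟨i, rfl⟩, rfl⟩ := hex
      obtain ⟨_, ⟨i', rfl⟩, h⟩ := hey
      simp only [Sym2.eq_iff] at h
      rcases h with ⟨h, -⟩ | ⟨h, -⟩
      · exact ⟨_, _, h⟩
      · exact ⟨_, _, h⟩
    · rw [hlen, hL]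
      exact hf
  have h := card_many_present_mul_le (fixedDegree d) (trailPatterns T (l + 1)) SeqPresent
    SeqConflict ((l + 2) * ((l + 2) * M ^ (l + 1))) w (fixedDegree d).card
    (fun x _ => hw0 x) (by positivity)
    (fun G hG x _ _ => card_seqConflict_le
      (fun v => ((Finset.mem_filter.1 hG).2 v).le.trans (hd v)) T x) j
    (fun L h1 h2 h3 => by convert hP L h1 h2 h3) X
  refine h.trans ?_
  have hsum : ∑ x ∈ trailPatterns T (l + 1), w x ≤
      (∑ v ∈ T, (d v : ℝ)) ^ 2 * (∑ v, (d v : ℝ) ^ 2) ^ l / (f : ℝ) ^ (l + 1) := by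
    have hwx : ∀ x, w x = (∏ i : Fin (l + 1), (d (x i.castSucc) : ℝ) * d (x i.succ)) /
        (f : ℝ) ^ (l + 1) := by
      intro x
      simp only [hw, seqPairs, List.map_ofFn, List.prod_ofFn, Function.comp_def]
      rw [Finset.prod_div_distrib]
      simp
    have heq := sum_seq_prod T (fun v => (d v : ℝ)) l (fun v => if v ∈ T then 1 else 0)
    rw [le_div_iff₀ (by positivity), Finset.sum_mul]
    calc ∑ x ∈ trailPatterns T (l + 1), w x * (f : ℝ) ^ (l + 1)
        = ∑ x ∈ trailPatterns T (l + 1),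
            (if x 0 ∈ T then (1 : ℝ) else 0) *
              ((∏ i : Fin (l + 1), (d (x i.castSucc) : ℝ) * d (x i.succ)) *
                if x (Fin.last (l + 1)) ∈ T then 1 else 0) := by
          refine Finset.sum_congr rfl fun x hx => ?_
          have hx' := (Finset.mem_filter.1 hx).2
          rw [if_pos hx'.1, if_pos hx'.2.1, hwx]
          field_simp
      _ ≤ ∑ x : Fin (l + 2) → V,
            (if x 0 ∈ T then (1 : ℝ) else 0) *
              ((∏ i : Fin (l + 1), (d (x i.castSucc) : ℝ) * d (x i.succ)) *
                if x (Fin.last (l + 1)) ∈ T then 1 else 0) := by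
          refine Finset.sum_le_sum_of_subset_of_nonneg (Finset.subset_univ _) fun x _ _ => ?_
          positivity
      _ = _ := by
          rw [heq]
          simp only [ite_mul, one_mul, zero_mul, Finset.sum_ite_mem, Finset.univ_inter]
          ring
  gcongr
  exact Finset.sum_nonneg fun x _ => hw0 x

end Trails

/-! ### Vertices of large degree with few good neighbours -/

section LowVertices

open scoped Classical

variable {V : Type u} [Fintype V]

/-- The vertices of `S` of degree at least `D`. -/
noncomputable def hiSet (S : Finset V) (D : ℕ) (G : SimpleGraph V) : Finset V :=
  S.filter fun v => D ≤ degIn G Finset.univ v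

/-- The neighbours of `v` outside `S` of degree above `k`. -/
noncomputable def goodNbrs (S : Finset V) (k : ℕ) (G : SimpleGraph V) (v : V) : Finset V :=
  (nbhd G Finset.univ v).filter fun w => w ∉ S ∧ k < degIn G Finset.univ w

/-- `v` has no neighbour in `T` and fewer than `q` neighbours outside `S` of degree above `k`. -/
def FewGood (S T : Finset V) (k q : ℕ) (v : V) (G : SimpleGraph V) : Prop :=
  (∀ w, G.Adj v w → w ∉ T) ∧ (goodNbrs S k G v).card < q

/-- The graphs with all degrees at most `M` for which `T` is the set of vertices in `S` of degree
at least `D`, and the degrees on `T` sum to at most `W`. -/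
noncomputable def profileEvent (m k M D W : ℕ) (S T : Finset V) : Finset (SimpleGraph V) :=
  (boundedCore V m k M).filter fun G => hiSet S D G = T ∧ ∑ v ∈ T, degIn G Finset.univ v ≤ W

/-- The graphs of `profileEvent` in which all vertices in `l` have few good neighbours. -/
noncomputable def fewGoodEvent (m k M D W q : ℕ) (S T : Finset V) (l : List V) :
    Finset (SimpleGraph V) :=
  (profileEvent m k M D W S T).filter fun G => ∀ v ∈ l, FewGood S T k q v G

lemma mem_fewGoodEvent {m k M D W q : ℕ} {S T : Finset V} {l : List V} {G : SimpleGraph V} :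
    G ∈ fewGoodEvent m k M D W q S T l ↔ (G.edgeSet.ncard = m ∧
      (∀ v, k ≤ degIn G Finset.univ v) ∧ ∀ v, degIn G Finset.univ v ≤ M) ∧
      (hiSet S D G = T ∧ ∑ v ∈ T, degIn G Finset.univ v ≤ W) ∧
      ∀ v ∈ l, FewGood S T k q v G := by
  rw [fewGoodEvent, Finset.mem_filter, profileEvent, Finset.mem_filter, mem_boundedCore, and_assoc]

lemma ite_mem_sym2 {a b : V} (hab : a ≠ b) (u : V) :
    (if u ∈ s(a, b) then 1 else 0) = (if u = a then 1 else 0) + if u = b then 1 else 0 := by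
  simp only [Sym2.mem_iff]
  by_cases h1 : u = a
  · subst h1; simp [hab]
  · simp [h1]

/-- The possible new neighbours `w'` of `v` in the switch below. -/
noncomputable def newNbrs (S : Finset V) (M : ℕ) (l : List V) (v : V) (G : SimpleGraph V) :
    Finset V :=
  Finset.univ.filter fun w' => (w' ∉ S ∧ degIn G Finset.univ w' < M) ∧ ¬ G.Adj v w' ∧
    ∀ u ∈ l, ¬ G.Adj u w'

/-- The possible edges `zy`, with `y` losing one degree, in the switch below. -/
noncomputable def freePairs (T : Finset V) (k : ℕ) (l : List V) (w : V) (G : SimpleGraph V) :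
    Finset (V × V) :=
  Finset.univ.filter fun p => (G.Adj p.1 p.2 ∧ k < degIn G Finset.univ p.2) ∧ p.2 ∉ T ∧
    p.1 ∉ insert w (nbhd G Finset.univ w) ∧ p.1 ∉ l

lemma card_newNbrs {m M h : ℕ} {S : Finset V} {l : List V} {v : V} {G : SimpleGraph V}
    (hm : G.edgeSet.ncard = m) (hM : ∀ v, degIn G Finset.univ v ≤ M)
    (hh : 2 * m < (h + 1) * M) :
    Fintype.card V ≤ (newNbrs S M l v G).card + (S.card + (l.length + 1) * M + h) := by
  set B := Finset.univ.filter fun u => M ≤ degIn G Finset.univ u with hB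
  have hBh : B.card ≤ h := by
    by_contra! hlt
    have h1 : B.card * M ≤ ∑ u, degIn G Finset.univ u := by
      rw [← smul_eq_mul]
      refine (Finset.card_nsmul_le_sum B _ M fun u hu => (Finset.mem_filter.1 hu).2).trans ?_
      exact Finset.sum_le_sum_of_subset (Finset.subset_univ _)
    rw [sum_degIn, hm] at h1
    have h2 : (h + 1) * M ≤ B.card * M := Nat.mul_le_mul_right _ hlt
    omega
  have hsub : (Finset.univ : Finset V) ⊆ newNbrs S M l v G ∪ ((S ∪
      (v :: l).toFinset.biUnion fun u => nbhd G Finset.univ u) ∪ B) := by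
    intro u _
    simp only [newNbrs, hB, Finset.mem_union, Finset.mem_filter, Finset.mem_univ, true_and,
      Finset.mem_biUnion, List.mem_toFinset, List.mem_cons, mem_nbhd, exists_eq_or_imp]
    by_cases h1 : u ∈ S
    · tauto
    by_cases h2 : M ≤ degIn G Finset.univ u
    · tauto
    by_cases h3 : G.Adj v u
    · tauto
    by_cases h4 : ∃ a ∈ l, G.Adj a u
    · exact Or.inr (Or.inl (Or.inr (Or.inr h4)))
    · push Not at h4
      left
      exact ⟨⟨h1, not_le.1 h2⟩, h3, h4⟩
  have h1 := Finset.card_le_card hsub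
  have h2 : ((v :: l).toFinset.biUnion fun u => nbhd G Finset.univ u).card ≤
      (l.length + 1) * M := by
    refine (Finset.card_biUnion_le_card_mul _ _ M fun u _ => hM u).trans ?_
    exact Nat.mul_le_mul_right _ (List.toFinset_card_le _)
  have h3 := h1.trans ((Finset.card_union_le _ _).trans (Nat.add_le_add_left
    ((Finset.card_union_le _ _).trans (Nat.add_le_add_right (Finset.card_union_le _ _) _)) _))
  rw [Finset.card_univ] at h3
  omega

lemma card_freePairs {m k M W : ℕ} {T : Finset V} {l : List V} {w : V} {G : SimpleGraph V}
    (hm : G.edgeSet.ncard = m) (hM : ∀ v, degIn G Finset.univ v ≤ M)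
    (hW : ∑ v ∈ T, degIn G Finset.univ v ≤ W) :
    2 * m ≤ (freePairs T k l w G).card + (k * Fintype.card V + W + (M + 1) * M + l.length * M) := by
  have h1 := excess_le_sum (k := k) hm
  rw [← card_adj_pairs_snd_mem] at h1
  have h2 := (card_adj_pairs_snd_mem G T).le.trans hW
  have h3 : (Finset.univ.filter fun p : V × V => G.Adj p.1 p.2 ∧
      p.1 ∈ insert w (nbhd G Finset.univ w)).card ≤ (M + 1) * M := by
    rw [card_adj_pairs_fst_mem]
    refine (Finset.sum_le_card_nsmul _ _ M fun u _ => hM u).trans ?_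
    rw [smul_eq_mul]
    refine Nat.mul_le_mul_right _ ((Finset.card_insert_le _ _).trans ?_)
    exact Nat.add_le_add_right (hM w) 1
  have h4 : (Finset.univ.filter fun p : V × V => G.Adj p.1 p.2 ∧
      p.1 ∈ l.toFinset).card ≤ l.length * M := by
    rw [card_adj_pairs_fst_mem]
    refine (Finset.sum_le_card_nsmul _ _ M fun u _ => hM u).trans ?_
    rw [smul_eq_mul]
    exact Nat.mul_le_mul_right _ (List.toFinset_card_le _)
  have hsub : (Finset.univ.filter fun p : V × V => G.Adj p.1 p.2 ∧
      p.2 ∈ Finset.univ.filter (fun v => k < degIn G Finset.univ v)) ⊆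
      freePairs T k l w G ∪ ((Finset.univ.filter fun p : V × V => G.Adj p.1 p.2 ∧ p.2 ∈ T) ∪
        ((Finset.univ.filter fun p : V × V => G.Adj p.1 p.2 ∧
          p.1 ∈ insert w (nbhd G Finset.univ w)) ∪
        (Finset.univ.filter fun p : V × V => G.Adj p.1 p.2 ∧ p.1 ∈ l.toFinset))) := by
    intro p
    simp only [freePairs, Finset.mem_union, Finset.mem_filter, Finset.mem_univ, true_and,
      List.mem_toFinset]
    tauto
  have h5 := (Finset.card_le_card hsub).trans ((Finset.card_union_le _ _).trans
    (Nat.add_le_add_left ((Finset.card_union_le _ _).trans (Nat.add_le_add_left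
      (Finset.card_union_le _ _) _)) _))
  omega

/-- The switch replacing `vw` and `zy` by `vw'` and `zw`. It gives `v` the good neighbour `w'` and
affects neither the other vertices in `l` nor the degrees on `T`. -/
lemma fewGood_swap {m k M D W q : ℕ} {S T : Finset V} {l : List V} {v : V} (hv : v ∉ l)
    (hvT : v ∈ T) (hl : ∀ u ∈ l, u ∈ T) {G : SimpleGraph V}
    (hG : G ∈ fewGoodEvent m k M D W q S T (v :: l)) {w w' z y : V} (hw : G.Adj v w)
    (hw' : w' ∈ newNbrs S M l v G) (hp : (z, y) ∈ freePairs T k l w G) :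
    IsSwap G {s(v, w), s(z, y)} {s(v, w'), s(z, w)} ∧
      swap G {s(v, w), s(z, y)} {s(v, w'), s(z, w)} ∈ fewGoodEvent m k M D W q S T l ∧
      (goodNbrs S k (swap G {s(v, w), s(z, y)} {s(v, w'), s(z, w)}) v).card ≤ q ∧
      w' ∈ goodNbrs S k (swap G {s(v, w), s(z, y)} {s(v, w'), s(z, w)}) v ∧
      (swap G {s(v, w), s(z, y)} {s(v, w'), s(z, w)}).Adj z w := by
  rw [mem_fewGoodEvent] at hG
  obtain ⟨⟨hm, hk, hM⟩, ⟨hT, hW⟩, hlow⟩ := hG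
  simp only [newNbrs, Finset.mem_filter, Finset.mem_univ, true_and] at hw'
  obtain ⟨⟨hw'S, hw'M⟩, hvw', hlw'⟩ := hw'
  simp only [freePairs, Finset.mem_filter, Finset.mem_univ, true_and, Finset.mem_insert,
    mem_nbhd, not_or] at hp
  obtain ⟨⟨hzy, hyk⟩, hyT, ⟨hzw, hwz⟩, hzl⟩ := hp
  have hTS : ∀ u ∈ T, u ∈ S := by
    intro u hu
    rw [← hT] at hu
    exact (Finset.mem_filter.1 hu).1
  have hwT : w ∉ T := (hlow v List.mem_cons_self).1 w hw
  have hzv : z ≠ v := fun h => hwz (h ▸ hw.symm)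
  have hyw : y ≠ w := fun h => hwz (h ▸ hzy.symm)
  have hyv : y ≠ v := fun h => hyT (h ▸ hvT)
  have hvw'ne : v ≠ w' := fun h => hw'S (h ▸ hTS v hvT)
  have hww' : w ≠ w' := fun h => hvw' (h ▸ hw)
  have hne1 : s(v, w) ≠ s(z, y) := by
    rw [Ne, Sym2.eq_iff]
    rintro (⟨h, -⟩ | ⟨h, -⟩)
    · exact hzv h.symm
    · exact hyv h.symm
  have hne2 : s(v, w') ≠ s(z, w) := by
    rw [Ne, Sym2.eq_iff]
    rintro (⟨h, -⟩ | ⟨h, -⟩)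
    · exact hzv h.symm
    · exact hw.ne h
  have hs : IsSwap G {s(v, w), s(z, y)} {s(v, w'), s(z, w)} := by
    refine ⟨?_, ?_, ?_⟩
    · simp [hw, hzy]
    · have : ¬ G.Adj z w := fun h => hwz h.symm
      simp [hvw', this]
    · simp [hvw'ne, hzw]
  set G' := swap G {s(v, w), s(z, y)} {s(v, w'), s(z, w)} with hG'
  have hdeg : ∀ u, degIn G' Finset.univ u + (if u = y then 1 else 0) =
      degIn G Finset.univ u + if u = w' then 1 else 0 := by
    intro u
    have := hs.degree_eq u
    rw [← hG', incCount_pair hne1, incCount_pair hne2, ite_mem_sym2 hw.ne, ite_mem_sym2 hzy.ne,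
      ite_mem_sym2 hvw'ne, ite_mem_sym2 hzw] at this
    omega
  have hdle : ∀ u, u ≠ w' → degIn G' Finset.univ u ≤ degIn G Finset.univ u := by
    intro u hu
    have := hdeg u
    rw [if_neg hu] at this
    omega
  have hdT : ∀ u ∈ T, degIn G' Finset.univ u = degIn G Finset.univ u := by
    intro u hu
    have := hdeg u
    rw [if_neg fun h : u = w' => hw'S (h ▸ hTS u hu), if_neg fun h : u = y => hyT (h ▸ hu)] at this
    omega
  have hadj : ∀ u x, u ≠ v → u ≠ w → u ≠ z → u ≠ y → u ≠ w' → (G'.Adj u x ↔ G.Adj u x) := by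
    intro u x h1 h2 h3 h4 h5
    have hR : s(u, x) ∉ ({s(v, w), s(z, y)} : Finset (Sym2 V)) := by
      simp [h1, h2, h3, h4]
    have hA : s(u, x) ∉ ({s(v, w'), s(z, w)} : Finset (Sym2 V)) := by
      simp [h1, h2, h3, h5]
    rw [hG', swap_adj]
    have : G.Adj u x → u ≠ x := fun h => h.ne
    tauto
  have hw'deg : k < degIn G' Finset.univ w' := by
    have h1 := hdeg w'
    have h2 := hk w'
    by_cases h : w' = y
    · rw [if_pos h, if_pos rfl] at h1
      rw [← h] at hyk
      omega
    · rw [if_neg h, if_pos rfl] at h1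
      omega
  have hvw'adj : G'.Adj v w' := by
    rw [hG', swap_adj]
    exact ⟨Or.inr (by simp), hvw'ne⟩
  refine ⟨hs, ?_, ?_, ?_, ?_⟩
  · rw [mem_fewGoodEvent]
    refine ⟨⟨?_, fun u => ?_, fun u => ?_⟩, ⟨?_, ?_⟩, fun u hu => ⟨fun x hx => ?_, ?_⟩⟩
    · have := hs.ncard_edgeSet
      rw [← hG', Finset.card_pair hne1, Finset.card_pair hne2] at this
      omega
    · have h1 := hdeg u
      have h2 := hk u
      by_cases h : u = y
      · rw [if_pos h] at h1
        rw [← h] at hyk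
        omega
      · rw [if_neg h] at h1
        omega
    · have h1 := hdeg u
      have h2 := hM u
      by_cases h : u = w'
      · rw [if_pos h] at h1
        rw [← h] at hw'M
        omega
      · rw [if_neg h] at h1
        omega
    · rw [← hT]
      ext u
      simp only [hiSet, Finset.mem_filter]
      refine and_congr_right fun hu => ?_
      have h1 := hdeg u
      rw [if_neg fun h : u = w' => hw'S (h ▸ hu)] at h1
      by_cases h : u = y
      · have h2 : ¬ D ≤ degIn G Finset.univ u := fun h' => by
          apply hyT
          rw [← hT, ← h]
          exact Finset.mem_filter.2 ⟨hu, h'⟩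
        rw [if_pos h] at h1
        omega
      · rw [if_neg h] at h1
        omega
    · rw [Finset.sum_congr rfl hdT]
      exact hW
    all_goals
      have huT := hl u hu
      have huv : u ≠ v := fun h => hv (h ▸ hu)
      have hadj' := fun x => hadj u x huv (fun h => hwT (h ▸ huT)) (fun h => hzl (h ▸ hu))
        (fun h => hyT (h ▸ huT)) (fun h => hw'S (h ▸ hTS u huT))
    · rw [hadj'] at hx
      exact (hlow u (List.mem_cons_of_mem _ hu)).1 x hx
    · refine lt_of_le_of_lt (Finset.card_le_card fun x hx => ?_)
        (hlow u (List.mem_cons_of_mem _ hu)).2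
      simp only [goodNbrs, Finset.mem_filter, mem_nbhd, hadj', Finset.mem_univ, true_and]
        at hx ⊢
      refine ⟨hx.1, hx.2.1, hx.2.2.trans_le (hdle x fun h => ?_)⟩
      exact hlw' u hu (h ▸ hx.1)
  · have hsub : goodNbrs S k G' v ⊆ insert w' (goodNbrs S k G v) := by
      intro x hx
      simp only [goodNbrs, Finset.mem_insert, Finset.mem_filter, mem_nbhd, Finset.mem_univ,
        true_and] at hx ⊢
      by_cases hxw : x = w'
      · exact Or.inl hxw
      · refine Or.inr ⟨?_, hx.2.1, hx.2.2.trans_le (hdle x hxw)⟩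
        have h1 := hx.1
        rw [hG', swap_adj] at h1
        rcases h1.1 with h2 | h2
        · exact h2.1
        · simp only [Finset.mem_insert, Finset.mem_singleton, Sym2.eq_iff] at h2
          have := hw.ne
          have := Ne.symm hzv
          tauto
    have h1 := (Finset.card_le_card hsub).trans (Finset.card_insert_le _ _)
    have h2 := (hlow v List.mem_cons_self).2
    omega
  · simp only [goodNbrs, Finset.mem_filter, mem_nbhd, Finset.mem_univ, true_and]
    exact ⟨hvw'adj, hw'S, hw'deg⟩
  · rw [hG', swap_adj]
    exact ⟨Or.inr (by simp), hzw⟩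

/-- Requiring that a further vertex of large degree has few good neighbours costs a factor which
is small when `q` is much smaller than `D`. -/
lemma card_fewGoodEvent_cons_mul_le {m k M D W q h : ℕ} {S T : Finset V} {l : List V} {v : V}
    (hv : v ∉ l) (hvT : v ∈ T) (hl : ∀ u ∈ l, u ∈ T) {f₁ f₂ : ℕ} (hh : 2 * m < (h + 1) * M)
    (hf₁ : f₁ + (S.card + (l.length + 1) * M + h) ≤ Fintype.card V)
    (hf₂ : f₂ + (k * Fintype.card V + W + (M + 1) * M + l.length * M) ≤ 2 * m) :
    (fewGoodEvent m k M D W q S T (v :: l)).card * (D * f₁ * f₂) ≤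
      (fewGoodEvent m k M D W q S T l).card * (q * (2 * m) * Fintype.card V) := by
  refine le_trans (card_mul_le_card_mul_of_moves _
    ((fewGoodEvent m k M D W q S T l).filter fun G => (goodNbrs S k G v).card ≤ q)
    (κ := Σ _ : V × V, V × V)
    (fun G => (nbhd G Finset.univ v ×ˢ newNbrs S M l v G).sigma
      fun p => freePairs T k l p.1 G)
    (fun G => ((goodNbrs S k G v ×ˢ Finset.univ.filter fun p : V × V => G.Adj p.1 p.2) ×ˢ
      (Finset.univ : Finset V)).image fun a => ⟨(a.1.2.2, a.1.1), (a.1.2.1, a.2)⟩)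
    (fun G a => swap G {s(v, a.1.1), s(a.2.1, a.2.2)} {s(v, a.1.2), s(a.2.1, a.1.1)})
    (fun G a => swap G {s(v, a.1.2), s(a.2.1, a.1.1)} {s(v, a.1.1), s(a.2.1, a.2.2)})
    ?_ ?_ ?_) (Nat.mul_le_mul_right _ (Finset.card_le_card (Finset.filter_subset _ _)))
  · intro G hG
    rw [mem_fewGoodEvent] at hG
    obtain ⟨⟨hm, hk, hM⟩, ⟨hT, hW⟩, hlow⟩ := hG
    have hDv : D ≤ (nbhd G Finset.univ v).card := by
      rw [← hT] at hvT
      exact (Finset.mem_filter.1 hvT).2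
    rw [Finset.card_sigma]
    have h1 := card_newNbrs (S := S) (l := l) (v := v) hm hM hh
    refine le_trans ?_ (Finset.card_nsmul_le_sum _ _ f₂ fun p _ => ?_)
    · rw [smul_eq_mul, Finset.card_product]
      refine Nat.mul_le_mul_right _ (Nat.mul_le_mul hDv ?_)
      omega
    · have h2 := card_freePairs (k := k) (l := l) (w := p.1) hm hM hW
      omega
  · intro G hG
    rw [Finset.mem_filter, mem_fewGoodEvent] at hG
    refine Finset.card_image_le.trans ?_
    rw [Finset.card_product, Finset.card_product, card_adj_pairs, hG.1.1.1, Finset.card_univ]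
    gcongr
    exact hG.2
  · rintro G hG ⟨⟨w, w'⟩, ⟨z, y⟩⟩ hp
    rw [Finset.mem_sigma, Finset.mem_product, mem_nbhd] at hp
    obtain ⟨⟨⟨-, hw⟩, hw'⟩, hzy⟩ := hp
    obtain ⟨h1, h2, h3, h4, h5⟩ := fewGood_swap hv hvT hl hG hw hw' hzy
    refine ⟨Finset.mem_filter.2 ⟨h2, h3⟩, ?_, h1.swap_swap⟩
    rw [Finset.mem_image]
    exact ⟨((w', (z, w)), y), by simp [h4, h5], rfl⟩

/-- Given the set `T` of vertices of large degree, few graphs have many vertices in `T` with few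
good neighbours. -/
lemma card_many_fewGood_mul_le {m k M D W q h : ℕ} {S T : Finset V} {f₁ f₂ j : ℕ}
    (hh : 2 * m < (h + 1) * M)
    (hf₁ : f₁ + (S.card + (j + 1) * M + h) ≤ Fintype.card V)
    (hf₂ : f₂ + (k * Fintype.card V + W + (M + 1) * M + j * M) ≤ 2 * m) {w : ℝ}
    (hD0 : 0 < D) (hf₁0 : 0 < f₁) (hf₂0 : 0 < f₂)
    (hw : (q * (2 * m) * Fintype.card V : ℝ) / (D * f₁ * f₂) ≤ w) (X : ℕ) :
    (((profileEvent m k M D W S T).filter fun G =>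
        X ≤ (T.filter fun v => FewGood S T k q v G).card).card : ℝ) * ((X - j : ℕ) : ℝ) ^ j ≤
      (T.card * w) ^ j * (profileEvent m k M D W S T).card := by
  have hw0 : 0 ≤ w := le_trans (by positivity) hw
  have hP : ∀ l : List V, l.Nodup → (∀ v ∈ l, v ∈ T) → l.length ≤ j →
      ((fewGoodEvent m k M D W q S T l).card : ℝ) ≤
        (l.map fun _ => w).prod * (profileEvent m k M D W S T).card := by
    intro l hl hlT hlj
    induction l with
    | nil => simp [fewGoodEvent]
    | cons v l ih =>
      rw [List.nodup_cons] at hl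
      rw [List.length_cons] at hlj
      have hlM : l.length * M ≤ j * M := Nat.mul_le_mul_right _ (by omega)
      have hlM' : (l.length + 1) * M ≤ (j + 1) * M := Nat.mul_le_mul_right _ (by omega)
      have h1 := card_fewGoodEvent_cons_mul_le (m := m) (k := k) (W := W) (S := S) (D := D)
        (q := q) hl.1
        (hlT v List.mem_cons_self)
        (fun u hu => hlT u (List.mem_cons_of_mem _ hu)) hh (f₁ := f₁) (f₂ := f₂)
        (by omega) (by omega)
      have h2 : ((fewGoodEvent m k M D W q S T (v :: l)).card : ℝ) ≤
          (q * (2 * m) * Fintype.card V : ℝ) / (D * f₁ * f₂) *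
            (fewGoodEvent m k M D W q S T l).card := by
        rw [div_mul_eq_mul_div, le_div_iff₀ (by positivity),
          mul_comm (_ * _) ((fewGoodEvent m k M D W q S T l).card : ℝ)]
        exact_mod_cast h1
      rw [List.map_cons, List.prod_cons, mul_assoc]
      refine h2.trans (mul_le_mul hw (ih hl.2 (fun u hu => hlT u (List.mem_cons_of_mem _ hu))
        (by omega)) (by positivity) hw0)
  have h := card_many_present_mul_le (profileEvent m k M D W S T) T (FewGood S T k q)
    (fun a b => a = b) 1 (fun _ => w) (profileEvent m k M D W S T).card (fun _ _ => hw0)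
    (by positivity)
    (fun G _ v _ _ => by
      refine (Finset.card_le_card (t := {v}) fun x hx => ?_).trans (by simp)
      have hx' := (@Finset.mem_filter _ _ (_) _ _).1 hx
      simpa using hx'.2.2.symm) j
    (fun l h1 h2 h3 => by
      convert hP l (h3.imp fun {a b} h (hab : a = b) => h hab.symm) h2 h1.le
      rw [fewGoodEvent]
      congr!) X
  rw [Finset.sum_const, nsmul_eq_mul, mul_one] at h
  convert h

end LowVertices

/-! ### The vertices lost between `T` and `T'` -/

section Inclusion

open scoped Classical

variable {V : Type u} [Fintype V]

/-- A trail of length between `1` and `6` leads from `v` to a vertex of `T`, possibly back to `v`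
itself. -/
def IsNear (T : Finset V) (G : SimpleGraph V) (v : V) : Prop :=
  ∃ l < 6, ∃ x ∈ trailPatterns T (l + 1), SeqPresent x G ∧ x 0 = v

/-- The vertices of `T` from which a short trail leads to a vertex of `T`. -/
noncomputable def nearSet (T : Finset V) (G : SimpleGraph V) : Finset V :=
  T.filter fun v => IsNear T G v

lemma exists_seq_of_trail {G : SimpleGraph V} {T : Finset V} {u v : V} (p : G.Walk u v)
    (hp : p.IsTrail) (hu : u ∈ T) (hv : v ∈ T) {l : ℕ} (hl : p.length = l) :
    ∃ x ∈ trailPatterns T l, SeqPresent x G ∧ x 0 = u := by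
  refine ⟨fun i => p.getVert i, ?_, ?_, by simp⟩
  · simp only [trailPatterns, Finset.mem_filter, Finset.mem_univ, true_and]
    refine ⟨by simpa using hu, by simpa [← hl] using hv, ?_⟩
    have : (seqPairs fun i : Fin (l + 1) => p.getVert i).map (fun e => s(e.1, e.2)) = p.edges := by
      apply List.ext_getElem
      · simp [seqPairs, hl]
      · intro i h1 h2
        simp [seqPairs, SimpleGraph.Walk.getElem_edges]
    rw [this]
    exact hp.edges_nodup
  · rw [seqPresent_iff]
    intro i
    simpa using p.adj_getVert_succ (i := i) (by omega)

lemma mem_nearSet_of_joined {G : SimpleGraph V} {T U : Finset V} {u v : V}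
    (h : Joined G U 6 u v) (hu : u ∈ T) (hv : v ∈ T) : u ∈ nearSet T G := by
  have key : ∀ (w : V) (p : G.Walk u w), w ∈ T → p.IsTrail → 1 ≤ p.length → p.length ≤ 6 →
      u ∈ nearSet T G := by
    intro w p hw hp h1 h6
    refine Finset.mem_filter.2 ⟨hu, p.length - 1, by omega, ?_⟩
    exact exists_seq_of_trail p hp hu hw (by omega)
  rcases h with ⟨huv, p, hp, hl, -⟩ | ⟨-, p, hp, hl, -⟩
  · refine key v p hv hp.isTrail ?_ hl
    rw [Nat.one_le_iff_ne_zero]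
    exact fun h => huv (SimpleGraph.Walk.eq_of_length_eq_zero h)
  · refine key u p hu hp.isTrail ?_ hl
    have := hp.three_le_length
    omega

variable {S : Finset V} {Δ : ℝ} {k : ℕ} {G : SimpleGraph V}

lemma highSet_eq_hiSet : highSet S Δ G = hiSet S ⌈Δ⌉₊ G := by
  ext v
  rw [mem_highSet, hiSet, Finset.mem_filter, Nat.ceil_le]

lemma mem_nearSet_of_mem_badSet {v : V} (hv : v ∈ badSet S Δ k G) :
    v ∈ nearSet (highSet S Δ G) G := by
  rw [mem_badSet] at hv
  obtain ⟨h1, w, hw, h2⟩ := hv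
  exact mem_nearSet_of_joined h2 h1 hw

/-- A neighbour outside `S`, of degree above `k`, of a vertex `v ∈ T` which has no other vertex of
`T` and no short cycle near it is not in `B_bias`: it only misses the neighbour `v` outside
`T`. -/
lemma goodNbrs_subset_nbhd_freeSet (hG : ∀ v, k ≤ degIn G Finset.univ v) {v : V}
    (hv : v ∈ highSet S Δ G) (hn : v ∉ nearSet (highSet S Δ G) G) :
    goodNbrs S k G v ⊆ nbhd G (freeSet S Δ k G) v := by
  intro w hw
  simp only [goodNbrs, Finset.mem_filter, mem_nbhd, Finset.mem_univ, true_and] at hw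
  obtain ⟨hvw, hwS, hwk⟩ := hw
  rw [mem_nbhd, mem_freeSet]
  refine ⟨⟨fun hB => hn ?_, hwS⟩, hvw⟩
  rw [mem_biasSet] at hB
  obtain ⟨hwT, x, hxT, hxk, p, hpl, hpT⟩ := hB
  have hdx := degIn_add_degIn_compl G (highSet S Δ G) x
  have hkx := hG x
  by_cases hall : ∀ t ∈ nbhd G (highSet S Δ G) x, t = v
  · have h1 : degIn G (highSet S Δ G) x ≤ 1 := by
      refine (Finset.card_le_card (t := {v}) fun t ht => ?_).trans (by simp)
      exact Finset.mem_singleton.2 (hall t ht)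
    have hwx : w ≠ x := by
      rintro rfl
      omega
    have hxv : G.Adj x v := by
      have h2 : 0 < (nbhd G (highSet S Δ G) x).card := by
        change 0 < degIn G (highSet S Δ G) x
        omega
      obtain ⟨t, ht⟩ := Finset.card_pos.1 h2
      rw [← hall t ht]
      exact (mem_nbhd.1 ht).2
    refine mem_nearSet_of_joined (U := Finset.univ) (joined_of_path hwx hvw hxv.symm p.bypass
      p.bypass_isPath ?_ (fun h => ?_) (Finset.mem_univ _) (fun _ _ => Finset.mem_univ _)) hv hv
    · have := p.length_bypass_le_length
      omega
    · exact Finset.mem_compl.1 (hpT v (p.support_bypass_subset_support h)) hv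
  · push Not at hall
    obtain ⟨t, ht, htv⟩ := hall
    rw [mem_nbhd] at ht
    refine mem_nearSet_of_joined (U := Finset.univ) (joined_of_walk htv.symm
      (SimpleGraph.Walk.cons hvw (p.concat ht.2)) ?_ fun _ _ => Finset.mem_univ _) hv ht.1
    simp
    omega

lemma fewGood_of_mem_lowSet (hG : ∀ v, k ≤ degIn G Finset.univ v) {v : V}
    (hv : v ∈ lowSet S Δ k G) (hn : v ∉ nearSet (highSet S Δ G) G) :
    FewGood S (highSet S Δ G) k ⌈√Δ⌉₊ v G := by
  rw [mem_lowSet] at hv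
  refine ⟨fun w hw hwT => hn ?_, ?_⟩
  · exact mem_nearSet_of_joined (U := Finset.univ)
      (joined_of_walk hw.ne hw.toWalk (by simp) fun _ _ => Finset.mem_univ _) hv.1 hwT
  · rw [Nat.lt_ceil]
    refine lt_of_le_of_lt ?_ hv.2
    rw [Nat.cast_le]
    exact Finset.card_le_card (goodNbrs_subset_nbhd_freeSet hG hv.1 hn)

lemma card_nearSet_le (T : Finset V) (G : SimpleGraph V) :
    (nearSet T G).card ≤
      ∑ l ∈ Finset.range 6, ((trailPatterns T (l + 1)).filter fun x => SeqPresent x G).card := by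
  have hsub : nearSet T G ⊆ (Finset.range 6).biUnion fun l =>
      ((trailPatterns T (l + 1)).filter fun x => SeqPresent x G).image fun x => x 0 := by
    intro v hv
    obtain ⟨-, l, hl, x, hx, hxG, rfl⟩ := Finset.mem_filter.1 hv
    rw [Finset.mem_biUnion]
    exact ⟨l, Finset.mem_range.2 hl, Finset.mem_image_of_mem _ (Finset.mem_filter.2 ⟨hx, hxG⟩)⟩
  refine (Finset.card_le_card hsub).trans (Finset.card_biUnion_le.trans ?_)
  exact Finset.sum_le_sum fun l _ => Finset.card_image_le

/-- The vertices of `T` lost in passing to `T'` lie on short trails between vertices of `T` or have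
few good neighbours. -/
lemma card_highSet_le (hG : ∀ v, k ≤ degIn G Finset.univ v) :
    (highSet S Δ G).card ≤ (refinedSet S Δ k G).card +
      ((∑ l ∈ Finset.range 6,
        ((trailPatterns (highSet S Δ G) (l + 1)).filter fun x => SeqPresent x G).card) +
      ((highSet S Δ G).filter fun v => FewGood S (highSet S Δ G) k ⌈√Δ⌉₊ v G).card) := by
  have hsub : highSet S Δ G ⊆ refinedSet S Δ k G ∪ (nearSet (highSet S Δ G) G ∪
      (highSet S Δ G).filter fun v => FewGood S (highSet S Δ G) k ⌈√Δ⌉₊ v G) := by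
    intro v hv
    rw [Finset.mem_union, Finset.mem_union, mem_refinedSet, Finset.mem_filter]
    by_cases h1 : v ∈ nearSet (highSet S Δ G) G
    · exact Or.inr (Or.inl h1)
    · by_cases h2 : v ∈ lowSet S Δ k G
      · exact Or.inr (Or.inr ⟨hv, fewGood_of_mem_lowSet hG h2 h1⟩)
      · exact Or.inl ⟨hv, fun h => h1 (mem_nearSet_of_mem_badSet h), h2⟩
  refine (Finset.card_le_card hsub).trans ((Finset.card_union_le _ _).trans
    (Nat.add_le_add_left ((Finset.card_union_le _ _).trans (Nat.add_le_add_right ?_ _)) _))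
  exact card_nearSet_le _ _

end Inclusion

/-! ### Existence of graphs in the model -/

section Existence

open scoped Classical

variable {V : Type u} [Fintype V]

/-- The model is non-empty: in a graph of maximum degree at most `k` with the most edges the
vertices of degree below `k` form a clique, hence are at most `k`; joining each of them to `k`
further vertices gives minimum degree `k` with few edges, and arbitrary edges can then be added. -/
lemma coreFin_nonempty {m k : ℕ} (hN : 2 * k ≤ Fintype.card V)
    (hm : k * Fintype.card V + 2 * k ^ 2 ≤ 2 * m)
    (hm' : 2 * m + Fintype.card V ≤ Fintype.card V ^ 2) : (coreFin V m k).Nonempty := by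
  set C : Finset (SimpleGraph V) :=
    Finset.univ.filter fun G => ∀ v, degIn G Finset.univ v ≤ k with hC
  have hCne : C.Nonempty := by
    refine ⟨⊥, Finset.mem_filter.2 ⟨Finset.mem_univ _, fun v => ?_⟩⟩
    rw [degIn_univ_eq_degree]
    simp
  obtain ⟨H, hHC, hmax⟩ := C.exists_max_image (fun G => G.edgeSet.ncard) hCne
  rw [hC, Finset.mem_filter] at hHC
  set B := Finset.univ.filter fun v => degIn H Finset.univ v < k with hB
  have hclique : ∀ x ∈ B, ∀ y ∈ B, x ≠ y → H.Adj x y := by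
    intro x hx y hy hxy
    by_contra hadj
    have hs : IsSwap H ∅ {s(x, y)} := ⟨by simp, by simpa using hadj, by simpa using hxy⟩
    have h1 := hs.ncard_edgeSet
    have h2 : swap H ∅ {s(x, y)} ∈ C := by
      rw [hC, Finset.mem_filter]
      refine ⟨Finset.mem_univ _, fun v => ?_⟩
      have h3 := hs.degree_eq v
      rw [incCount_singleton] at h3
      have h4 := hHC.2 v
      have h5 := (Finset.mem_filter.1 hx).2
      have h6 := (Finset.mem_filter.1 hy).2
      by_cases hvx : v = x
      · subst hvx
        simp [incCount] at h3
        omega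
      · by_cases hvy : v = y
        · subst hvy
          simp [incCount] at h3
          omega
        · simp [incCount, hvx, hvy] at h3
          omega
    have h7 := hmax _ h2
    simp at h1
    omega
  have hBk : B.card ≤ k := by
    rcases B.eq_empty_or_nonempty with h | ⟨x, hx⟩
    · simp [h]
    · have h1 : B.erase x ⊆ nbhd H Finset.univ x := by
        intro y hy
        rw [Finset.mem_erase] at hy
        exact mem_nbhd.2 ⟨Finset.mem_univ _, hclique x hx y hy.2 hy.1.symm⟩
      have h2 := Finset.card_le_card h1
      rw [Finset.card_erase_of_mem hx] at h2
      have h3 : (nbhd H Finset.univ x).card < k := (Finset.mem_filter.1 hx).2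
      omega
  obtain ⟨W, hWB, hW⟩ : ∃ W ⊆ Bᶜ, W.card = k := by
    apply Finset.exists_subset_card_eq
    have := Finset.card_add_card_compl B
    omega
  set E₁ : Finset (Sym2 V) := H.edgeFinset ∪ (B ×ˢ W).image fun p => s(p.1, p.2) with hE₁
  have hE₁card : E₁.card ≤ m := by
    have h1 : E₁.card ≤ H.edgeFinset.card + ((B ×ˢ W).image fun p => s(p.1, p.2)).card :=
      Finset.card_union_le _ _
    have h2 : ((B ×ˢ W).image fun p => s(p.1, p.2)).card ≤ k ^ 2 := by
      refine Finset.card_image_le.trans ?_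
      rw [Finset.card_product, hW, sq]
      exact Nat.mul_le_mul_right _ hBk
    have h3 : 2 * H.edgeFinset.card ≤ k * Fintype.card V := by
      have h4 := sum_degIn H
      rw [← SimpleGraph.coe_edgeFinset, Set.ncard_coe_finset] at h4
      rw [← h4, mul_comm]
      refine (Finset.sum_le_card_nsmul _ _ k fun v _ => hHC.2 v).trans ?_
      simp
    omega
  set E₂ : Finset (Sym2 V) := (⊤ : SimpleGraph V).edgeFinset with hE₂
  have hsub : E₁ ⊆ E₂ := by
    intro e he
    rw [hE₁, Finset.mem_union] at he
    rw [hE₂, SimpleGraph.mem_edgeFinset]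
    rcases he with he | he
    · exact SimpleGraph.edgeSet_mono le_top (SimpleGraph.mem_edgeFinset.1 he)
    · obtain ⟨p, hp, rfl⟩ := Finset.mem_image.1 he
      rw [Finset.mem_product] at hp
      rw [SimpleGraph.mem_edgeSet, SimpleGraph.top_adj]
      intro h
      exact Finset.mem_compl.1 (hWB hp.2) (h ▸ hp.1)
  have hE₂card : m ≤ E₂.card := by
    rw [hE₂, SimpleGraph.card_edgeFinset_top_eq_card_choose_two, Nat.choose_two_right]
    rw [Nat.le_div_iff_mul_le (by norm_num)]
    have : Fintype.card V * (Fintype.card V - 1) + Fintype.card V = Fintype.card V ^ 2 := by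
      rcases Nat.eq_zero_or_pos (Fintype.card V) with h | h
      · simp [h]
      · obtain ⟨a, ha⟩ := Nat.exists_eq_add_of_le' h
        rw [ha]
        simp
        ring
    omega
  obtain ⟨E, hE1, hE2, hEm⟩ := Finset.exists_subsuperset_card_eq hsub hE₁card hE₂card
  have hedge : (SimpleGraph.fromEdgeSet (E : Set (Sym2 V))).edgeSet = E := by
    rw [SimpleGraph.edgeSet_fromEdgeSet, sdiff_eq_left, Set.disjoint_left]
    intro e he hd
    have := SimpleGraph.mem_edgeFinset.1 (hE2 he)
    exact (⊤ : SimpleGraph V).not_isDiag_of_mem_edgeSet this hd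
  refine ⟨SimpleGraph.fromEdgeSet E, mem_coreFin.2 ⟨?_, fun v => ?_⟩⟩
  · rw [hedge, Set.ncard_coe_finset, hEm]
  · have hadj : ∀ x y, s(x, y) ∈ E₁ → (SimpleGraph.fromEdgeSet (E : Set (Sym2 V))).Adj x y := by
      intro x y h
      rw [← SimpleGraph.mem_edgeSet, hedge]
      exact hE1 h
    by_cases hv : v ∈ B
    · rw [← hW]
      refine Finset.card_le_card fun w hw => mem_nbhd.2 ⟨Finset.mem_univ _, hadj v w ?_⟩
      exact Finset.mem_union_right _ (Finset.mem_image.2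
        ⟨(v, w), Finset.mem_product.2 ⟨hv, hw⟩, rfl⟩)
    · have h1 : k ≤ degIn H Finset.univ v := by
        by_contra! h
        exact hv (Finset.mem_filter.2 ⟨Finset.mem_univ _, h⟩)
      refine h1.trans (Finset.card_le_card fun w hw => ?_)
      rw [mem_nbhd] at hw ⊢
      refine ⟨hw.1, hadj v w (Finset.mem_union_left _ ?_)⟩
      rw [SimpleGraph.mem_edgeFinset]
      exact hw.2

end Existence

/-! ### Asymptotic forms of the degree bounds -/

section Asymptotics

open scoped Classical
open Filter

/-- A bound for the degrees: the integer part of the sixteenth root of `n`. It is polynomially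
large, so that stars with `17` leaves exclude larger degrees, while the numbers of conflicts between
patterns, at most of the order of its sixth power, stay negligible compared with `n`. -/
@[irreducible] def degBound (n : ℕ) : ℕ := Nat.sqrt (Nat.sqrt (Nat.sqrt (Nat.sqrt n)))

lemma degBound_pow_le (n : ℕ) : degBound n ^ 16 ≤ n := by
  have h : ∀ a : ℕ, Nat.sqrt a ^ 2 ≤ a := fun a => by rw [sq]; exact Nat.sqrt_le a
  rw [degBound]
  calc Nat.sqrt (Nat.sqrt (Nat.sqrt (Nat.sqrt n))) ^ 16
      = (((Nat.sqrt (Nat.sqrt (Nat.sqrt (Nat.sqrt n))) ^ 2) ^ 2) ^ 2) ^ 2 := by ring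
    _ ≤ ((Nat.sqrt (Nat.sqrt (Nat.sqrt n)) ^ 2) ^ 2) ^ 2 := by gcongr; exact h _
    _ ≤ (Nat.sqrt (Nat.sqrt n) ^ 2) ^ 2 := by gcongr; exact h _
    _ ≤ Nat.sqrt n ^ 2 := by gcongr; exact h _
    _ ≤ n := h _

lemma lt_degBound_add_one_pow (n : ℕ) : n < (degBound n + 1) ^ 16 := by
  have h : ∀ a : ℕ, a + 1 ≤ (Nat.sqrt a + 1) ^ 2 := fun a => by
    rw [sq]
    exact Nat.lt_succ_sqrt a
  rw [degBound]
  calc n + 1 ≤ (Nat.sqrt n + 1) ^ 2 := h _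
    _ ≤ ((Nat.sqrt (Nat.sqrt n) + 1) ^ 2) ^ 2 := by gcongr; exact h _
    _ ≤ (((Nat.sqrt (Nat.sqrt (Nat.sqrt n)) + 1) ^ 2) ^ 2) ^ 2 := by gcongr; exact h _
    _ ≤ ((((Nat.sqrt (Nat.sqrt (Nat.sqrt (Nat.sqrt n))) + 1) ^ 2) ^ 2) ^ 2) ^ 2 := by
        gcongr; exact h _
    _ = (Nat.sqrt (Nat.sqrt (Nat.sqrt (Nat.sqrt n))) + 1) ^ 16 := by ring

lemma eventually_le_degBound (A : ℝ) : ∀ᶠ n : ℕ in atTop, A ≤ degBound n := by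
  filter_upwards [eventually_ge_atTop ((⌈A⌉₊ + 1) ^ 16)] with n hn
  have h1 := hn.trans_lt (lt_degBound_add_one_pow n)
  have h2 : ⌈A⌉₊ + 1 < degBound n + 1 := lt_of_pow_lt_pow_left₀ 16 (Nat.zero_le _) h1
  have h3 : ⌈A⌉₊ ≤ degBound n := by omega
  exact (Nat.le_ceil A).trans (by exact_mod_cast h3)

lemma eventually_mul_degBound_pow_le (A : ℝ) :
    ∀ᶠ n : ℕ in atTop, A * (degBound n : ℝ) ^ 15 ≤ n := by
  filter_upwards [eventually_le_degBound A] with n hn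
  calc A * (degBound n : ℝ) ^ 15 ≤ degBound n * (degBound n : ℝ) ^ 15 := by gcongr
    _ = ((degBound n ^ 16 : ℕ) : ℝ) := by push_cast; ring
    _ ≤ n := by exact_mod_cast degBound_pow_le n

lemma eventually_mul_le_degBound_pow {A : ℝ} (hA : 0 ≤ A) :
    ∀ᶠ n : ℕ in atTop, A * n ≤ (degBound n : ℝ) ^ 17 := by
  filter_upwards [eventually_le_degBound (A * 2 ^ 16), eventually_le_degBound 1] with n hn h1
  have h2 : (n : ℝ) ≤ (2 * (degBound n : ℝ)) ^ 16 := by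
    calc (n : ℝ) ≤ (((degBound n + 1) ^ 16 : ℕ) : ℝ) := by
          exact_mod_cast (lt_degBound_add_one_pow n).le
      _ = ((degBound n : ℝ) + 1) ^ 16 := by push_cast; rfl
      _ ≤ (2 * (degBound n : ℝ)) ^ 16 := by gcongr; linarith
  calc A * n ≤ A * (2 * (degBound n : ℝ)) ^ 16 := by gcongr
    _ = (A * 2 ^ 16) * (degBound n : ℝ) ^ 16 := by ring
    _ ≤ degBound n * (degBound n : ℝ) ^ 16 := by gcongr
    _ = _ := by ring

lemma eventually_const_le (A : ℝ) {B : ℝ} (hB : 0 < B) : ∀ᶠ n : ℕ in atTop, A ≤ B * n := by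
  filter_upwards [eventually_ge_atTop ⌈A / B⌉₊] with n hn
  have h := (Nat.le_ceil (A / B)).trans (Nat.cast_le.2 hn)
  rw [div_le_iff₀ hB] at h
  linarith

/-- A moment bound `a Y ^ j ≤ y ^ j Z` gives exponential decay when `y` is below `Y`. -/
lemma le_pow_mul_of_mul_pow_le {a Y y Z ρ : ℝ} {j : ℕ} (hY : 0 < Y) (hy0 : 0 ≤ y) (hZ : 0 ≤ Z)
    (hy : y ≤ ρ * Y) (h : a * Y ^ j ≤ y ^ j * Z) : a ≤ ρ ^ j * Z := by
  have h1 : a * Y ^ j ≤ (ρ ^ j * Z) * Y ^ j := by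
    refine h.trans ?_
    calc y ^ j * Z ≤ (ρ * Y) ^ j * Z := by gcongr
      _ = _ := by rw [mul_pow]; ring
  exact le_of_mul_le_mul_right h1 (by positivity)

section

variable {k : ℕ} {ε α c C : ℝ}

lemma Admissible.two_mul_edges_ge {n m : ℕ} {V : Type u} [Fintype V] {S : Finset V}
    (h : Admissible k ε α c C n S m) :
    2 * ε * n + k * (Fintype.card V : ℝ) ≤ 2 * m := by
  have := h.2.2.1
  linarith

lemma Admissible.edges_le {n m : ℕ} {V : Type u} [Fintype V] {S : Finset V}
    (h : Admissible k ε α c C n S m) : (m : ℝ) ≤ (k * C / 2 + 1 / ε) * n := by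
  have h1 := h.2.2.2.1
  have h2 := h.2.1
  have h3 : (k : ℝ) * (Fintype.card V : ℝ) ≤ k * (C * n) := by gcongr
  have h4 : (n : ℝ) / ε = 1 / ε * n := by ring
  rw [h4] at h1
  linarith

/-- The factors gained by one move of the star switchings are `O(1/n)`. Here `f` bounds from below
the number of non-adjacent pairs and `g` the number of non-neighbours of a vertex of degree `k`. -/
lemma eventually_exists_factors (hε : 0 < ε) (hc : 0 < c) (hC : 0 < C) :
    ∃ K : ℝ, 0 < K ∧ ∀ᶠ n : ℕ in atTop, ∀ (m : ℕ) (V : Type u) [Fintype V] (S : Finset V),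
      Admissible k ε α c C n S m → ∃ f g : ℕ, 0 < f ∧ 0 < g ∧
        f + 2 * m + Fintype.card V ≤ Fintype.card V ^ 2 ∧ g + k + 1 ≤ Fintype.card V ∧
        (2 * m / f + k / g : ℝ) ≤ K / n := by
  set B : ℝ := k * C / 2 + 1 / ε with hB
  have hB0 : 0 < B := by positivity
  refine ⟨4 * B / c ^ 2 + 2 * k / c, by positivity, ?_⟩
  filter_upwards [eventually_const_le (4 * B + 2 * C) (show 0 < c ^ 2 by positivity),
    eventually_const_le (2 * (k + 1) : ℝ) hc, eventually_ge_atTop 1] with n h1 h2 h3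
  intro m V _ S hA
  have hm := hA.edges_le
  rw [← hB] at hm
  obtain ⟨hcn, hCn, -⟩ := hA
  set N := Fintype.card V with hN
  have hn : (1 : ℝ) ≤ n := by exact_mod_cast h3
  have hn0 : (0 : ℝ) < n := by linarith
  have hcn0 : 0 < c * n := by positivity
  have hNsq : (c * n) ^ 2 ≤ (N : ℝ) ^ 2 := by gcongr
  have h4 : 4 * m + 2 * N ≤ N ^ 2 := by
    have : (4 * m + 2 * N : ℝ) ≤ (N : ℝ) ^ 2 := by
      calc (4 * m + 2 * N : ℝ) ≤ 4 * (B * n) + 2 * (C * n) := by linarith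
        _ = (4 * B + 2 * C) * n := by ring
        _ ≤ c ^ 2 * n * n := by gcongr
        _ = (c * n) ^ 2 := by ring
        _ ≤ _ := hNsq
    exact_mod_cast this
  have h5 : 2 * (k + 1) ≤ N := by
    have : (2 * (k + 1) : ℝ) ≤ N := h2.trans hcn
    exact_mod_cast this
  have hN0 : 0 < N := by omega
  have hN2 : 0 < N ^ 2 := by positivity
  refine ⟨N ^ 2 - 2 * m - N, N - k - 1, by omega, by omega, by omega, by omega, ?_⟩
  have hf : (c * n) ^ 2 / 2 ≤ ((N ^ 2 - 2 * m - N : ℕ) : ℝ) := by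
    have : N ^ 2 ≤ 2 * (N ^ 2 - 2 * m - N) := by omega
    have : (N : ℝ) ^ 2 ≤ 2 * ((N ^ 2 - 2 * m - N : ℕ) : ℝ) := by exact_mod_cast this
    linarith
  have hg : c * n / 2 ≤ ((N - k - 1 : ℕ) : ℝ) := by
    have : N ≤ 2 * (N - k - 1) := by omega
    have : (N : ℝ) ≤ 2 * ((N - k - 1 : ℕ) : ℝ) := by exact_mod_cast this
    linarith
  calc (2 * m / ((N ^ 2 - 2 * m - N : ℕ) : ℝ) + k / ((N - k - 1 : ℕ) : ℝ) : ℝ)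
      ≤ 2 * (B * n) / ((c * n) ^ 2 / 2) + k / (c * n / 2) := by gcongr
    _ = (4 * B / c ^ 2 + 2 * k / c) / n := by field_simp; ring

/-- With high probability all degrees are at most `degBound n`. -/
lemma eventually_degree_le (hε : 0 < ε) (hc : 0 < c) (hC : 0 < C) {η : ℝ} (hη : 0 < η) :
    ∀ᶠ n : ℕ in atTop, ∀ (m : ℕ) (V : Type u) [Fintype V] (S : Finset V),
      Admissible k ε α c C n S m →
        (((coreFin V m k).filter fun G => ∃ v, degBound n + 1 ≤ degIn G Finset.univ v).card : ℝ) ≤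
          η * (coreFin V m k).card := by
  obtain ⟨K, hK, hev⟩ := eventually_exists_factors.{u} (k := k) (α := α) hε hc hC
  set A : ℝ := C ^ 18 * K ^ 17 * (2 ^ 17 * (Nat.factorial 17 : ℝ)) / η with hAdef
  filter_upwards [hev, eventually_mul_le_degBound_pow (A := A) (by positivity),
    eventually_le_degBound (k + 40), eventually_ge_atTop 1] with n h1 h2 h3 h4
  intro m V _ S hA
  obtain ⟨f, g, hf, hg, hfN, hgN, hκ⟩ := h1 m V S hA
  have hn : (0 : ℝ) < n := by exact_mod_cast h4
  have hkM : k + 40 ≤ degBound n := by exact_mod_cast h3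
  -- At most `n ^ 18` stars with `17` leaves, each of probability `O(n ^ (-17))`, against the
  -- `M ^ 17` of them at a vertex of degree above `M`, where `M ^ 17` is much larger than `n`.
  have h := card_large_degree_mul_le hf hg hfN hgN hκ 17 (degBound n + 1) (by omega)
  set M := degBound n with hM
  have hch : ((M : ℝ) / 2) ^ 17 / (Nat.factorial 17 : ℝ) ≤ ((M + 1).choose 17 : ℝ) := by
    refine le_trans ?_ (Nat.pow_le_choose 17 (M + 1))
    gcongr
    have h5 : M ≤ 2 * (M + 1 + 1 - 17) := by omega
    have h6 : (M : ℝ) ≤ 2 * ((M + 1 + 1 - 17 : ℕ) : ℝ) := by exact_mod_cast h5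
    linarith
  have hch0 : (0 : ℝ) < ((M + 1).choose 17 : ℝ) := by
    refine lt_of_lt_of_le ?_ hch
    have : (0 : ℝ) < M := by
      have : 0 < M := by omega
      exact_mod_cast this
    positivity
  have hpow : (Fintype.card V : ℝ) ^ (17 + 1) * (K / n) ^ 17 ≤ η * ((M + 1).choose 17 : ℝ) := by
    calc (Fintype.card V : ℝ) ^ (17 + 1) * (K / n) ^ 17 ≤ (C * n) ^ (17 + 1) * (K / n) ^ 17 := by
          gcongr
          exact hA.2.1
      _ = C ^ 18 * K ^ 17 * n := by field_simp; ring
      _ = η * ((A * n) / 2 ^ 17 / (Nat.factorial 17 : ℝ)) := by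
          rw [hAdef]; field_simp
      _ ≤ η * ((M : ℝ) ^ 17 / 2 ^ 17 / (Nat.factorial 17 : ℝ)) := by gcongr
      _ = η * (((M : ℝ) / 2) ^ 17 / (Nat.factorial 17 : ℝ)) := by rw [div_pow]
      _ ≤ _ := by gcongr
  refine le_of_mul_le_mul_right (h.trans ?_) hch0
  calc _ ≤ η * ((M + 1).choose 17 : ℝ) * (coreFin V m k).card := by gcongr
    _ = _ := by ring

lemma exists_pow_le {ρ η : ℝ} (hρ : ρ < 1) (hη : 0 < η) : ∃ j : ℕ, ρ ^ j ≤ η := by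
  obtain ⟨j, hj⟩ := exists_pow_lt_of_lt_one hη hρ
  exact ⟨j, hj.le⟩

/-- With high probability there are `O(n)` stars with three leaves and a centre of degree at least
`k + 3`. -/
lemma exists_eventually_stars_le (hε : 0 < ε) (hc : 0 < c) (hC : 0 < C) :
    ∃ K₃ : ℝ, 0 < K₃ ∧ ∀ η : ℝ, 0 < η →
      ∀ᶠ n : ℕ in atTop, ∀ (m : ℕ) (V : Type u) [Fintype V] (S : Finset V),
        Admissible k ε α c C n S m →
          (((boundedCore V m k (degBound n)).filter fun G => ⌈K₃ * n⌉₊ ≤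
            ∑ v ∈ Finset.univ.filter (fun v => k + 3 ≤ degIn G Finset.univ v),
              (degIn G Finset.univ v).choose 3).card : ℝ) ≤ η * (coreFin V m k).card := by
  obtain ⟨K, hK, hev⟩ := eventually_exists_factors.{u} (k := k) (α := α) hε hc hC
  set A : ℝ := C ^ 4 * K ^ 3 with hAdef
  have hA0 : 0 < A := by positivity
  refine ⟨3 * A, by positivity, fun η hη => ?_⟩
  obtain ⟨j, hj⟩ := exists_pow_le (ρ := 1 / 2) (by norm_num) hη
  filter_upwards [hev, eventually_mul_degBound_pow_le (8 * j / A), eventually_le_degBound 1,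
    eventually_ge_atTop 1] with n h1 h2 h3 h4
  intro m V _ S hA
  obtain ⟨f, g, hf, hg, hfN, hgN, hκ⟩ := h1 m V S hA
  have hn : (0 : ℝ) < n := by exact_mod_cast h4
  set M := degBound n with hM
  set X := ⌈3 * A * n⌉₊ with hX
  have h := card_many_stars_mul_le hf hg hfN hgN hκ 3 M j X
  have hY : 2 * A * n ≤ ((X - j * ((3 + 1) * ((M + 1) * M ^ 3)) : ℕ) : ℝ) := by
    have h5 : (X : ℝ) - j * ((3 + 1) * ((M + 1) * M ^ 3)) ≤
        ((X - j * ((3 + 1) * ((M + 1) * M ^ 3)) : ℕ) : ℝ) := by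
      rw [sub_le_iff_le_add]
      have : X ≤ X - j * ((3 + 1) * ((M + 1) * M ^ 3)) + j * ((3 + 1) * ((M + 1) * M ^ 3)) := by
        omega
      exact_mod_cast this
    have h6 : (j : ℝ) * ((3 + 1) * ((M + 1) * M ^ 3)) ≤ A * n := by
      rw [div_mul_eq_mul_div, div_le_iff₀ hA0] at h2
      calc (j : ℝ) * ((3 + 1) * ((M + 1) * M ^ 3)) ≤ j * (4 * ((M + M) * M ^ 3)) := by
            gcongr
            norm_num
        _ = 8 * j * (M : ℝ) ^ 4 := by ring
        _ ≤ 8 * j * (M : ℝ) ^ 15 := by gcongr; norm_num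
        _ ≤ A * n := by linarith
    have h7 : 3 * A * n ≤ X := Nat.le_ceil _
    linarith
  have hA2 : 0 < 2 * A * n := by positivity
  refine (le_pow_mul_of_mul_pow_le (ρ := 1 / 2) (lt_of_lt_of_le hA2 hY) (by positivity)
    (by positivity) ?_ h).trans (by gcongr)
  calc (Fintype.card V : ℝ) ^ (3 + 1) * (K / n) ^ 3 ≤ (C * n) ^ (3 + 1) * (K / n) ^ 3 := by
        gcongr
        exact hA.2.1
    _ = A * n := by rw [hAdef]; field_simp; ring
    _ ≤ _ := by linarith

/-- With high probability a positive proportion of the vertices in `S` have degree at least `D`. -/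
lemma exists_eventually_hiSet_ge (hε : 0 < ε) (hα : 0 < α) (hc : 0 < c) (hC : 0 < C) (D : ℕ) :
    ∃ δ : ℝ, 0 < δ ∧ ∀ η : ℝ, 0 < η →
      ∀ᶠ n : ℕ in atTop, ∀ (m : ℕ) (V : Type u) [Fintype V] (S : Finset V),
        Admissible k ε α c C n S m →
          (((boundedCore V m k (degBound n)).filter fun G =>
            ((hiSet S D G).card : ℝ) < δ * n).card : ℝ) ≤ η * (coreFin V m k).card := by
  set ρ : ℝ := max 1 (D * C / ε) with hρdef
  have hρ1 : 1 ≤ ρ := le_max_left _ _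
  set R : ℝ := D * ρ ^ D with hR
  have hR0 : 0 ≤ R := by positivity
  set w : ℝ := R / (1 + R) with hw
  have hw0 : 0 ≤ w := by positivity
  have hw1 : w < 1 := by
    rw [hw, div_lt_one (by linarith)]
    linarith
  -- `w < θ' < θ < 1`
  set θ : ℝ := (1 + w) / 2 with hθ
  set θ' : ℝ := (1 + 3 * w) / 4 with hθ'
  have hθ'0 : 0 < θ' := by rw [hθ']; linarith
  refine ⟨(1 - θ) * (α * c / 2), by rw [hθ]; have : 0 < 1 - w := by linarith
                                    have : 0 < 1 - (1 + w) / 2 := by linarith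
                                    positivity, fun η hη => ?_⟩
  obtain ⟨j, hj⟩ := exists_pow_le (ρ := w / θ')
    (by rw [div_lt_one hθ'0, hθ']; linarith) hη
  filter_upwards [eventually_mul_degBound_pow_le (D / ε), eventually_le_degBound D,
    eventually_le_degBound 1, eventually_ge_atTop 1,
    eventually_const_le 1 (show 0 < α * c / 2 by positivity),
    eventually_const_le j (show 0 < (θ - θ') * (α * c / 2) by
      have : 0 < θ - θ' := by rw [hθ, hθ']; linarith
      positivity)] with n h1 h2 h3 h4 h5 h6
  intro m V _ S hA
  have hn : (0 : ℝ) < n := by exact_mod_cast h4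
  have hm := hA.two_mul_edges_ge
  obtain ⟨hcn, hCn, -, -, hS⟩ := hA
  set M := degBound n with hM
  have hDM : D ≤ M := by exact_mod_cast h2
  have hSge : α * c / 2 * n ≤ S.card := by
    have h7 : α * (Fintype.card V : ℝ) - 1 < S.card := by
      rw [hS]
      exact Nat.sub_one_lt_floor _
    have h8 : α * (c * n) ≤ α * Fintype.card V := by gcongr
    linarith
  have hS0 : (0 : ℝ) < S.card := lt_of_lt_of_le (by positivity) hSge
  have hDM' : (D : ℝ) * M ≤ ε * n := by
    rw [div_mul_eq_mul_div, div_le_iff₀ hε] at h1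
    calc (D : ℝ) * M = D * (M : ℝ) ^ 1 := by ring
      _ ≤ D * (M : ℝ) ^ 15 := by gcongr; norm_num
      _ ≤ _ := by linarith
  set f : ℕ := 2 * m - k * Fintype.card V - D * M with hf
  have hfε : ε * n ≤ f := by
    have h7 : 2 * m ≤ f + k * Fintype.card V + D * M := by omega
    have h8 : (2 * m : ℝ) ≤ f + k * Fintype.card V + D * M := by exact_mod_cast h7
    linarith
  have hf0 : 0 < f := by
    have : (0 : ℝ) < f := lt_of_lt_of_le (by positivity) hfε
    exact_mod_cast this
  have hρ : (D : ℝ) * Fintype.card V / f ≤ ρ := by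
    refine le_trans ?_ (le_max_right _ _)
    calc (D : ℝ) * Fintype.card V / f ≤ D * (C * n) / (ε * n) := by gcongr
      _ = D * C / ε := by field_simp
  set X := ⌈θ * S.card⌉₊ with hX
  have h := card_many_low_mul_le (m := m) (k := k) hDM S hf0 (by omega) hρ1 hρ j X
  have hY : θ' * S.card ≤ ((X - j : ℕ) : ℝ) := by
    have h7 : (X : ℝ) ≤ ((X - j : ℕ) : ℝ) + j := by
      have : X ≤ X - j + j := by omega
      exact_mod_cast this
    have h8 : θ * S.card ≤ X := Nat.le_ceil _
    have h9 : (θ - θ') * (α * c / 2 * n) ≤ (θ - θ') * S.card := by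
      have : 0 ≤ θ - θ' := by rw [hθ, hθ']; linarith
      gcongr
    have h10 : (θ - θ') * (α * c / 2) * n = (θ - θ') * (α * c / 2 * n) := by ring
    have h11 : (θ - θ') * (S.card : ℝ) = θ * S.card - θ' * S.card := by ring
    linarith
  have hbc : ((boundedCore V m k M).card : ℝ) ≤ (coreFin V m k).card := by
    exact_mod_cast Finset.card_le_card (Finset.filter_subset _ _)
  have hYpos : (0 : ℝ) < ((X - j : ℕ) : ℝ) := lt_of_lt_of_le (by positivity) hY
  have hfin := le_pow_mul_of_mul_pow_le (ρ := w / θ') hYpos (by positivity) (by positivity)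
    (by
      rw [div_mul_eq_mul_div, le_div_iff₀ hθ'0]
      calc S.card * w * θ' = w * (θ' * S.card) := by ring
        _ ≤ _ := by gcongr) h
  refine le_trans ?_ (hfin.trans (mul_le_mul hj hbc (Nat.cast_nonneg _) hη.le))
  rw [Nat.cast_le]
  refine Finset.card_le_card fun G hG => ?_
  rw [Finset.mem_filter] at hG ⊢
  refine ⟨hG.1, Nat.ceil_le.2 ?_⟩
  have hsplit : (hiSet S D G).card + (S.filter fun v => degIn G Finset.univ v < D).card =
      S.card := by
    rw [hiSet, ← Finset.card_filter_add_card_filter_not (s := S)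
      (fun v => D ≤ degIn G Finset.univ v)]
    simp only [not_le]
  have hsplit' : ((hiSet S D G).card : ℝ) +
      ((S.filter fun v => degIn G Finset.univ v < D).card : ℝ) = S.card := by
    exact_mod_cast hsplit
  have h7 : (1 - θ) * (α * c / 2) * n ≤ (1 - θ) * S.card := by
    rw [mul_assoc]
    have : 0 ≤ 1 - θ := by rw [hθ]; linarith
    gcongr
  linarith [hG.2]

end

end Asymptotics

/-! ### Asymptotic forms of the bounds for trails and good neighbours -/

section Typical

open scoped Classical
open Filter

variable {k : ℕ} {ε α c C : ℝ}

lemma fixedDegree_eq_filter_coreFin {V : Type u} [Fintype V] {m : ℕ} {d : V → ℕ}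
    (hsum : ∑ v, d v = 2 * m) (hk : ∀ v, k ≤ d v) :
    (coreFin V m k).filter (fun G => (fun v => degIn G Finset.univ v) = d) = fixedDegree d := by
  ext G
  simp only [fixedDegree, Finset.mem_filter, mem_coreFin, Finset.mem_univ, true_and, funext_iff]
  refine ⟨fun h => h.2, fun h => ⟨⟨?_, fun v => (hk v).trans (h v).ge⟩, h⟩⟩
  have h1 := sum_degIn G
  rw [Finset.sum_congr rfl fun v _ => h v, hsum] at h1
  omega

lemma card_le_of_nonempty {β : Type*} {s : Finset β} {b : ℝ} (hb : 0 ≤ b)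
    (h : s.Nonempty → (s.card : ℝ) ≤ b) : (s.card : ℝ) ≤ b := by
  rcases s.eq_empty_or_nonempty with rfl | hs
  · simpa using hb
  · exact h hs

/-- The expected number of trails of length `l + 1` between `t` vertices of degree at least `Δ` is
a small proportion of `t` if `Δ` is large. -/
lemma trail_mean_le {Δ K₃ K₂ t x a q f : ℝ} {l : ℕ} (hε : 0 < ε) (hΔ0 : 0 < Δ) (hK₃ : 0 < K₃)
    (hK₂ : 0 < K₂) (ht : 0 ≤ t) (hx : 0 < x)
    (hΔ : 384 * (27 * K₃ / ε * (1 + K₂ / ε) ^ 5) ≤ Δ) (hl : l ≤ 5)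
    (ha : a ≤ t * (27 * (K₃ * x) / Δ)) (hq0 : 0 ≤ q) (hq : q ≤ K₂ * x) (hf : ε * x ≤ f) :
    a * q ^ l / f ^ (l + 1) ≤ 1 / 2 * (t / 192) := by
  calc a * q ^ l / f ^ (l + 1)
      ≤ (t * (27 * (K₃ * x) / Δ)) * (K₂ * x) ^ l / (ε * x) ^ (l + 1) := by gcongr
    _ = t * (27 * K₃ / ε * (K₂ / ε) ^ l) / Δ := by
        rw [div_pow, mul_pow, mul_pow, pow_succ, pow_succ]
        field_simp
    _ ≤ t * (27 * K₃ / ε * (1 + K₂ / ε) ^ 5) / Δ := by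
        gcongr
        calc (K₂ / ε) ^ l ≤ (1 + K₂ / ε) ^ l := by gcongr; linarith
          _ ≤ (1 + K₂ / ε) ^ 5 := by
            refine pow_le_pow_right₀ ?_ hl
            have : 0 ≤ K₂ / ε := by positivity
            linarith
    _ ≤ 1 / 2 * (t / 192) := by
        rw [div_le_iff₀ hΔ0]
        calc t * (27 * K₃ / ε * (1 + K₂ / ε) ^ 5)
            = 1 / 2 * (t / 192) * (384 * (27 * K₃ / ε * (1 + K₂ / ε) ^ 5)) := by ring
          _ ≤ _ := by gcongr

/-- With high probability, if there are `O(n)` stars and linearly many vertices in `S` of degree at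
least `Δ`, then there are few trails of length `l + 1` between such vertices. The switchings keep
the degree sequence, so the graphs are partitioned according to it. -/
lemma eventually_trails_le (hε : 0 < ε) (hC : 0 < C) {K₃ δ Δ : ℝ}
    (hK₃ : 0 < K₃) (hδ : 0 < δ) (hΔk : (k : ℝ) + 3 ≤ Δ)
    (hΔ : 384 * (27 * K₃ / ε * (1 + ((k + 3) ^ 2 * C + 27 * K₃) / ε) ^ 5) ≤ Δ)
    {l : ℕ} (hl : l < 6) {η : ℝ} (hη : 0 < η) :
    ∀ᶠ n : ℕ in atTop, ∀ (m : ℕ) (V : Type u) [Fintype V] (S : Finset V),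
      Admissible k ε α c C n S m →
        (((boundedCore V m k (degBound n)).filter fun G =>
          ∑ v ∈ Finset.univ.filter (fun v => k + 3 ≤ degIn G Finset.univ v),
              (degIn G Finset.univ v).choose 3 < ⌈K₃ * n⌉₊ ∧
            δ * n ≤ ((hiSet S ⌈Δ⌉₊ G).card : ℝ) ∧
            ((hiSet S ⌈Δ⌉₊ G).card : ℝ) / 96 ≤ (((trailPatterns (hiSet S ⌈Δ⌉₊ G) (l + 1)).filter
              fun x => SeqPresent x G).card : ℝ)).card : ℝ) ≤ η * (coreFin V m k).card := by
  have hΔ0 : 0 < Δ := lt_of_lt_of_le (by positivity) hΔk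
  set K₂ : ℝ := (k + 3) ^ 2 * C + 27 * K₃ with hK₂
  have hK₂0 : 0 < K₂ := by positivity
  clear_value K₂
  obtain ⟨j, hj⟩ := exists_pow_le (ρ := 1 / 2) (by norm_num) hη
  filter_upwards [eventually_mul_degBound_pow_le ((4 + 12 * j) / ε),
    eventually_mul_degBound_pow_le (192 * 49 * j / δ), eventually_le_degBound 1,
    eventually_ge_atTop 1] with n h1 h2 h3 h4
  intro m V _ S hA
  have hn : (0 : ℝ) < n := by exact_mod_cast h4
  have hm := hA.two_mul_edges_ge
  obtain ⟨hcn, hCn, -, -, -⟩ := hA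
  set M := degBound n with hM
  have hM1 : 1 ≤ M := by exact_mod_cast h3
  refine card_le_mul_card_of_fibers _ _ (fun G v => degIn G Finset.univ v) η fun d =>
    card_le_of_nonempty (by positivity) fun ⟨H, hH⟩ => ?_
  rw [Finset.mem_filter, Finset.mem_filter, mem_boundedCore] at hH
  obtain ⟨⟨⟨hHm, hHk, hHM⟩, hst, ht, -⟩, rfl⟩ := hH
  set d : V → ℕ := fun v => degIn H Finset.univ v with hd
  have hsum : ∑ v, d v = 2 * m := by rw [← hHm]; exact sum_degIn H
  rw [fixedDegree_eq_filter_coreFin hsum hHk]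
  set T := hiSet S ⌈Δ⌉₊ H with hT
  set t : ℝ := (T.card : ℝ) with htdef
  clear_value t
  have ht0 : 0 < t := lt_of_lt_of_le (by positivity) ht
  set X := ⌈t / 96⌉₊ with hX
  set Z := ∑ v ∈ Finset.univ.filter (fun v => k + 3 ≤ d v), (d v).choose 3 with hZ
  have hZn : (Z : ℝ) ≤ K₃ * n := (Nat.lt_ceil.1 hst).le
  -- the number of directed edges available to a switching
  set f : ℕ := 2 * m - 2 * ((M + 1) * M) - 2 * (j * (l + 1)) with hf
  clear_value f M
  have hMM : (2 * ((M + 1) * M) + 2 * (j * (l + 1)) : ℝ) ≤ ε * n := by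
    rw [div_mul_eq_mul_div, div_le_iff₀ hε] at h1
    have hl' : (l : ℝ) + 1 ≤ 6 := by exact_mod_cast hl
    have hM15 : (1 : ℝ) ≤ (M : ℝ) ^ 15 := one_le_pow₀ h3
    calc (2 * ((M + 1) * M) + 2 * (j * (l + 1)) : ℝ)
        ≤ 2 * ((M + M) * M) + 2 * (j * 6) := by gcongr
      _ = 4 * (M : ℝ) ^ 2 + 12 * j * 1 := by ring
      _ ≤ 4 * (M : ℝ) ^ 15 + 12 * j * (M : ℝ) ^ 15 := by gcongr; norm_num
      _ = (4 + 12 * j) * (M : ℝ) ^ 15 := by ring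
      _ ≤ ε * n := by linarith
  have hkN : (0 : ℝ) ≤ k * (Fintype.card V : ℝ) := by positivity
  have hεn : 0 < ε * n := by positivity
  have hle : 2 * ((M + 1) * M) + 2 * (j * (l + 1)) ≤ 2 * m := by
    have : (2 * ((M + 1) * M) + 2 * (j * (l + 1)) : ℝ) ≤ 2 * m := by linarith
    exact_mod_cast this
  have hfε : ε * n ≤ f := by
    have h7 : 2 * m ≤ f + (2 * ((M + 1) * M) + 2 * (j * (l + 1))) := by omega
    have h8 : (2 * m : ℝ) ≤ f + (2 * ((M + 1) * M) + 2 * (j * (l + 1))) := by exact_mod_cast h7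
    linarith
  have hf0 : 0 < f := by
    have : (0 : ℝ) < f := lt_of_lt_of_le (by positivity) hfε
    exact_mod_cast this
  have h := card_many_trails_mul_le (d := d) hHM hf0 T l j X (by rw [hsum]; omega)
  have hY : t / 192 ≤ ((X - j * ((l + 2) * ((l + 2) * M ^ (l + 1))) : ℕ) : ℝ) := by
    have h5 : (X : ℝ) - j * ((l + 2) * ((l + 2) * M ^ (l + 1))) ≤
        ((X - j * ((l + 2) * ((l + 2) * M ^ (l + 1))) : ℕ) : ℝ) := by
      rw [sub_le_iff_le_add]
      have : X ≤ X - j * ((l + 2) * ((l + 2) * M ^ (l + 1))) +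
        j * ((l + 2) * ((l + 2) * M ^ (l + 1))) := by omega
      exact_mod_cast this
    have h6 : (j : ℝ) * ((l + 2) * ((l + 2) * (M : ℝ) ^ (l + 1))) ≤ t / 192 := by
      rw [div_mul_eq_mul_div, div_le_iff₀ hδ] at h2
      have hl' : (l : ℝ) + 2 ≤ 7 := by
        have : (l : ℝ) + 1 ≤ 6 := by exact_mod_cast hl
        linarith
      have hp : (M : ℝ) ^ (l + 1) ≤ (M : ℝ) ^ 15 := pow_le_pow_right₀ h3 (by omega)
      calc (j : ℝ) * ((l + 2) * ((l + 2) * (M : ℝ) ^ (l + 1)))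
          ≤ j * (7 * (7 * (M : ℝ) ^ 15)) := by gcongr
        _ = 192 * 49 * j * (M : ℝ) ^ 15 / 192 := by ring
        _ ≤ t / 192 := by gcongr; linarith
    have h7 : t / 96 ≤ X := Nat.le_ceil _
    linarith
  -- by the bound on the stars, the squares of the degrees on `T` gain a factor `1 / Δ`
  have hTsq : ∑ v ∈ T, (d v : ℝ) ^ 2 ≤ 27 * (K₃ * n) / Δ := by
    refine le_trans (Finset.sum_le_sum_of_subset_of_nonneg (fun v hv => ?_) fun _ _ _ => sq_nonneg _)
      ((sum_sq_large_le hΔk d (X := Z) le_rfl).trans (by gcongr))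
    rw [hT, hiSet, Finset.mem_filter] at hv
    exact Finset.mem_filter.2 ⟨Finset.mem_univ _, Nat.ceil_le.1 hv.2⟩
  have hsq : ∑ v, (d v : ℝ) ^ 2 ≤ K₂ * n := by
    have h5 : (∑ v, (d v : ℝ) ^ 2) ≤ (k + 3) ^ 2 * Fintype.card V + 27 * (Z : ℝ) := by
      exact_mod_cast sum_sq_le (k := k) (X := Z) d le_rfl
    calc _ ≤ _ := h5
      _ ≤ (k + 3) ^ 2 * (C * n) + 27 * (K₃ * n) := by gcongr
      _ = K₂ * n := by rw [hK₂]; ring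
  have hmean : (∑ v ∈ T, (d v : ℝ)) ^ 2 * (∑ v, (d v : ℝ) ^ 2) ^ l / (f : ℝ) ^ (l + 1) ≤
      1 / 2 * (t / 192) := by
    refine trail_mean_le hε hΔ0 hK₃ hK₂0 ht0.le hn hΔ (by omega) ?_
      (Finset.sum_nonneg fun _ _ => sq_nonneg _) hsq hfε
    refine sq_sum_le_card_mul_sum_sq.trans ?_
    rw [← htdef]
    exact (mul_le_mul_of_nonneg_left hTsq ht0.le)
  have hYpos := lt_of_lt_of_le (show (0 : ℝ) < t / 192 by positivity) hY
  have hfin := le_pow_mul_of_mul_pow_le (ρ := 1 / 2) hYpos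
    (div_nonneg (mul_nonneg (sq_nonneg _) (pow_nonneg (Finset.sum_nonneg fun _ _ => sq_nonneg _) _))
      (pow_nonneg (Nat.cast_nonneg _) _)) (Nat.cast_nonneg _)
    (hmean.trans (mul_le_mul_of_nonneg_left hY (by norm_num))) h
  refine le_trans ?_ (hfin.trans (mul_le_mul_of_nonneg_right hj (Nat.cast_nonneg _)))
  rw [Nat.cast_le]
  refine Finset.card_le_card fun G hG => ?_
  rw [Finset.mem_filter, Finset.mem_filter] at hG
  have hdeg : ∀ v, degIn G Finset.univ v = d v := fun v => congrFun hG.2 v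
  have hTG : hiSet S ⌈Δ⌉₊ G = T := by
    rw [hT, hiSet, hiSet]
    simp only [hdeg, hd]
  have h9 := hG.1.2.2.2
  rw [hTG, ← htdef] at h9
  exact Finset.mem_filter.2 ⟨Finset.mem_filter.2 ⟨Finset.mem_univ _, hdeg⟩, Nat.ceil_le.2 h9⟩

/-- The probability that a vertex of degree at least `Δ` has few good neighbours is small if `Δ` is
large. -/
lemma fewGood_weight_le {Δ B N x m f₁ f₂ : ℝ} {D q : ℕ} (hε : 0 < ε) (hα1 : α < 1) (hΔ1 : 1 ≤ Δ)
    (hB : 0 ≤ B) (hΔ : 64 * (8 * B / ((1 - α) * ε)) ≤ √Δ) (hD : Δ ≤ D) (hq : (q : ℝ) ≤ 2 * √Δ)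
    (hN : 0 < N) (hx : 0 < x) (hm0 : 0 ≤ m) (hm : m ≤ B * x) (hf₁ : (1 - α) * N / 2 ≤ f₁)
    (hf₂ : ε * x ≤ f₂) : q * (2 * m) * N / (D * f₁ * f₂) ≤ 1 / 64 := by
  have hα' : 0 < 1 - α := by linarith
  have hs : 0 < √Δ := Real.sqrt_pos.2 (by linarith)
  have hf₁0 : 0 ≤ f₁ := le_trans (by positivity) hf₁
  calc q * (2 * m) * N / (D * f₁ * f₂)
      ≤ (2 * √Δ) * (2 * (B * x)) * N / (Δ * ((1 - α) * N / 2) * (ε * x)) := by gcongr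
    _ = (2 * √Δ) * (2 * (B * x)) * N / ((√Δ * √Δ) * ((1 - α) * N / 2) * (ε * x)) := by
        rw [Real.mul_self_sqrt (by linarith)]
    _ = 8 * B / ((1 - α) * ε) / √Δ := by
        field_simp
        ring
    _ ≤ 1 / 64 := by
        rw [div_le_iff₀ hs]
        linarith

/-- With high probability, if there are `O(n)` stars and linearly many vertices in `S` of degree at
least `Δ`, then only a small proportion of these have few good neighbours. The switchings keep the
set of these vertices, so the graphs are partitioned according to it. -/
lemma eventually_fewGood_le (hε : 0 < ε) (hα : 0 < α) (hα1 : α < 1) (hc : 0 < c) (hC : 0 < C)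
    {K₃ δ Δ : ℝ} (hδ : 0 < δ) (hΔk : (k : ℝ) + 3 ≤ Δ) (hΔ₁ : 54 * K₃ / ε ≤ Δ)
    (hΔ₂ : 64 * (8 * (k * C / 2 + 1 / ε) / ((1 - α) * ε)) ≤ √Δ) {η : ℝ} (hη : 0 < η) :
    ∀ᶠ n : ℕ in atTop, ∀ (m : ℕ) (V : Type u) [Fintype V] (S : Finset V),
      Admissible k ε α c C n S m →
        (((boundedCore V m k (degBound n)).filter fun G =>
          ∑ v ∈ Finset.univ.filter (fun v => k + 3 ≤ degIn G Finset.univ v),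
              (degIn G Finset.univ v).choose 3 < ⌈K₃ * n⌉₊ ∧
            δ * n ≤ ((hiSet S ⌈Δ⌉₊ G).card : ℝ) ∧
            ((hiSet S ⌈Δ⌉₊ G).card : ℝ) / 16 ≤ (((hiSet S ⌈Δ⌉₊ G).filter
              fun v => FewGood S (hiSet S ⌈Δ⌉₊ G) k ⌈√Δ⌉₊ v G).card : ℝ)).card : ℝ) ≤
          η * (coreFin V m k).card := by
  have hΔ1 : 1 ≤ Δ := by linarith [(Nat.cast_nonneg k : (0 : ℝ) ≤ k)]
  have hα' : 0 < 1 - α := by linarith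
  set B : ℝ := k * C / 2 + 1 / ε with hB
  have hB0 : 0 < B := by positivity
  obtain ⟨j, hj⟩ := exists_pow_le (ρ := 1 / 2) (by norm_num) hη
  filter_upwards [eventually_mul_degBound_pow_le (2 * (2 + j) / ε),
    eventually_mul_degBound_pow_le (4 * (j + 1) / ((1 - α) * c)), eventually_le_degBound 1,
    eventually_le_degBound (8 * B / ((1 - α) * c)), eventually_const_le (32 * j) hδ,
    eventually_ge_atTop 1] with n h1 h2 h3 h4 h5 h6
  intro m V _ S hA
  have hn : (0 : ℝ) < n := by exact_mod_cast h6
  have hm := hA.two_mul_edges_ge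
  have hmB := hA.edges_le
  rw [← hB] at hmB
  clear_value B
  obtain ⟨hcn, hCn, -, -, hS⟩ := hA
  generalize degBound n = M at h1 h2 h3 h4 ⊢
  have hM0 : (0 : ℝ) < M := by linarith
  have hMpow : ∀ i : ℕ, i ≤ 15 → (M : ℝ) ^ i ≤ (M : ℝ) ^ 15 := fun i hi =>
    pow_le_pow_right₀ h3 hi
  refine card_le_mul_card_of_fibers _ _ (fun G => hiSet S ⌈Δ⌉₊ G) η fun T =>
    card_le_of_nonempty (mul_nonneg hη.le (Nat.cast_nonneg _)) fun ⟨H, hH⟩ => ?_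
  rw [Finset.mem_filter, Finset.mem_filter] at hH
  obtain ⟨⟨-, -, ht, -⟩, hHT⟩ := hH
  rw [hHT] at ht
  obtain ⟨t, htdef⟩ : ∃ t : ℝ, t = T.card := ⟨_, rfl⟩
  rw [← htdef] at ht
  have ht0 : 0 < t := lt_of_lt_of_le (by positivity) ht
  set W := ⌊ε * n / 2⌋₊ with hW
  have hWle : (W : ℝ) ≤ ε * n / 2 := Nat.floor_le (by positivity)
  set h := 2 * m / M with hhdef
  have hcN : (1 - α) * (c * n) ≤ (1 - α) * Fintype.card V := by gcongr
  have hN0 : (0 : ℝ) < Fintype.card V := lt_of_lt_of_le (by positivity) hcn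
  -- the vertices and the directed edges available to a switching
  obtain ⟨f₁, hf₁⟩ : ∃ f₁, f₁ = Fintype.card V - (S.card + (j + 1) * M + h) := ⟨_, rfl⟩
  obtain ⟨f₂, hf₂⟩ : ∃ f₂, f₂ = 2 * m - (k * Fintype.card V + W + (M + 1) * M + j * M) := ⟨_, rfl⟩
  have hlow₁ : (S.card + (j + 1) * M + h : ℝ) ≤ Fintype.card V - (1 - α) * Fintype.card V / 2 := by
    have h7 : (S.card : ℝ) ≤ α * Fintype.card V := by
      rw [hS]
      exact Nat.floor_le (by positivity)
    have h8 : ((j + 1) * M : ℝ) ≤ (1 - α) * c * n / 4 := by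
      rw [div_mul_eq_mul_div, div_le_iff₀ (by positivity)] at h2
      have := hMpow 1 (by norm_num)
      rw [pow_one] at this
      have h9 : (4 * (j + 1) * M : ℝ) ≤ 4 * (j + 1) * (M : ℝ) ^ 15 := by gcongr
      linarith
    have h9 : (h : ℝ) ≤ (1 - α) * c * n / 4 := by
      rw [div_le_iff₀ (by positivity)] at h4
      calc (h : ℝ) ≤ ((2 * m : ℕ) : ℝ) / M := Nat.cast_div_le
        _ = 2 * m / M := by push_cast; rfl
        _ ≤ 2 * (B * n) / M := by gcongr
        _ ≤ (1 - α) * c * n / 4 := by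
          rw [div_le_iff₀ hM0]
          calc 2 * (B * n) = 8 * B * (n / 4) := by ring
            _ ≤ (M * ((1 - α) * c)) * (n / 4) := by gcongr
            _ = _ := by ring
    linarith
  have hlow₂ : (k * Fintype.card V + W + (M + 1) * M + j * M : ℝ) ≤ 2 * m - ε * n := by
    have h7 : ((M + 1) * M + j * M : ℝ) ≤ ε * n / 2 := by
      rw [div_mul_eq_mul_div, div_le_iff₀ hε] at h1
      have h8 := hMpow 1 (by norm_num)
      have h9 := hMpow 2 (by norm_num)
      rw [pow_one] at h8
      have h10 : (j * M : ℝ) ≤ j * (M : ℝ) ^ 15 := by gcongr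
      linarith
    linarith
  have hεn : 0 < ε * n := by positivity
  have hle₁ : S.card + (j + 1) * M + h ≤ Fintype.card V := by
    have : 0 ≤ (1 - α) * (Fintype.card V : ℝ) / 2 := by positivity
    have : (S.card + (j + 1) * M + h : ℝ) ≤ Fintype.card V := by linarith
    exact_mod_cast this
  have hle₂ : k * Fintype.card V + W + (M + 1) * M + j * M ≤ 2 * m := by
    have : (k * Fintype.card V + W + (M + 1) * M + j * M : ℝ) ≤ 2 * m := by linarith
    exact_mod_cast this
  have hf₁ge : (1 - α) * (Fintype.card V : ℝ) / 2 ≤ f₁ := by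
    rw [hf₁, Nat.cast_sub hle₁]
    push_cast
    linarith
  have hf₂ge : ε * n ≤ f₂ := by
    rw [hf₂, Nat.cast_sub hle₂]
    push_cast
    linarith
  have hf₁0 : 0 < f₁ := by
    have : (0 : ℝ) < f₁ := lt_of_lt_of_le (by positivity) hf₁ge
    exact_mod_cast this
  have hf₂0 : 0 < f₂ := by
    have : (0 : ℝ) < f₂ := lt_of_lt_of_le (by positivity) hf₂ge
    exact_mod_cast this
  have hD : Δ ≤ ⌈Δ⌉₊ := Nat.le_ceil _
  have hD0 : 0 < ⌈Δ⌉₊ := Nat.ceil_pos.2 (by linarith)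
  have hq : (⌈√Δ⌉₊ : ℝ) ≤ 2 * √Δ := by
    have h7 : 1 ≤ √Δ := Real.one_le_sqrt.2 hΔ1
    have h8 := (Nat.ceil_lt_add_one (Real.sqrt_nonneg Δ)).le
    linarith
  have hhM : 2 * m < (h + 1) * M := by
    have hMN : 0 < M := by exact_mod_cast hM0
    rw [mul_comm (h + 1)]
    exact Nat.lt_mul_div_succ _ hMN
  set X := ⌈t / 16⌉₊ with hX
  have hmain := card_many_fewGood_mul_le (k := k) (q := ⌈√Δ⌉₊) (D := ⌈Δ⌉₊) (T := T) hhM (j := j)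
    (f₁ := f₁) (S := S) (by omega) (f₂ := f₂) (W := W) (by omega) hD0 hf₁0 hf₂0
    (fewGood_weight_le hε hα1 hΔ1 hB0.le hΔ₂ hD hq hN0 hn (Nat.cast_nonneg m) hmB hf₁ge hf₂ge) X
  rw [← htdef] at hmain
  have hY : t / 32 ≤ ((X - j : ℕ) : ℝ) := by
    have h7 : (X : ℝ) ≤ ((X - j : ℕ) : ℝ) + j := by
      have : X ≤ X - j + j := by omega
      exact_mod_cast this
    have h8 : t / 16 ≤ X := Nat.le_ceil _
    linarith
  have hfin := le_pow_mul_of_mul_pow_le (ρ := 1 / 2) (lt_of_lt_of_le (by positivity) hY)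
    (by positivity) (Nat.cast_nonneg _) (by linarith) hmain
  have hsub : profileEvent m k M ⌈Δ⌉₊ W S T ⊆
      (coreFin V m k).filter fun G => hiSet S ⌈Δ⌉₊ G = T := by
    intro G hG
    rw [profileEvent, Finset.mem_filter, boundedCore, Finset.mem_filter] at hG
    exact Finset.mem_filter.2 ⟨hG.1.1, hG.2.1⟩
  have hcard : ((profileEvent m k M ⌈Δ⌉₊ W S T).card : ℝ) ≤
      ((coreFin V m k).filter fun G => hiSet S ⌈Δ⌉₊ G = T).card := by
    exact_mod_cast Finset.card_le_card hsub
  refine le_trans ?_ (hfin.trans (mul_le_mul hj hcard (Nat.cast_nonneg _) hη.le))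
  rw [Nat.cast_le]
  refine Finset.card_le_card fun G hG => ?_
  rw [Finset.mem_filter, Finset.mem_filter] at hG
  obtain ⟨⟨hGb, hst, -, hfew⟩, hGT⟩ := hG
  rw [hGT, ← htdef] at hfew
  rw [Finset.mem_filter, profileEvent, Finset.mem_filter]
  refine ⟨⟨hGb, hGT, Nat.le_floor ?_⟩, Nat.ceil_le.2 hfew⟩
  have hΔ0 : 0 < Δ := by linarith
  -- the degrees on `T` sum to at most half of the excess `ε n`
  push_cast
  calc ∑ v ∈ T, (degIn G Finset.univ v : ℝ) ≤ ∑ v ∈ T, (degIn G Finset.univ v : ℝ) ^ 2 := by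
        refine Finset.sum_le_sum fun v _ => ?_
        exact_mod_cast Nat.le_self_pow two_ne_zero _
    _ ≤ 27 * (K₃ * n) / Δ := by
        refine le_trans (Finset.sum_le_sum_of_subset_of_nonneg (fun v hv => ?_)
          fun _ _ _ => sq_nonneg _)
          ((sum_sq_large_le hΔk (fun v => degIn G Finset.univ v) le_rfl).trans ?_)
        · rw [← hGT, hiSet, Finset.mem_filter] at hv
          exact Finset.mem_filter.2 ⟨Finset.mem_univ _, Nat.ceil_le.1 hv.2⟩
        · gcongr
          exact (Nat.lt_ceil.1 hst).le
    _ ≤ ε * n / 2 := by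
        rw [div_le_iff₀ hε] at hΔ₁
        rw [div_le_iff₀ hΔ0]
        calc 27 * (K₃ * n) = (54 * K₃) * (n / 2) := by ring
          _ ≤ (Δ * ε) * (n / 2) := by gcongr
          _ = _ := by ring

end Typical

/-! ### Typical graphs -/

section Probability

open scoped Classical
open Filter

variable {k : ℕ} {ε α c C : ℝ}

lemma one_sub_le_coreLaw_real {V : Type u} [Fintype V] {m : ℕ} {η : ℝ}
    {P : SimpleGraph V → Prop} (hne : (coreFin V m k).Nonempty)
    (h : (((coreFin V m k).filter fun G => ¬ P G).card : ℝ) ≤ η * (coreFin V m k).card) :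
    1 - η ≤ (coreLaw V m k).real {G | P G} := by
  have hcoe : coreGraphs V m k = (coreFin V m k : Set (SimpleGraph V)) := by
    ext G
    rw [Finset.mem_coe, mem_coreFin, mem_coreGraphs]
  have hset : {G | P G} = ((Finset.univ.filter P : Finset (SimpleGraph V)) : Set _) := by
    ext G
    simp
  have hpos : (0 : ℝ) < (coreFin V m k).card := by exact_mod_cast hne.card_pos
  have hsplit := Finset.card_filter_add_card_filter_not (s := coreFin V m k) P
  have hsplit' : (((coreFin V m k).filter P).card : ℝ) +
      ((coreFin V m k).filter fun G => ¬ P G).card = (coreFin V m k).card := by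
    exact_mod_cast hsplit
  rw [Measure.real, coreLaw, hcoe, hset, uniformOn_apply_finset, ENNReal.toReal_div,
    ENNReal.toReal_natCast, ENNReal.toReal_natCast, Finset.inter_filter, Finset.inter_univ,
    le_div_iff₀ hpos]
  linarith

/-- With high probability at most an eighth of the vertices of `T` are lost in `T'`. The bound on `Δ`
makes each expected loss smaller than half of what is allowed. -/
lemma exists_eventually_refinedSet_ge (hε : 0 < ε) (hα : 0 < α) (hα1 : α < 1) (hc : 0 < c)
    (hC : 0 < C) : ∃ Δ₀ : ℝ, ∀ Δ : ℝ, Δ₀ ≤ Δ → ∀ η : ℝ, 0 < η →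
      ∀ᶠ n : ℕ in atTop, ∀ (m : ℕ) (V : Type u) [Fintype V] (S : Finset V),
        Admissible k ε α c C n S m →
          (((coreFin V m k).filter fun G => ¬ 7 / 8 * ((highSet S Δ G).card : ℝ) ≤
            ((refinedSet S Δ k G).card : ℝ)).card : ℝ) ≤ η * (coreFin V m k).card := by
  obtain ⟨K₃, hK₃, hstars⟩ := exists_eventually_stars_le.{u} (k := k) (α := α) hε hc hC
  refine ⟨max (max (k + 3) (384 * (27 * K₃ / ε * (1 + ((k + 3) ^ 2 * C + 27 * K₃) / ε) ^ 5)))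
    (max (54 * K₃ / ε) ((64 * (8 * (k * C / 2 + 1 / ε) / ((1 - α) * ε))) ^ 2)),
    fun Δ hΔ η hη => ?_⟩
  obtain ⟨⟨hΔk, hΔt⟩, hΔs, hΔf⟩ : ((k : ℝ) + 3 ≤ Δ ∧ _ ≤ Δ) ∧ _ ≤ Δ ∧ _ ≤ Δ :=
    ⟨max_le_iff.1 (max_le_iff.1 hΔ).1, max_le_iff.1 (max_le_iff.1 hΔ).2⟩
  obtain ⟨δ, hδ, hlarge⟩ :=
    exists_eventually_hiSet_ge.{u} (k := k) (ε := ε) hε hα hc hC ⌈Δ⌉₊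
  have hη' : 0 < η / 10 := by positivity
  have htrails : ∀ᶠ n : ℕ in atTop, ∀ l ∈ Finset.range 6, _ :=
    (Finset.eventually_all _).2 fun l hl =>
      eventually_trails_le.{u} (α := α) (c := c) hε hC hK₃ hδ hΔk hΔt (Finset.mem_range.1 hl) hη'
  filter_upwards [eventually_degree_le.{u} (k := k) (α := α) hε hc hC hη', hstars _ hη',
    hlarge _ hη', htrails, eventually_fewGood_le.{u} hε hα hα1 hc hC hδ hΔk hΔs
      (Real.le_sqrt_of_sq_le hΔf) hη'] with n h1 h2 h3 h4 h5
  intro m V _ S hA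
  specialize h1 m V S hA
  specialize h2 m V S hA
  specialize h3 m V S hA
  specialize h5 m V S hA
  set A₁ := (coreFin V m k).filter fun G => ∃ v, degBound n + 1 ≤ degIn G Finset.univ v with hA₁
  set A₂ := (boundedCore V m k (degBound n)).filter fun G => ⌈K₃ * n⌉₊ ≤
    ∑ v ∈ Finset.univ.filter (fun v => k + 3 ≤ degIn G Finset.univ v),
      (degIn G Finset.univ v).choose 3 with hA₂
  set A₃ := (boundedCore V m k (degBound n)).filter fun G =>
    ((hiSet S ⌈Δ⌉₊ G).card : ℝ) < δ * n with hA₃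
  set A₄ : ℕ → Finset (SimpleGraph V) := fun l =>
    (boundedCore V m k (degBound n)).filter fun G =>
      ∑ v ∈ Finset.univ.filter (fun v => k + 3 ≤ degIn G Finset.univ v),
          (degIn G Finset.univ v).choose 3 < ⌈K₃ * n⌉₊ ∧
        δ * n ≤ ((hiSet S ⌈Δ⌉₊ G).card : ℝ) ∧
        ((hiSet S ⌈Δ⌉₊ G).card : ℝ) / 96 ≤ (((trailPatterns (hiSet S ⌈Δ⌉₊ G) (l + 1)).filter
          fun x => SeqPresent x G).card : ℝ) with hA₄
  set A₅ := (boundedCore V m k (degBound n)).filter fun G =>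
    ∑ v ∈ Finset.univ.filter (fun v => k + 3 ≤ degIn G Finset.univ v),
        (degIn G Finset.univ v).choose 3 < ⌈K₃ * n⌉₊ ∧
      δ * n ≤ ((hiSet S ⌈Δ⌉₊ G).card : ℝ) ∧
      ((hiSet S ⌈Δ⌉₊ G).card : ℝ) / 16 ≤ (((hiSet S ⌈Δ⌉₊ G).filter
        fun v => FewGood S (hiSet S ⌈Δ⌉₊ G) k ⌈√Δ⌉₊ v G).card : ℝ) with hA₅
  have h4' : ∀ l ∈ Finset.range 6, ((A₄ l).card : ℝ) ≤ η / 10 * (coreFin V m k).card :=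
    fun l hl => h4 l hl m V S hA
  have hsub : ((coreFin V m k).filter fun G => ¬ 7 / 8 * ((highSet S Δ G).card : ℝ) ≤
      ((refinedSet S Δ k G).card : ℝ)) ⊆ A₁ ∪ (A₂ ∪ (A₃ ∪ ((Finset.range 6).biUnion A₄ ∪ A₅))) := by
    intro G hG
    rw [Finset.mem_filter] at hG
    obtain ⟨hGc, hGP⟩ := hG
    by_contra hbad
    simp only [Finset.mem_union, Finset.mem_biUnion, not_or, not_exists, not_and] at hbad
    obtain ⟨g1, g2, g3, g4, g5⟩ := hbad
    have hb : G ∈ boundedCore V m k (degBound n) := by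
      refine Finset.mem_filter.2 ⟨hGc, fun v => ?_⟩
      by_contra! hv
      exact g1 (Finset.mem_filter.2 ⟨hGc, v, hv⟩)
    have e2 := not_le.1 fun h => g2 (Finset.mem_filter.2 ⟨hb, h⟩)
    have e3 := not_lt.1 fun h => g3 (Finset.mem_filter.2 ⟨hb, h⟩)
    have e4 := fun l hl => not_le.1 fun h => g4 l hl (Finset.mem_filter.2 ⟨hb, e2, e3, h⟩)
    have e5 := not_le.1 fun h => g5 (Finset.mem_filter.2 ⟨hb, e2, e3, h⟩)
    have hcount := card_highSet_le (S := S) (Δ := Δ) (mem_coreFin.1 hGc).2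
    rw [highSet_eq_hiSet] at hcount hGP
    have hcount' : ((hiSet S ⌈Δ⌉₊ G).card : ℝ) ≤ (refinedSet S Δ k G).card +
        ((∑ l ∈ Finset.range 6, (((trailPatterns (hiSet S ⌈Δ⌉₊ G) (l + 1)).filter
          fun x => SeqPresent x G).card : ℝ)) + ((hiSet S ⌈Δ⌉₊ G).filter
            fun v => FewGood S (hiSet S ⌈Δ⌉₊ G) k ⌈√Δ⌉₊ v G).card) := by
      exact_mod_cast hcount
    have hsum := Finset.sum_le_sum fun l hl => (e4 l hl).le
    rw [Finset.sum_const, Finset.card_range, nsmul_eq_mul] at hsum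
    push_cast at hsum
    -- the six lengths of trails cost at most `1 / 96` each, the few good neighbours `1 / 16`
    exact hGP (by linarith)
  have hcard : ((coreFin V m k).filter fun G => ¬ 7 / 8 * ((highSet S Δ G).card : ℝ) ≤
      ((refinedSet S Δ k G).card : ℝ)).card ≤
      A₁.card + (A₂.card + (A₃.card + (∑ l ∈ Finset.range 6, (A₄ l).card + A₅.card))) := by
    refine (Finset.card_le_card hsub).trans ((Finset.card_union_le _ _).trans ?_)
    gcongr
    refine (Finset.card_union_le _ _).trans ?_
    gcongr
    refine (Finset.card_union_le _ _).trans ?_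
    gcongr
    refine (Finset.card_union_le _ _).trans ?_
    gcongr
    exact Finset.card_biUnion_le
  have hcard' : (((coreFin V m k).filter fun G => ¬ 7 / 8 * ((highSet S Δ G).card : ℝ) ≤
      ((refinedSet S Δ k G).card : ℝ)).card : ℝ) ≤ A₁.card + (A₂.card + (A₃.card +
        (∑ l ∈ Finset.range 6, ((A₄ l).card : ℝ) + A₅.card))) := by
    exact_mod_cast hcard
  have hsum := Finset.sum_le_sum h4'
  rw [Finset.sum_const, Finset.card_range, nsmul_eq_mul] at hsum
  push_cast at hsum
  linarith

/-- For `n` large the law is a probability measure, so that probabilities are not junk values. -/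
lemma eventually_coreFin_nonempty (hε : 0 < ε) (hc : 0 < c) (hC : 0 < C) :
    ∀ᶠ n : ℕ in atTop, ∀ (m : ℕ) (V : Type u) [Fintype V] (S : Finset V),
      Admissible k ε α c C n S m → (coreFin V m k).Nonempty := by
  obtain ⟨K, hK, hev⟩ := eventually_exists_factors.{u} (k := k) (α := α) hε hc hC
  filter_upwards [hev, eventually_const_le (2 * k) hc,
    eventually_const_le (2 * k ^ 2 : ℝ) (show 0 < 2 * ε by positivity)] with n h1 h2 h3
  intro m V _ S hA
  obtain ⟨f, g, -, -, hfN, -⟩ := h1 m V S hA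
  have h4 := hA.two_mul_edges_ge
  refine coreFin_nonempty ?_ ?_ (by omega)
  · exact_mod_cast h2.trans hA.1
  · have : (k * Fintype.card V + 2 * k ^ 2 : ℝ) ≤ 2 * m := by linarith
    exact_mod_cast this

end Probability

end Extraction


theorem lemma8p1 (k : ℕ) (hk : 3 ≤ k) (ε α c C : ℝ) (hε : 0 < ε) (hα : 0 < α) (hα1 : α < 1)
    (hc : 0 < c) (hC : 0 < C) :
    ∃ Δ₀ : ℝ, ∀ Δ : ℝ, Δ₀ ≤ Δ → (k : ℝ) ≤ Δ →
      -- parts (1), (2) and (4)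
      (∀ (n m : ℕ) (V : Type u) [Fintype V] (S : Finset V), Admissible k ε α c C n S m →
        (∀ G ∈ coreGraphs V m k, ∀ U : Finset V, (∀ v, v ∉ refinedSet S Δ k G → v ∈ U) →
          (∀ v ∈ U, 2 ≤ degIn G U v) ∧
          ∀ u ∈ U, ∀ v ∈ U, u ≠ v → degIn G U u = 2 → degIn G U v = 2 →
            ¬ WithinDist G U 4 u v) ∧
        (∀ G ∈ coreGraphs V m k, ∀ v ∈ refinedSet S Δ k G,
          √Δ ≤ (degIn G (freeSet S Δ k G) v : ℝ)) ∧
        (∀ H ∈ coreGraphs V m k,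
          iIndepFun
            (fun (v : {v // v ∈ refinedSet S Δ k H}) (G : SimpleGraph V) =>
              nbhd G (freeSet S Δ k G) v)
            (cond (coreLaw V m k) (revealed S Δ k H)) ∧
          ∀ v ∈ refinedSet S Δ k H,
            (cond (coreLaw V m k) (revealed S Δ k H)).map
                (fun G => nbhd G (freeSet S Δ k G) v) =
              uniformOn
                (((freeSet S Δ k H).powersetCard (degIn H (freeSet S Δ k H) v) :
                  Finset (Finset V)) : Set (Finset V)))) ∧
      -- part (3): with high probability as `n → ∞`
      (∀ η : ℝ, 0 < η → ∃ N : ℕ, ∀ (n m : ℕ) (V : Type u) [Fintype V] (S : Finset V),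
        N ≤ n → Admissible k ε α c C n S m →
          1 - η ≤ (coreLaw V m k).real
            {G | 7 / 8 * ((highSet S Δ G).card : ℝ) ≤ ((refinedSet S Δ k G).card : ℝ)}) := by
  obtain ⟨Δ₀, hΔ₀⟩ := exists_eventually_refinedSet_ge.{u} (k := k) hε hα hα1 hc hC
  refine ⟨Δ₀, fun Δ hΔ _ => ⟨fun n m V _ S _ => ⟨fun G hG U hU => ?_,
    fun G _ v hv => sqrt_le_degIn_freeSet hv, fun H hH => nbhd_indep_uniform hH⟩, fun η hη => ?_⟩⟩
  · exact minDegree_and_separation hk (mem_coreGraphs.1 hG).2 hU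
  · obtain ⟨N, hN⟩ := Filter.eventually_atTop.1 ((hΔ₀ Δ hΔ η hη).and
      (eventually_coreFin_nonempty.{u} (k := k) (α := α) hε hc hC))
    exact ⟨N, fun n m V _ S hn hA =>
      one_sub_le_coreLaw_real ((hN n hn).2 m V S hA) ((hN n hn).1 m V S hA)⟩
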